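/- Let $n\ge 2$ be an integer and let $\mathrm{U}_n$ be the group of unitary $n\times n$ complex matrices. Write $\mathrm{Irr}(\mathrm{U}_n)$ for the set of characters of continuous irreducible finite-dimensional complex representations of $\mathrm{U}_n$, and let $\log$ denote the logarithm to base $2$. Eigenvalues of $g\in \mathrm{U}_n$ are counted with multiplicity, so that there are $n$ of them. Given $\epsilon>0$, $g\in\mathrm{U}_n$ is called $(\gamma,\epsilon)$-separated, for $0<\gamma<\frac12$, if its eigenvalues can be divided into two parts $Q,R$ with $|Q|,|R|\ge\gamma n$ such that every element of $Q$ is at distance at least $\epsilon$ (in $\mathbb{C}$) from every element of $R$; it is called $(\beta,\epsilon)$-spread, for $0<\beta<1$, if every arc of length $2\epsilon$ of the unit circle contains at most $(1-\beta)n$ of its eigenvalues. Let $\rho\in\mathrm{Irr}(\mathrm{U}_n)$ and $g\in\mathrm{U}_n$. (1) Let $0<\gamma<\frac12$ and $\epsilon=\rho(1)^{-\gamma(1-\gamma)/n^2}$. If $\rho(1)>2^{\frac{16}{\gamma}n^2\log n}$ and $g$ is $(\gamma,\epsilon)$-separated, then $$|\rho(g)|\le\rho(1)^{1-\frac12\gamma(1-\gamma)}.$$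 (2) Let $0<\beta<1$ and $\epsilon=\rho(1)^{-\frac18\beta(2-\beta)/n^2}$. If $\rho(1)>2^{\frac{8}{\beta}n^2\log n}$ and $g$ is $(\beta,\epsilon)$-spread, then $$|\rho(g)|\le\rho(1)^{1-\frac{\beta(2-\beta)}{8}}.$$ -/

import Mathlib

namespace UnitaryChar

/-- `Irr G`: the irreducible (complex) characters of the topological group `G`, that is, the
characters of its continuous finite-dimensional irreducible complex representations. Every such
representation can be realized on some `ℂ^d`. -/
def Irr (G : Type*) [Group G] [TopologicalSpace G] : Set (G → ℂ) :=
  {χ | ∃ (d : ℕ) (π : Representation ℂ G (Fin d → ℂ)),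
    π.IsIrreducible ∧ (∀ v, Continuous fun g => π g v) ∧ χ = π.character}

/-- The degree `χ(1)` of a character, as a real number. -/
def degree {G : Type*} [Group G] (χ : G → ℂ) : ℝ := (χ 1).re

/-- The degree is really the value at `1`, a natural number. -/
theorem degree_spec {G : Type*} [Group G] [TopologicalSpace G] {χ : G → ℂ} (hχ : χ ∈ Irr G) :
    ((degree χ : ℝ) : ℂ) = χ 1 ∧ ∃ d : ℕ, degree χ = d := by
  obtain ⟨d, π, -, -, rfl⟩ := hχ
  simp [degree]

/-- The unitary group `U_n`. -/
abbrev U (n : ℕ) : Type := Matrix.unitaryGroup (Fin n) ℂ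

/-- The eigenvalues of `g ∈ U_n`, as a multiset (counted with multiplicity; there are `n`). -/
noncomputable def eigenvalues {n : ℕ} (g : U n) : Multiset ℂ :=
  (g : Matrix (Fin n) (Fin n) ℂ).charpoly.roots

/-- `(γ, ε)`-separated: the eigenvalues, with multiplicity, split into two parts, each of size
at least `γ n`, at mutual distance at least `ε` in `ℂ`. -/
def IsSeparated {n : ℕ} (γ ε : ℝ) (g : U n) : Prop :=
  ∃ Q R : Multiset ℂ, Q + R = eigenvalues g ∧
    γ * n ≤ (Multiset.card Q : ℝ) ∧ γ * n ≤ (Multiset.card R : ℝ) ∧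
    ∀ a ∈ Q, ∀ b ∈ R, ε ≤ ‖a - b‖

/-- The closed arc of the unit circle that starts at the angle `a` and has length `l`. -/
def arc (a l : ℝ) : Set ℂ := (fun θ : ℝ => Complex.exp (θ * Complex.I)) '' Set.Icc a (a + l)

open Classical in
/-- `(β, ε)`-spread: every arc of length `2 ε` of the unit circle contains at most `(1 - β) n`
of the eigenvalues, counted with multiplicity. -/
def IsSpread {n : ℕ} (β ε : ℝ) (g : U n) : Prop :=
  ∀ a : ℝ, ((eigenvalues g).countP (fun z => z ∈ arc a (2 * ε)) : ℝ) ≤ (1 - β) * n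

end UnitaryChar

/-! ### Compactness of `U n` and the dense algebra of polynomials in entries and conjugates -/

namespace UnitaryChar

open MeasureTheory

/-! The character is a ratio of two determinants, and it is estimated by expanding the numerator
along the splitting of the eigenvalues. Write `n = a + b` with `a = |Q|`, `b = |R|`, and let `l` be
the `n` distinct exponents in the Weyl character formula. The Laplace expansion of `det (x_i ^ l_j)`
along the rows of `Q` is a sum over ways to split `l` into blocks of sizes `a` and `b`. Each smaller
alternant, divided by its own Vandermonde determinant, is a Schur polynomial, and on the unit torus
it is at most its value at one, a Vandermonde determinant of exponents over a product of factorials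
(`norm_det_pow_le`).

Compared with the degree, which by `weyl_dimension` is the Vandermonde determinant of all of `l`
over factorials, every term lacks the product `K` of differences between the two exponent blocks.
Differences inside one block are controlled by differences to the other block, so `K` is at least
about `ρ(1) ^ (ab/n²)` (`vnorm_sumElim_pow_le`). On the eigenvalue side the cross differences remain
in the denominator, each at least `ε`. The result is `|ρ(g)| ε^(ab) ≤ n^(2ab) ρ(1)^(1 - ab/n²)`
(`norm_trace_mul_cross_le_degree`, `norm_mul_pow_card_le`). Since `ab/n² ≥ γ(1-γ)`, the choice of
`ε` and the lower bound on the degree turn this into (1).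

For (2), a spread element is separated: cut the circle at a gap of the eigenvalue angles between two
quantiles, and at a second gap coming from pigeonhole. With `γ = β/2` the distance obtained is `ε²`,
exactly the distance needed for (1) (`IsSpread.isSeparated`).

The Weyl formulas are proved from scratch. Matrix coefficients of a continuous representation are
polynomial up to a power of the determinant, by Stone–Weierstrass and convolution, and the unitary
group is Zariski dense, so the representation extends to all matrices. Differentiation gives an
action of `gl n`, hence a highest weight of multiplicity one. The Casimir element makes character
times Vandermonde an eigenfunction of the torus Laplacian. An antisymmetric eigenfunction with a
dominant leading exponent must be a single alternant (`weyl_character`). -/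

theorem norm_entry_le_one {n : ℕ} (g : U n) (i j : Fin n) :
    ‖(g : Matrix (Fin n) (Fin n) ℂ) i j‖ ≤ 1 := by
  have h : ((g : Matrix (Fin n) (Fin n) ℂ) * star (g : Matrix (Fin n) (Fin n) ℂ)) i i = 1 := by
    rw [Matrix.mem_unitaryGroup_iff.mp g.2]; simp
  rw [Matrix.mul_apply] at h
  have h2 : ∑ k, ‖(g : Matrix (Fin n) (Fin n) ℂ) i k‖ ^ 2 = 1 := by
    have : ((∑ k, ‖(g : Matrix (Fin n) (Fin n) ℂ) i k‖ ^ 2 : ℝ) : ℂ) = 1 := by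
      rw [← h]; push_cast
      refine Finset.sum_congr rfl fun k _ => ?_
      rw [Matrix.star_apply, ← Complex.mul_conj']; rfl
    exact_mod_cast this
  have h3 := Finset.single_le_sum (f := fun k => ‖(g : Matrix (Fin n) (Fin n) ℂ) i k‖ ^ 2)
    (fun k _ => sq_nonneg _) (Finset.mem_univ j)
  rw [h2] at h3
  exact (sq_le_one_iff₀ (norm_nonneg _)).mp h3

/-- Compactness supplies Stone–Weierstrass, finiteness of Haar measure and the boundedness of
continuous representations. -/
instance compactSpace_U (n : ℕ) : CompactSpace (U n) := by
  refine isCompact_iff_compactSpace.mp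
    (?_ : IsCompact (unitary (Matrix (Fin n) (Fin n) ℂ) : Set (Matrix (Fin n) (Fin n) ℂ)))
  have hK : IsCompact (Set.pi Set.univ fun _ : Fin n => Set.pi Set.univ fun _ : Fin n =>
      Metric.closedBall (0 : ℂ) 1) :=
    isCompact_univ_pi fun _ => isCompact_univ_pi fun _ => isCompact_closedBall _ _
  refine IsCompact.of_isClosed_subset (s := (Set.pi Set.univ fun _ : Fin n =>
    Set.pi Set.univ fun _ : Fin n => Metric.closedBall (0 : ℂ) 1)) hK
    (isClosed_unitary (R := Matrix (Fin n) (Fin n) ℂ)) ?_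
  intro g hg i _ j _
  simpa using norm_entry_le_one ⟨g, hg⟩ i j

/-- The matrix entry `g ↦ g i j` as a continuous function on `U n`. -/
def entry {n : ℕ} (i j : Fin n) : C(U n, ℂ) where
  toFun g := (g : Matrix (Fin n) (Fin n) ℂ) i j
  continuous_toFun := by
    have : Continuous fun g : U n => (g : Matrix (Fin n) (Fin n) ℂ) := continuous_subtype_val
    exact this.matrix_elem i j

/-- The star-algebra generated by the matrix entries: polynomials in the entries and their
conjugates. -/
noncomputable def entryAlgebra (n : ℕ) : StarSubalgebra ℂ C(U n, ℂ) :=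
  StarAlgebra.adjoin ℂ (Set.range fun p : Fin n × Fin n => entry p.1 p.2)

theorem entry_mem {n : ℕ} (i j : Fin n) : entry i j ∈ entryAlgebra n :=
  StarAlgebra.subset_adjoin _ _ ⟨(i, j), rfl⟩

theorem entryAlgebra_dense (n : ℕ) : (entryAlgebra n).topologicalClosure = ⊤ := by
  apply ContinuousMap.starSubalgebra_topologicalClosure_eq_top_of_separatesPoints
  intro g h hgh
  have : ∃ i j, (g : Matrix (Fin n) (Fin n) ℂ) i j ≠ (h : Matrix (Fin n) (Fin n) ℂ) i j := by
    by_contra! hc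
    exact hgh (Subtype.ext (by ext i j; exact hc i j))
  obtain ⟨i, j, hij⟩ := this
  exact ⟨entry i j, ⟨entry i j, entry_mem i j, rfl⟩, hij⟩

/-- On the unitary group a polynomial in the entries and their conjugates becomes a polynomial in
the entries after multiplication by a power of the determinant. -/
theorem exists_polynomial_of_mem {n : ℕ} {f : C(U n, ℂ)} (hf : f ∈ entryAlgebra n) :
    ∃ (N : ℕ) (p : MvPolynomial (Fin n × Fin n) ℂ), ∀ g : U n,
      (g : Matrix (Fin n) (Fin n) ℂ).det ^ N * f g =
        p.eval fun q => (g : Matrix (Fin n) (Fin n) ℂ) q.1 q.2 := by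
  have hdet : ∀ g : U n, (MvPolynomial.eval fun q => (g : Matrix (Fin n) (Fin n) ℂ) q.1 q.2)
      (Matrix.det (Matrix.of fun i j => (MvPolynomial.X (i, j) : MvPolynomial (Fin n × Fin n) ℂ)))
      = (g : Matrix (Fin n) (Fin n) ℂ).det := by
    intro g
    rw [RingHom.map_det]
    congr 1; ext i j; simp
  rw [entryAlgebra, ← StarSubalgebra.mem_toSubalgebra, StarAlgebra.adjoin_toSubalgebra] at hf
  induction hf using Algebra.adjoin_induction with
  | mem f hf =>
    rcases hf with ⟨⟨i, j⟩, rfl⟩ | hf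
    · exact ⟨0, MvPolynomial.X (i, j), fun g => by simp [entry]⟩
    · obtain ⟨⟨i, j⟩, hf⟩ := hf
      -- The conjugate of the entry `(i, j)` is the entry `(j, i)` of the inverse, that is, of the
      -- adjugate divided by the determinant; one factor of the determinant clears it.
      refine ⟨1, Matrix.adjugate (Matrix.of fun i j =>
        (MvPolynomial.X (i, j) : MvPolynomial (Fin n × Fin n) ℂ)) j i, fun g => ?_⟩
      have h1 : f = star (entry i j) := by
        have := congrArg star hf
        simpa using this.symm
      have h2 : (MvPolynomial.eval fun q => (g : Matrix (Fin n) (Fin n) ℂ) q.1 q.2)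
          (Matrix.adjugate (Matrix.of fun i j =>
            (MvPolynomial.X (i, j) : MvPolynomial (Fin n × Fin n) ℂ)) j i) =
          (g : Matrix (Fin n) (Fin n) ℂ).adjugate j i := by
        have := RingHom.map_adjugate (MvPolynomial.eval fun q =>
          (g : Matrix (Fin n) (Fin n) ℂ) q.1 q.2) (Matrix.of fun i j =>
            (MvPolynomial.X (i, j) : MvPolynomial (Fin n × Fin n) ℂ))
        have h3 := congrFun (congrFun this j) i
        rw [RingHom.mapMatrix_apply, Matrix.map_apply] at h3
        rw [h3]
        congr 2; ext i j; simp
      have h4 : (g : Matrix (Fin n) (Fin n) ℂ).adjugate =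
          (g : Matrix (Fin n) (Fin n) ℂ).det • star (g : Matrix (Fin n) (Fin n) ℂ) := by
        have h5 := Matrix.adjugate_mul (g : Matrix (Fin n) (Fin n) ℂ)
        calc (g : Matrix (Fin n) (Fin n) ℂ).adjugate
            = (g : Matrix (Fin n) (Fin n) ℂ).adjugate * ((g : Matrix (Fin n) (Fin n) ℂ) *
              star (g : Matrix (Fin n) (Fin n) ℂ)) := by
                rw [Matrix.mem_unitaryGroup_iff.mp g.2, mul_one]
          _ = _ := by rw [← mul_assoc, h5, Matrix.smul_mul, one_mul]
      rw [h2, h4, h1]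
      simp [entry, Matrix.star_apply]
  | algebraMap r => exact ⟨0, MvPolynomial.C r, fun g => by simp [Algebra.algebraMap_eq_smul_one]⟩
  | add f₁ f₂ _ _ h₁ h₂ =>
    obtain ⟨N₁, p₁, h₁⟩ := h₁
    obtain ⟨N₂, p₂, h₂⟩ := h₂
    refine ⟨N₁ + N₂, Matrix.det (Matrix.of fun i j => MvPolynomial.X (i, j)) ^ N₂ * p₁ +
      Matrix.det (Matrix.of fun i j => MvPolynomial.X (i, j)) ^ N₁ * p₂, fun g => ?_⟩
    rw [map_add, map_mul, map_mul, map_pow, map_pow, hdet, ← h₁, ← h₂, ContinuousMap.add_apply]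
    ring
  | mul f₁ f₂ _ _ h₁ h₂ =>
    obtain ⟨N₁, p₁, h₁⟩ := h₁
    obtain ⟨N₂, p₂, h₂⟩ := h₂
    refine ⟨N₁ + N₂, p₁ * p₂, fun g => ?_⟩
    rw [map_mul, ← h₁, ← h₂, ContinuousMap.mul_apply]
    ring

/-- Left translates of a polynomial function separate variables. -/
theorem exists_tensor_of_mem {n : ℕ} {f : C(U n, ℂ)} (hf : f ∈ entryAlgebra n) :
    ∃ (m : ℕ) (a b : Fin m → C(U n, ℂ)), (∀ k, a k ∈ entryAlgebra n) ∧
      ∀ h g : U n, f (h⁻¹ * g) = ∑ k, a k h * b k g := by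
  have hval : ∀ (h g : U n) (i j : Fin n), entry i j (h⁻¹ * g) =
      ∑ k, star (entry k i) h * entry k j g := by
    intro h g i j
    simp only [entry, ContinuousMap.coe_mk, ContinuousMap.star_apply]
    rw [show ((h⁻¹ * g : U n) : Matrix (Fin n) (Fin n) ℂ) =
      star (h : Matrix (Fin n) (Fin n) ℂ) * (g : Matrix (Fin n) (Fin n) ℂ) from rfl,
      Matrix.mul_apply]
    rfl
  rw [entryAlgebra, ← StarSubalgebra.mem_toSubalgebra, StarAlgebra.adjoin_toSubalgebra] at hf
  induction hf using Algebra.adjoin_induction with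
  | mem f hf =>
    rcases hf with ⟨⟨i, j⟩, rfl⟩ | hf
    · exact ⟨n, fun k => star (entry k i), fun k => entry k j,
        fun k => star_mem (entry_mem k i), fun h g => hval h g i j⟩
    · obtain ⟨⟨i, j⟩, hf⟩ := hf
      have h1 : f = star (entry i j) := by
        have := congrArg star hf
        simpa using this.symm
      refine ⟨n, fun k => entry k i, fun k => star (entry k j),
        fun k => entry_mem k i, fun h g => ?_⟩
      rw [h1, ContinuousMap.star_apply, hval, star_sum]
      simp
  | algebraMap r =>
    exact ⟨1, fun _ => algebraMap _ _ r, fun _ => 1, fun _ => algebraMap_mem _ r,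
      fun h g => by simp [Algebra.algebraMap_eq_smul_one]⟩
  | add f₁ f₂ _ _ h₁ h₂ =>
    obtain ⟨m₁, a₁, b₁, ha₁, h₁⟩ := h₁
    obtain ⟨m₂, a₂, b₂, ha₂, h₂⟩ := h₂
    refine ⟨m₁ + m₂, Fin.append a₁ a₂, Fin.append b₁ b₂, fun k => ?_, fun h g => ?_⟩
    · refine Fin.addCases (fun k => ?_) (fun k => ?_) k
      · simpa using ha₁ k
      · simpa using ha₂ k
    · rw [ContinuousMap.add_apply, h₁, h₂, Fin.sum_univ_add]
      simp
  | mul f₁ f₂ _ _ h₁ h₂ =>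
    obtain ⟨m₁, a₁, b₁, ha₁, h₁⟩ := h₁
    obtain ⟨m₂, a₂, b₂, ha₂, h₂⟩ := h₂
    refine ⟨m₁ * m₂, fun k => a₁ (finProdFinEquiv.symm k).1 * a₂ (finProdFinEquiv.symm k).2,
      fun k => b₁ (finProdFinEquiv.symm k).1 * b₂ (finProdFinEquiv.symm k).2,
      fun k => mul_mem (ha₁ _) (ha₂ _), fun h g => ?_⟩
    rw [ContinuousMap.mul_apply, h₁, h₂, Finset.sum_mul_sum, ← Finset.sum_product',
      Finset.univ_product_univ, ← finProdFinEquiv.symm.sum_comp]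
    refine Finset.sum_congr rfl fun k _ => ?_
    simp only [ContinuousMap.mul_apply]
    ring

end UnitaryChar
-- Continuous representations are polynomial up to a power of the determinant
namespace UnitaryChar
open MeasureTheory

/-- The matrix coefficients of a continuous representation of `U n` are polynomials in the entries
and their conjugates. -/
theorem matrixCoeff_mem_entryAlgebra {n : ℕ} {E : Type*} [NormedRing E] [NormedAlgebra ℂ E]
    [CompleteSpace E] (π : U n →* E) (hπ : Continuous π) (ℓ : E →ₗ[ℂ] ℂ) :
    ∃ f ∈ entryAlgebra n, ∀ g, f g = ℓ (π g) := by
  borelize (U n)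
  let μ : Measure (U n) := Measure.haar
  have hint : ∀ F : U n → E, Continuous F → Integrable F μ := fun F hF =>
    hF.integrable_of_hasCompactSupport (HasCompactSupport.of_compactSpace F)
  have hintR : ∀ F : U n → ℝ, Continuous F → Integrable F μ := fun F hF =>
    hF.integrable_of_hasCompactSupport (HasCompactSupport.of_compactSpace F)
  obtain ⟨M, hM⟩ : ∃ M, ∀ g, ‖π g‖ ≤ M := by
    obtain ⟨M, hM⟩ := (isCompact_range hπ).isBounded.exists_norm_le
    exact ⟨M, fun g => hM _ ⟨g, rfl⟩⟩
  -- a bump function at the identity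
  let b : U n → ℝ := fun g => max 0 (1 / 2 - ‖π g - 1‖)
  have hb : Continuous b := by fun_prop
  have hb0 : ∀ g, 0 ≤ b g := fun g => le_max_left _ _
  have hbpos : 0 < ∫ g, b g ∂μ := by
    rw [integral_pos_iff_support_of_nonneg hb0 (hintR b hb)]
    refine (hb.isOpen_support).measure_pos μ ⟨1, ?_⟩
    simp [b]
  set c : ℝ := ∫ g, b g ∂μ with hc
  -- The bump has total mass one and lives where `π g` is within `1/2` of the identity, so averaging
  -- `π` against it gives an element within `1/2` of `1`. A polynomial approximation then stays
  -- within distance `< 1` and the average stays invertible.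
  let f₀ : C(U n, ℂ) := ⟨fun g => ((c⁻¹ * b g : ℝ) : ℂ), by fun_prop⟩
  let I : C(U n, ℂ) → E := fun f => ∫ g, f g • π g ∂μ
  have hI : ∀ f : C(U n, ℂ), Integrable (fun g => f g • π g) μ := fun f =>
    hint _ (f.continuous.smul hπ)
  have hone : ∫ g, f₀ g • (1 : E) ∂μ = 1 := by
    rw [integral_smul_const]
    simp only [f₀, ContinuousMap.coe_mk]
    rw [integral_complex_ofReal, integral_const_mul, ← hc, inv_mul_cancel₀ hbpos.ne']
    simp
  have h₀ : ‖I f₀ - 1‖ ≤ 1 / 2 := by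
    rw [← hone, ← integral_sub (hI f₀) (hint _ (by fun_prop))]
    have : ∀ g, ‖f₀ g • π g - f₀ g • (1 : E)‖ ≤ c⁻¹ * b g * (1 / 2) := by
      intro g
      rw [← smul_sub, norm_smul]
      have h1 : ‖f₀ g‖ = c⁻¹ * b g := by
        simp only [f₀, ContinuousMap.coe_mk, Complex.norm_real, Real.norm_eq_abs]
        exact abs_of_nonneg (mul_nonneg (inv_nonneg.mpr hbpos.le) (hb0 g))
      rw [h1]
      rcases le_or_gt (1 / 2) ‖π g - 1‖ with h | h
      · have : b g = 0 := max_eq_left (by linarith)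
        simp [this]
      · exact mul_le_mul_of_nonneg_left h.le (mul_nonneg (inv_nonneg.mpr hbpos.le) (hb0 g))
    refine (norm_integral_le_of_norm_le ((hintR _ (by fun_prop))) (ae_of_all _ this)).trans ?_
    rw [integral_mul_const, integral_const_mul, ← hc, inv_mul_cancel₀ hbpos.ne', one_mul]
  -- approximate the bump function by a polynomial
  obtain ⟨f, hfA, hf⟩ : ∃ f ∈ entryAlgebra n, ‖I f - 1‖ < 1 := by
    -- This tolerance costs at most `1/4` after integration against `π`; the summand `1` only keeps
    -- the denominator positive.
    have hd0 : (0 : ℝ) < 1 / (4 * (|M| * μ.real Set.univ + 1)) := by positivity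
    have hmem : f₀ ∈ (entryAlgebra n).topologicalClosure := by
      rw [entryAlgebra_dense]; trivial
    obtain ⟨f, hfA, hf⟩ := Metric.mem_closure_iff.mp
      (show f₀ ∈ closure (entryAlgebra n : Set C(U n, ℂ)) from hmem) _ hd0
    refine ⟨f, hfA, ?_⟩
    have h1 : ‖I f - I f₀‖ ≤ dist f₀ f * |M| * μ.real Set.univ := by
      rw [← integral_sub (hI f) (hI f₀)]
      refine norm_integral_le_of_norm_le_const (ae_of_all _ fun g => ?_)
      rw [← sub_smul, norm_smul]
      refine mul_le_mul ?_ ((hM g).trans (le_abs_self _)) (norm_nonneg _) dist_nonneg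
      rw [← dist_eq_norm, dist_comm]
      exact ContinuousMap.dist_apply_le_dist g
    have h2 : dist f₀ f * |M| * μ.real Set.univ ≤ 1 / 4 := by
      rw [mul_assoc]
      have hX : 0 ≤ |M| * μ.real Set.univ := by positivity
      calc dist f₀ f * (|M| * μ.real Set.univ)
          ≤ 1 / (4 * (|M| * μ.real Set.univ + 1)) * (|M| * μ.real Set.univ + 1) :=
            mul_le_mul hf.le (by linarith) hX hd0.le
        _ = 1 / 4 := by field_simp
    calc ‖I f - 1‖ = ‖(I f - I f₀) + (I f₀ - 1)‖ := by congr 1; abel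
      _ ≤ ‖I f - I f₀‖ + ‖I f₀ - 1‖ := norm_add_le _ _
      _ < 1 := by linarith
  have hunit : IsUnit (I f) := by
    have := (Units.oneSub (1 - I f) (by rwa [norm_sub_rev])).isUnit
    simpa using this
  -- By invariance of Haar measure, `π h * I f` is the average of `π` against the left translate of
  -- `f` by `h`, whose dependence on `h` is polynomial. Cancelling the unit `I f` makes `π h` itself
  -- polynomial in `h`.
  obtain ⟨m, a, e, ha, hae⟩ := exists_tensor_of_mem hfA
  -- the convolution identity
  have hconv : ∀ h, π h * I f = ∑ k, a k h • I (e k) := by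
    intro h
    have h1 : π h * I f = ∫ g, f g • π (h * g) ∂μ := by
      simp only [I]
      have : ∀ g, f g • π (h * g) = ContinuousLinearMap.mul ℂ _ (π h) (f g • π g) := by
        intro g; simp [map_mul]
      simp_rw [this]
      rw [ContinuousLinearMap.integral_comp_comm _ (hI f)]
      rfl
    have h2 : ∫ g, f g • π (h * g) ∂μ = ∫ g, f (h⁻¹ * g) • π g ∂μ := by
      rw [← integral_mul_left_eq_self (μ := μ) (fun g => f (h⁻¹ * g) • π g) h]
      simp
    have h3 : ∀ g, f (h⁻¹ * g) • π g = ∑ k, a k h • (e k g • π g) := by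
      intro g
      rw [hae, Finset.sum_smul]
      exact Finset.sum_congr rfl fun k _ => mul_smul _ _ _
    rw [h1, h2, integral_congr_ae (ae_of_all _ h3)]
    refine (integral_finsetSum _ (fun k _ => (hI (e k)).smul (a k h))).trans ?_
    exact Finset.sum_congr rfl fun k _ => integral_smul _ _
  obtain ⟨u, hu⟩ := hunit
  refine ⟨∑ k, ℓ (I (e k) * (↑u⁻¹ : E)) • a k,
    sum_mem fun k _ => (entryAlgebra n).smul_mem (ha k) _, fun h => ?_⟩
  have h3 : π h = ∑ k, a k h • (I (e k) * (↑u⁻¹ : E)) := by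
    calc π h = π h * I f * (↑u⁻¹ : E) := by
          rw [← hu, mul_assoc, Units.mul_inv, mul_one]
      _ = _ := by rw [hconv, Finset.sum_mul]; simp
  conv_rhs => rw [h3]
  rw [map_sum, ContinuousMap.sum_apply]
  simp [mul_comm]

/-- A continuous representation of `U n`, twisted by a power of the determinant, is polynomial in
the matrix entries. -/
theorem exists_polynomial_rep {n d : ℕ} (π : Representation ℂ (U n) (Fin d → ℂ))
    (hπ : ∀ v, Continuous fun g => π g v) :
    ∃ (N : ℕ) (P : Fin d → Fin d → MvPolynomial (Fin n × Fin n) ℂ), ∀ (g : U n) (i j : Fin d),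
      (g : Matrix (Fin n) (Fin n) ℂ).det ^ N * LinearMap.toMatrix' (π g) i j =
        (P i j).eval fun q => (g : Matrix (Fin n) (Fin n) ℂ) q.1 q.2 := by
  have h : ∀ q : Fin d × Fin d, ∃ (N : ℕ) (p : MvPolynomial (Fin n × Fin n) ℂ), ∀ g : U n,
      (g : Matrix (Fin n) (Fin n) ℂ).det ^ N * LinearMap.toMatrix' (π g) q.1 q.2 =
        p.eval fun q => (g : Matrix (Fin n) (Fin n) ℂ) q.1 q.2 := by
    intro q
    let Φ : U n →* ((Fin d → ℂ) →L[ℂ] (Fin d → ℂ)) :=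
      { toFun := fun g => LinearMap.toContinuousLinearMap (π g)
        map_one' := by rw [map_one]; rfl
        map_mul' := fun g h => by rw [map_mul]; rfl }
    have hΦ : Continuous Φ := by
      rw [continuous_clm_apply]
      exact hπ
    obtain ⟨f, hf, hfg⟩ := matrixCoeff_mem_entryAlgebra Φ hΦ
      ((LinearMap.proj q.1).comp ((LinearMap.applyₗ (Pi.single q.2 1)).comp
        (ContinuousLinearMap.coeLM ℂ)))
    obtain ⟨N, p, hp⟩ := exists_polynomial_of_mem hf
    refine ⟨N, p, fun g => ?_⟩
    rw [← hp, hfg, LinearMap.toMatrix'_apply]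
    rfl
  choose N p hp using h
  -- The sum of all exponents serves as a common power of the determinant; each entry is multiplied
  -- by the powers belonging to the other entries.
  refine ⟨∑ q, N q, fun i j => Matrix.det (Matrix.of fun i j => MvPolynomial.X (i, j)) ^
    (∑ q ∈ Finset.univ.erase (i, j), N q) * p (i, j), fun g i j => ?_⟩
  rw [map_mul, map_pow, ← hp, RingHom.map_det]
  have : ((MvPolynomial.eval fun q : Fin n × Fin n => (g : Matrix (Fin n) (Fin n) ℂ) q.1 q.2).mapMatrix
      (Matrix.of fun i j => (MvPolynomial.X (i, j) : MvPolynomial (Fin n × Fin n) ℂ))) =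
      (g : Matrix (Fin n) (Fin n) ℂ) := by
    ext i j; simp
  rw [this, ← mul_assoc, ← pow_add, Finset.sum_erase_add _ _ (Finset.mem_univ _)]

end UnitaryChar
-- Zariski density of the unitary group and extension to all matrices
namespace UnitaryChar

open MvPolynomial ComplexOrder in
/-- The unitary group is Zariski dense in the space of all matrices. -/
theorem eq_zero_of_eval_unitary {n : ℕ} (p : MvPolynomial (Fin n × Fin n) ℂ)
    (hp : ∀ g : U n, (p.eval fun q => (g : Matrix (Fin n) (Fin n) ℂ) q.1 q.2) = 0) : p = 0 := by
  -- An invertible `X` has a singular value decomposition `W * diagonal s * star V`. With `W` and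
  -- `V` fixed, `p` becomes a polynomial in the diagonal alone, and for a diagonal on the unit torus
  -- the product is unitary.
  have key : ∀ X : Matrix (Fin n) (Fin n) ℂ, X.det ≠ 0 → (p.eval fun q => X q.1 q.2) = 0 := by
    intro X hX
    have hXu : IsUnit X := (Matrix.isUnit_iff_isUnit_det X).mpr (isUnit_iff_ne_zero.mpr hX)
    have hpd : (star X * X).PosDef := Matrix.PosDef.conjTranspose_mul_self X
      (Matrix.mulVec_injective_of_isUnit hXu)
    have hA := hpd.isHermitian
    have hspec := hA.spectral_theorem
    set V := hA.eigenvectorUnitary with hV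
    rw [Unitary.conjStarAlgAut_apply] at hspec
    have hpos : ∀ i, 0 < hA.eigenvalues i := fun i => hpd.eigenvalues_pos i
    let s : Fin n → ℂ := fun i => ((Real.sqrt (hA.eigenvalues i) : ℝ) : ℂ)
    have hs : ∀ i, s i ≠ 0 := fun i => by
      simpa [s] using (Real.sqrt_pos.mpr (hpos i)).ne'
    have hss : ∀ i, s i * s i = ((hA.eigenvalues i : ℝ) : ℂ) := fun i => by
      simp only [s]; rw [← Complex.ofReal_mul, Real.mul_self_sqrt (hpos i).le]
    have hVV : star (V : Matrix (Fin n) (Fin n) ℂ) * (V : Matrix (Fin n) (Fin n) ℂ) = 1 :=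
      Matrix.mem_unitaryGroup_iff'.mp V.2
    have hVV' : (V : Matrix (Fin n) (Fin n) ℂ) * star (V : Matrix (Fin n) (Fin n) ℂ) = 1 :=
      Matrix.mem_unitaryGroup_iff.mp V.2
    let W : Matrix (Fin n) (Fin n) ℂ := X * V * Matrix.diagonal (fun i => (s i)⁻¹)
    have hdstar : star (Matrix.diagonal (fun i => (s i)⁻¹)) = Matrix.diagonal (fun i => (s i)⁻¹) := by
      rw [Matrix.star_eq_conjTranspose, Matrix.diagonal_conjTranspose]
      congr 1; ext i; simp [s]
    have hWu : W ∈ Matrix.unitaryGroup (Fin n) ℂ := by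
      rw [Matrix.mem_unitaryGroup_iff']
      simp only [W, star_mul, hdstar]
      calc Matrix.diagonal (fun i => (s i)⁻¹) * (star (V : Matrix (Fin n) (Fin n) ℂ) * star X) *
            (X * V * Matrix.diagonal (fun i => (s i)⁻¹))
          = Matrix.diagonal (fun i => (s i)⁻¹) * (star (V : Matrix (Fin n) (Fin n) ℂ) *
            (star X * X) * V) * Matrix.diagonal (fun i => (s i)⁻¹) := by
              simp only [mul_assoc]
        _ = Matrix.diagonal (fun i => (s i)⁻¹) *
            Matrix.diagonal (RCLike.ofReal ∘ hA.eigenvalues) *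
            Matrix.diagonal (fun i => (s i)⁻¹) := by
              conv_lhs => rw [hspec]
              congr 2
              simp only [mul_assoc]
              rw [hVV, mul_one, ← mul_assoc, hVV, one_mul]
        _ = 1 := by
              rw [Matrix.diagonal_mul_diagonal, Matrix.diagonal_mul_diagonal, ← Matrix.diagonal_one]
              congr 1; ext i
              have := hss i
              have h0 := hs i
              simp only [Function.comp]
              rw [show (RCLike.ofReal (hA.eigenvalues i) : ℂ) = s i * s i from this.symm]
              field_simp
    have hX' : X = W * Matrix.diagonal s * star (V : Matrix (Fin n) (Fin n) ℂ) := by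
      simp only [W]
      rw [mul_assoc (X * _), Matrix.diagonal_mul_diagonal]
      rw [show (fun i => (s i)⁻¹ * s i) = fun _ => (1 : ℂ) from
        funext fun i => inv_mul_cancel₀ (hs i), Matrix.diagonal_one, mul_one, mul_assoc, hVV',
        mul_one]
    let r : MvPolynomial (Fin n) ℂ := bind₁ (fun q : Fin n × Fin n =>
      ∑ k, C (W q.1 k * star (V : Matrix (Fin n) (Fin n) ℂ) k q.2) * MvPolynomial.X k) p
    have hr : ∀ x : Fin n → ℂ, r.eval x = p.eval fun q =>
        (W * Matrix.diagonal x * star (V : Matrix (Fin n) (Fin n) ℂ)) q.1 q.2 := by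
      intro x
      simp only [r]
      rw [← MvPolynomial.coe_aeval_eq_eval, RingHom.coe_coe, aeval_bind₁,
        ← MvPolynomial.coe_aeval_eq_eval, RingHom.coe_coe]
      congr 2; ext q
      rw [Matrix.mul_apply, map_sum]
      refine Finset.sum_congr rfl fun k _ => ?_
      rw [Matrix.mul_diagonal, map_mul, aeval_X, aeval_C]
      simp only [Algebra.algebraMap_self, RingHom.id_apply]
      ring
    -- A polynomial vanishing on a product of infinite sets, here circles, is zero.
    have hr0 : r = 0 := by
      refine funext_set (fun _ => Metric.sphere (0 : ℂ) 1) (fun _ => ?_) fun x hx => ?_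
      · refine (isPreconnected_sphere (by simp [Complex.rank_real_complex]) 0 1
          ).infinite_of_nontrivial ⟨1, by simp, -1, by simp, ?_⟩
        norm_num
      · rw [hr, map_zero]
        have hxu : Matrix.diagonal x ∈ Matrix.unitaryGroup (Fin n) ℂ := by
          rw [Matrix.mem_unitaryGroup_iff', Matrix.star_eq_conjTranspose,
            Matrix.diagonal_conjTranspose, Matrix.diagonal_mul_diagonal, ← Matrix.diagonal_one]
          congr 1; ext i
          have hi : ‖x i‖ = 1 := by simpa using hx i trivial
          have := Complex.conj_mul' (x i)
          rw [hi] at this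
          simpa using this
        exact hp ⟨_, mul_mem (mul_mem hWu hxu) (star V).2⟩
    have := hr s
    rw [hr0, map_zero, ← hX'] at this
    exact this.symm
  -- Multiplying by the determinant covers the singular matrices as well; the polynomial ring is a
  -- domain, so the factor can be removed afterwards.
  have hprod : p * Matrix.det (Matrix.of fun i j => (X (i, j) : MvPolynomial (Fin n × Fin n) ℂ)) = 0 := by
    refine MvPolynomial.funext fun x => ?_
    have hm : (eval x).mapMatrix (Matrix.of fun i j =>
        (X (i, j) : MvPolynomial (Fin n × Fin n) ℂ)) = Matrix.of fun i j => x (i, j) := by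
      ext i j; simp
    rw [map_mul, map_zero, RingHom.map_det, hm]
    by_cases h : (Matrix.of fun i j => x (i, j)).det = 0
    · rw [h, mul_zero]
    · have h2 := key _ h
      simp only [Matrix.of_apply, Prod.mk.eta] at h2
      rw [h2, zero_mul]
  refine (mul_eq_zero.mp hprod).resolve_right fun h => ?_
  have := congrArg (eval fun q : Fin n × Fin n => (1 : Matrix (Fin n) (Fin n) ℂ) q.1 q.2) h
  rw [RingHom.map_det, map_zero] at this
  have h1 : (eval fun q : Fin n × Fin n => (1 : Matrix (Fin n) (Fin n) ℂ) q.1 q.2).mapMatrix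
      (Matrix.of fun i j => (X (i, j) : MvPolynomial (Fin n × Fin n) ℂ)) = 1 := by
    ext i j; simp
  rw [h1, Matrix.det_one] at this
  exact one_ne_zero this

/-- The value of a matrix of polynomials in `n × n` variables at a matrix. -/
noncomputable def polyEval {n d : ℕ} (P : Matrix (Fin d) (Fin d) (MvPolynomial (Fin n × Fin n) ℂ))
    (X : Matrix (Fin n) (Fin n) ℂ) : Matrix (Fin d) (Fin d) ℂ :=
  P.map (MvPolynomial.eval fun q => X q.1 q.2)

/-- An irreducible polynomial representation of the monoid of `n × n` matrices. -/
structure IsPolyRep {n d : ℕ} (P : Matrix (Fin d) (Fin d) (MvPolynomial (Fin n × Fin n) ℂ)) :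
    Prop where
  map_one : polyEval P 1 = 1
  map_mul : ∀ X Y, polyEval P (X * Y) = polyEval P X * polyEval P Y
  nonempty : 0 < d
  irreducible : ∀ W : Submodule ℂ (Fin d → ℂ),
    (∀ X, ∀ w ∈ W, (polyEval P X).mulVec w ∈ W) → W = ⊥ ∨ W = ⊤

-- With one argument fixed, multiplicativity is a polynomial identity in the other, so Zariski
-- density applies to one argument at a time.
open MvPolynomial in
theorem polyEval_mul_of_unitary {n d : ℕ}
    (P : Matrix (Fin d) (Fin d) (MvPolynomial (Fin n × Fin n) ℂ))
    (h : ∀ g h : U n, polyEval P ((g : Matrix (Fin n) (Fin n) ℂ) * (h : Matrix (Fin n) (Fin n) ℂ)) =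
      polyEval P (g : Matrix (Fin n) (Fin n) ℂ) * polyEval P (h : Matrix (Fin n) (Fin n) ℂ))
    (X Y : Matrix (Fin n) (Fin n) ℂ) : polyEval P (X * Y) = polyEval P X * polyEval P Y := by
  -- first extend in the right factor, then in the left one
  have step : ∀ (g : U n) (Y : Matrix (Fin n) (Fin n) ℂ),
      polyEval P ((g : Matrix (Fin n) (Fin n) ℂ) * Y) =
        polyEval P (g : Matrix (Fin n) (Fin n) ℂ) * polyEval P Y := by
    intro g Y
    ext a b
    let r : MvPolynomial (Fin n × Fin n) ℂ :=
      bind₁ (fun q : Fin n × Fin n => ∑ k, C ((g : Matrix (Fin n) (Fin n) ℂ) q.1 k) * MvPolynomial.X (k, q.2))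
        (P a b) - ∑ c, C (polyEval P (g : Matrix (Fin n) (Fin n) ℂ) a c) * P c b
    have hr : ∀ Y : Matrix (Fin n) (Fin n) ℂ, (r.eval fun q => Y q.1 q.2) =
        polyEval P ((g : Matrix (Fin n) (Fin n) ℂ) * Y) a b -
        (polyEval P (g : Matrix (Fin n) (Fin n) ℂ) * polyEval P Y) a b := by
      intro Y
      simp only [r, map_sub]
      congr 1
      · rw [polyEval, Matrix.map_apply, ← MvPolynomial.coe_aeval_eq_eval, RingHom.coe_coe,
          aeval_bind₁, ← MvPolynomial.coe_aeval_eq_eval, RingHom.coe_coe]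
        congr 2; ext q
        simp [Matrix.mul_apply]
      · rw [Matrix.mul_apply, map_sum]
        refine Finset.sum_congr rfl fun c _ => ?_
        rw [_root_.map_mul, eval_C]
        rfl
    have hr0 : r = 0 := eq_zero_of_eval_unitary r fun h' => by rw [hr, h, sub_self]
    have := hr Y
    rw [hr0, map_zero] at this
    exact (sub_eq_zero.mp this.symm)
  ext a b
  let r : MvPolynomial (Fin n × Fin n) ℂ :=
    bind₁ (fun q : Fin n × Fin n => ∑ k, MvPolynomial.X (q.1, k) * C (Y k q.2))
      (P a b) - ∑ c, P a c * C (polyEval P Y c b)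
  have hr : ∀ X : Matrix (Fin n) (Fin n) ℂ, (r.eval fun q => X q.1 q.2) =
      polyEval P (X * Y) a b - (polyEval P X * polyEval P Y) a b := by
    intro X
    simp only [r, map_sub]
    congr 1
    · rw [polyEval, Matrix.map_apply, ← MvPolynomial.coe_aeval_eq_eval, RingHom.coe_coe,
        aeval_bind₁, ← MvPolynomial.coe_aeval_eq_eval, RingHom.coe_coe]
      congr 2; ext q
      simp [Matrix.mul_apply]
    · rw [Matrix.mul_apply, map_sum]
      refine Finset.sum_congr rfl fun c _ => ?_
      rw [_root_.map_mul, eval_C]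
      rfl
  have hr0 : r = 0 := eq_zero_of_eval_unitary r fun g => by rw [hr, step, sub_self]
  have := hr X
  rw [hr0, map_zero] at this
  exact (sub_eq_zero.mp this.symm)

/-- An irreducible continuous representation of `U n` extends, up to a power of the determinant,
to an irreducible polynomial representation. -/
theorem exists_isPolyRep {n d : ℕ} (π : Representation ℂ (U n) (Fin d → ℂ))
    (hirr : π.IsIrreducible) (hπ : ∀ v, Continuous fun g => π g v) :
    ∃ (N : ℕ) (P : Matrix (Fin d) (Fin d) (MvPolynomial (Fin n × Fin n) ℂ)), IsPolyRep P ∧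
      ∀ g : U n, (g : Matrix (Fin n) (Fin n) ℂ).det ^ N * π.character g =
        (polyEval P (g : Matrix (Fin n) (Fin n) ℂ)).trace := by
  obtain ⟨N, P, hP⟩ := exists_polynomial_rep π hπ
  have hev : ∀ g : U n, polyEval (Matrix.of P) (g : Matrix (Fin n) (Fin n) ℂ) =
      (g : Matrix (Fin n) (Fin n) ℂ).det ^ N • LinearMap.toMatrix' (π g) := by
    intro g
    ext i j
    rw [Matrix.smul_apply, smul_eq_mul, hP]
    rfl
  refine ⟨N, Matrix.of P, ⟨?_, ?_, ?_, ?_⟩, ?_⟩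
  · have := hev 1
    rw [map_one] at this
    simpa using this
  · refine polyEval_mul_of_unitary _ fun g h => ?_
    have := hev (g * h)
    rw [map_mul, Module.End.mul_eq_comp, LinearMap.toMatrix'_comp] at this
    rw [hev, hev, ← Submonoid.coe_mul, this]
    simp only [Submonoid.coe_mul, Matrix.det_mul, mul_pow, Matrix.smul_mul, Matrix.mul_smul,
      smul_smul]
    rw [mul_comm]
  · rcases Nat.eq_zero_or_pos d with rfl | h
    · exfalso
      obtain ⟨a, b, hab⟩ := hirr.toNontrivial
      apply hab
      have : a.toSubmodule = b.toSubmodule := Subsingleton.elim _ _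
      cases a; cases b; simp_all
    · exact h
  · intro W hW
    have hst : ∀ g : U n, ∀ w ∈ W, π g w ∈ W := by
      intro g w hw
      have h1 := hW g w hw
      rw [hev, Matrix.smul_mulVec, LinearMap.toMatrix'_mulVec] at h1
      have hdet : (g : Matrix (Fin n) (Fin n) ℂ).det ^ N ≠ 0 := by
        apply pow_ne_zero
        intro h0
        have := congrArg Matrix.det (Matrix.mem_unitaryGroup_iff.mp g.2)
        rw [Matrix.det_mul, h0, zero_mul, Matrix.det_one] at this
        exact zero_ne_one this
      exact (Submodule.smul_mem_iff _ hdet).mp h1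
    have hs := hirr.eq_bot_or_eq_top ⟨W, hst⟩
    rcases hs with h | h
    · left; exact congrArg Subrepresentation.toSubmodule h
    · right; exact congrArg Subrepresentation.toSubmodule h
  · intro g
    rw [hev, Matrix.trace_smul, smul_eq_mul]
    congr 1
    rw [Representation.character, LinearMap.trace_eq_matrix_trace ℂ (Pi.basisFun ℂ (Fin d))]
    rfl

end UnitaryChar
-- The action of the Lie algebra `gl n`
namespace UnitaryChar

open MvPolynomial

theorem derivation_aeval {σ A : Type*} [Fintype σ] [CommRing A] [Algebra ℂ A]
    (D : Derivation ℂ A A) (f : σ → A) (p : MvPolynomial σ ℂ) :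
    D (aeval f p) = ∑ i, aeval f (pderiv i p) * D (f i) := by
  classical
  induction p using MvPolynomial.induction_on with
  | C a => simp
  | add p q hp hq => simp [hp, hq, add_mul, Finset.sum_add_distrib]
  | mul_X p j hp =>
    simp only [map_mul, aeval_X, Derivation.leibniz, smul_eq_mul, hp, map_add, pderiv_X, add_mul,
      Finset.sum_add_distrib]
    congr 1
    · rw [Finset.sum_eq_single j]
      · simp
      · intro i _ hij; simp [hij.symm]
      · simp
    · rw [Finset.mul_sum]
      exact Finset.sum_congr rfl fun i _ => by ring

theorem eval_aeval_polynomial {σ : Type*} (f : σ → Polynomial ℂ) (p : MvPolynomial σ ℂ) (t : ℂ) :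
    (aeval f p).eval t = p.eval fun q => (f q).eval t := by
  induction p using MvPolynomial.induction_on with
  | C a => simp
  | add p q hp hq => simp [hp, hq]
  | mul_X p j hp => simp [hp]

/-- The right-invariant vector field of the elementary matrix `E i j`. -/
noncomputable def vectorField {n : ℕ} (i j : Fin n) :
    Derivation ℂ (MvPolynomial (Fin n × Fin n) ℂ) (MvPolynomial (Fin n × Fin n) ℂ) :=
  mkDerivation ℂ fun q => if q.2 = j then X (q.1, i) else 0

theorem vectorField_eq {n : ℕ} (i j : Fin n) (p : MvPolynomial (Fin n × Fin n) ℂ) :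
    vectorField i j p = ∑ q, pderiv q p * if q.2 = j then X (q.1, i) else 0 := by
  have := derivation_aeval (vectorField i j) X p
  rw [aeval_X_left_apply] at this
  rw [this]
  simp [vectorField, mkDerivation_X]

/-- Both sides are derivations, so it is enough to compare them on the variables. These are the
commutation relations of elementary matrices. -/
theorem vectorField_bracket {n : ℕ} (i j k l : Fin n) (p : MvPolynomial (Fin n × Fin n) ℂ) :
    vectorField i j (vectorField k l p) - vectorField k l (vectorField i j p) =
      (if k = j then vectorField i l p else 0) - (if i = l then vectorField k j p else 0) := by
  have : ⁅(vectorField i j : Derivation ℂ (MvPolynomial (Fin n × Fin n) ℂ) _), vectorField k l⁆ =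
      (if k = j then vectorField i l else 0) - (if i = l then vectorField k j else 0) := by
    apply derivation_ext
    rintro ⟨a, b⟩
    rw [Derivation.commutator_apply]
    simp only [vectorField, mkDerivation_X]
    split_ifs <;> simp_all [mkDerivation_X]
  have h := congrArg (fun D => D p) this
  simp only [Derivation.commutator_apply] at h
  rw [h]
  split_ifs <;> simp

section

variable {n d : ℕ} (P : Matrix (Fin d) (Fin d) (MvPolynomial (Fin n × Fin n) ℂ))

/-- The action of the elementary matrix `E i j` of `gl n`. -/
noncomputable def lie (i j : Fin n) : Matrix (Fin d) (Fin d) ℂ :=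
  polyEval (P.map (vectorField i j)) 1

/-- The entries of `Z (1 + t E i j)`, as polynomials in `t`. -/
noncomputable def shiftLine (Z : Matrix (Fin n) (Fin n) ℂ) (i j : Fin n) (q : Fin n × Fin n) :
    Polynomial ℂ :=
  Polynomial.C (Z q.1 q.2) + if q.2 = j then Polynomial.C (Z q.1 i) * Polynomial.X else 0

theorem eval_aeval_shiftLine (Z : Matrix (Fin n) (Fin n) ℂ) (i j : Fin n)
    (p : MvPolynomial (Fin n × Fin n) ℂ) (t : ℂ) :
    (aeval (shiftLine Z i j) p).eval t =
      p.eval fun q => (Z * (1 + t • Matrix.single i j (1 : ℂ))) q.1 q.2 := by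
  rw [eval_aeval_polynomial]
  congr 2
  ext q
  rw [mul_add, mul_one, Matrix.mul_smul, Matrix.add_apply, Matrix.smul_apply]
  simp only [shiftLine, Polynomial.eval_add, Polynomial.eval_C]
  congr 1
  split_ifs with h
  · subst h
    rw [Matrix.mul_single_apply_same]
    simp only [Polynomial.eval_mul, Polynomial.eval_C, Polynomial.eval_X, smul_eq_mul]
    ring
  · rw [Matrix.mul_single_apply_of_ne (hbj := h)]
    simp

theorem eval_derivative_aeval_shiftLine (Z : Matrix (Fin n) (Fin n) ℂ) (i j : Fin n)
    (p : MvPolynomial (Fin n × Fin n) ℂ) :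
    (Polynomial.derivative (aeval (shiftLine Z i j) p)).eval 0 =
      (vectorField i j p).eval fun q => Z q.1 q.2 := by
  have h := derivation_aeval (Polynomial.derivative' : Derivation ℂ (Polynomial ℂ) (Polynomial ℂ))
    (shiftLine Z i j) p
  rw [Polynomial.derivative'_apply] at h
  rw [h, vectorField_eq, map_sum, Polynomial.eval_finsetSum]
  refine Finset.sum_congr rfl fun q _ => ?_
  rw [Polynomial.eval_mul, eval_aeval_shiftLine, zero_smul, add_zero, mul_one, map_mul]
  congr 1
  simp only [shiftLine]
  split_ifs <;> simp

variable {P}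

/-- Differentiate `P(Z (1 + t E)) = P(Z) P(1 + t E)` at `t = 0`, with `E` the elementary matrix `(i,
j)`. -/
theorem eval_vectorField (hP : IsPolyRep P) (i j : Fin n) (Z : Matrix (Fin n) (Fin n) ℂ) :
    polyEval (P.map (vectorField i j)) Z = polyEval P Z * lie P i j := by
  ext a b
  have key : aeval (shiftLine Z i j) (P a b) =
      ∑ c, Polynomial.C (polyEval P Z a c) * aeval (shiftLine 1 i j) (P c b) := by
    refine Polynomial.funext fun t => ?_
    rw [eval_aeval_shiftLine, Polynomial.eval_finsetSum]
    have := congrFun (congrFun (hP.map_mul Z (1 + t • Matrix.single i j (1 : ℂ))) a) b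
    rw [Matrix.mul_apply] at this
    refine Eq.trans this (Finset.sum_congr rfl fun c _ => ?_)
    rw [Polynomial.eval_mul, Polynomial.eval_C, eval_aeval_shiftLine, one_mul]
    rfl
  have h := congrArg (fun p => (Polynomial.derivative p).eval 0) key
  simp only [eval_derivative_aeval_shiftLine, Polynomial.derivative_sum,
    Polynomial.eval_finsetSum, Polynomial.derivative_C_mul, Polynomial.eval_C_mul] at h
  rw [Matrix.mul_apply]
  exact h

theorem vectorField_apply (hP : IsPolyRep P) (i j : Fin n) (a b : Fin d) :
    vectorField i j (P a b) = ∑ c, P a c * C (lie P i j c b) := by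
  refine MvPolynomial.funext fun x => ?_
  have := congrFun (congrFun (eval_vectorField hP i j (Matrix.of fun i j => x (i, j))) a) b
  rw [Matrix.mul_apply] at this
  simp only [polyEval, Matrix.map_apply, Matrix.of_apply, Prod.mk.eta] at this
  rw [this, map_sum]
  exact Finset.sum_congr rfl fun c _ => by simp

theorem lie_mul_lie (hP : IsPolyRep P) (i j k l : Fin n) :
    lie P i j * lie P k l =
      polyEval (P.map fun p => vectorField i j (vectorField k l p)) 1 := by
  ext a b
  simp only [polyEval, Matrix.map_apply]
  rw [vectorField_apply hP, map_sum]
  simp only [Derivation.leibniz, smul_eq_mul, MvPolynomial.derivation_C, mul_zero, zero_add,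
    vectorField_apply hP i j, map_sum, map_mul, eval_C]
  have h1 : ∀ c, (eval fun q : Fin n × Fin n => (1 : Matrix (Fin n) (Fin n) ℂ) q.1 q.2) (P a c) =
      (1 : Matrix (Fin d) (Fin d) ℂ) a c := fun c => by rw [← hP.map_one]; rfl
  simp_rw [h1]
  rw [Matrix.mul_apply]
  refine Finset.sum_congr rfl fun c _ => ?_
  simp [Matrix.one_apply, mul_comm]

theorem lie_bracket (hP : IsPolyRep P) (i j k l : Fin n) :
    lie P i j * lie P k l - lie P k l * lie P i j =
      (if k = j then lie P i l else 0) - (if i = l then lie P k j else 0) := by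
  rw [lie_mul_lie hP, lie_mul_lie hP]
  ext a b
  have := congrArg (eval fun q : Fin n × Fin n => (1 : Matrix (Fin n) (Fin n) ℂ) q.1 q.2)
    (vectorField_bracket i j k l (P a b))
  rw [map_sub] at this
  rw [Matrix.sub_apply]
  refine Eq.trans this ?_
  split_ifs <;> simp [lie, polyEval]

theorem hasDerivAt_lie (i j : Fin n) (a b : Fin d) :
    HasDerivAt (fun t : ℂ => polyEval P (1 + t • Matrix.single i j (1 : ℂ)) a b)
      (lie P i j a b) 0 := by
  have h := (aeval (shiftLine 1 i j) (P a b)).hasDerivAt 0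
  rw [eval_derivative_aeval_shiftLine] at h
  refine h.congr_of_eventuallyEq (Filter.Eventually.of_forall fun t => ?_)
  simp only [eval_aeval_shiftLine, one_mul]
  rfl

/-- Conjugation by a diagonal matrix scales `E i j` by `x i / x j`. The form without denominators
allows zero coordinates; it is the derivative at `t = 0` of an identity between products of
matrices. -/
theorem diagonal_mul_lie (hP : IsPolyRep P) (x : Fin n → ℂ) (i j : Fin n) :
    x j • (polyEval P (Matrix.diagonal x) * lie P i j) =
      x i • (lie P i j * polyEval P (Matrix.diagonal x)) := by
  have hcomm : ∀ t : ℂ,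
      polyEval P (Matrix.diagonal x) * polyEval P (1 + (x j * t) • Matrix.single i j (1 : ℂ)) =
      polyEval P (1 + (x i * t) • Matrix.single i j (1 : ℂ)) * polyEval P (Matrix.diagonal x) := by
    intro t
    rw [← hP.map_mul, ← hP.map_mul]
    congr 1
    rw [mul_add, add_mul, mul_one, one_mul, Matrix.mul_smul, Matrix.smul_mul]
    congr 1
    ext a b
    rw [Matrix.smul_apply, Matrix.smul_apply, Matrix.diagonal_mul, Matrix.mul_diagonal]
    simp only [Matrix.single_apply, smul_eq_mul]
    split_ifs with h
    · rw [← h.1, ← h.2]; ring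
    · ring
  have hd : ∀ (s : ℂ) (a b : Fin d), HasDerivAt
      (fun t : ℂ => polyEval P (1 + (s * t) • Matrix.single i j (1 : ℂ)) a b)
      (s * lie P i j a b) 0 := by
    intro s a b
    have h1 : HasDerivAt (fun t : ℂ => s * t) s 0 := by
      simpa using (hasDerivAt_id (0 : ℂ)).const_mul s
    have h2 := hasDerivAt_lie (P := P) i j a b
    rw [show (0 : ℂ) = s * 0 by simp] at h2
    have := h2.comp 0 h1
    rw [mul_comm] at this
    exact this
  ext a b
  have hL : HasDerivAt (fun t : ℂ => ∑ c, polyEval P (Matrix.diagonal x) a c *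
      polyEval P (1 + (x j * t) • Matrix.single i j (1 : ℂ)) c b)
      (∑ c, polyEval P (Matrix.diagonal x) a c * (x j * lie P i j c b)) 0 :=
    HasDerivAt.fun_sum fun c _ => (hd (x j) c b).const_mul _
  have hR : HasDerivAt (fun t : ℂ => ∑ c,
      polyEval P (1 + (x i * t) • Matrix.single i j (1 : ℂ)) a c *
        polyEval P (Matrix.diagonal x) c b)
      (∑ c, (x i * lie P i j a c) * polyEval P (Matrix.diagonal x) c b) 0 :=
    HasDerivAt.fun_sum fun c _ => (hd (x i) a c).mul_const _
  have heq : (fun t : ℂ => ∑ c, polyEval P (Matrix.diagonal x) a c *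
      polyEval P (1 + (x j * t) • Matrix.single i j (1 : ℂ)) c b) = (fun t : ℂ => ∑ c,
      polyEval P (1 + (x i * t) • Matrix.single i j (1 : ℂ)) a c *
        polyEval P (Matrix.diagonal x) c b) := by
    ext t
    have := congrFun (congrFun (hcomm t) a) b
    rwa [Matrix.mul_apply, Matrix.mul_apply] at this
  rw [heq] at hL
  have := hL.unique hR
  rw [Matrix.smul_apply, Matrix.smul_apply, Matrix.mul_apply, Matrix.mul_apply, smul_eq_mul,
    smul_eq_mul, Finset.mul_sum, Finset.mul_sum]
  convert this using 2
  · ring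
  · ring

end

/-- A family of polynomials satisfying a linear differential system that is regular at `0`
vanishes if all initial values do. -/
theorem eq_zero_of_linear_system {ι κ : Type*} [Fintype κ] (δ : Polynomial ℂ) (hδ : δ.coeff 0 ≠ 0)
    (u : ι → Polynomial ℂ) (c : κ → Polynomial ℂ) (e : κ → ι → ι)
    (h0 : ∀ w, (u w).coeff 0 = 0)
    (h : ∀ w, δ * Polynomial.derivative (u w) = ∑ k, c k * u (e k w)) (w : ι) : u w = 0 := by
  -- If `X ^ m` divides every member then it divides `δ` times each derivative, hence each
  -- derivative because `δ` is prime to `X`. In characteristic zero and with zero constant terms, `X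
  -- ^ (m + 1)` then divides every member.
  have key : ∀ m : ℕ, ∀ w, Polynomial.X ^ m ∣ u w := by
    intro m
    induction m with
    | zero => intro w; simp
    | succ m ih =>
      intro w
      have h1 : Polynomial.X ^ m ∣ δ * Polynomial.derivative (u w) := by
        rw [h]
        exact Finset.dvd_sum fun k _ => (ih _).mul_left _
      have h2 : Polynomial.X ^ m ∣ Polynomial.derivative (u w) := by
        refine Polynomial.prime_X.pow_dvd_of_dvd_mul_left m ?_ h1
        rwa [Polynomial.X_dvd_iff]
      rw [Polynomial.X_pow_dvd_iff] at h2 ⊢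
      intro k hk
      rcases k with _ | k
      · exact h0 w
      · have := h2 k (by omega)
        rw [Polynomial.coeff_derivative] at this
        exact (mul_eq_zero.mp this).resolve_right (by exact_mod_cast Nat.succ_ne_zero k)
  ext k
  have := (Polynomial.X_pow_dvd_iff.mp (key (k + 1) w)) k (by omega)
  simpa using this

/-- A subspace stable under the Lie algebra is stable under all matrices. -/
theorem mulVec_mem_of_lie {n d : ℕ} {P : Matrix (Fin d) (Fin d) (MvPolynomial (Fin n × Fin n) ℂ)}
    (hP : IsPolyRep P) (W : Submodule ℂ (Fin d → ℂ))
    (hW : ∀ i j, ∀ w ∈ W, (lie P i j).mulVec w ∈ W) (Z : Matrix (Fin n) (Fin n) ℂ)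
    (w : Fin d → ℂ) (hw : w ∈ W) : (polyEval P Z).mulVec w ∈ W := by
  rw [← Subspace.forall_mem_dualAnnihilator_apply_eq_zero_iff]
  intro ℓ hℓ
  rw [Submodule.mem_dualAnnihilator] at hℓ
  have hℓv : ∀ (M : Matrix (Fin d) (Fin d) ℂ) (v : Fin d → ℂ), ℓ (M.mulVec v) =
      ∑ a, ∑ b, ℓ (Pi.single a 1) * v b * M a b := by
    intro M v
    conv_lhs => rw [pi_eq_sum_univ' (M.mulVec v), map_sum]
    refine Finset.sum_congr rfl fun a _ => ?_
    rw [map_smul, smul_eq_mul, Matrix.mulVec, dotProduct, Finset.sum_mul]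
    refine Finset.sum_congr rfl fun b _ => ?_
    ring
  -- Follow the segment `L = 1 + t A` from the identity to `Z`. For a functional `ℓ` killing `W`,
  -- the polynomials `ℓ (P(L) w)`, with `w` in `W`, vanish at `t = 0` and satisfy a linear system,
  -- so they vanish at `t = 1`.
  let A : Matrix (Fin n) (Fin n) ℂ := Z - 1
  let L : Matrix (Fin n) (Fin n) (Polynomial ℂ) :=
    Matrix.of fun i j => Polynomial.C ((1 : Matrix (Fin n) (Fin n) ℂ) i j) +
      Polynomial.C (A i j) * Polynomial.X
  let Lq : Fin n × Fin n → Polynomial ℂ := fun q => L q.1 q.2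
  have hLeval : ∀ (p : MvPolynomial (Fin n × Fin n) ℂ) (t : ℂ), (aeval Lq p).eval t =
      p.eval fun q => (1 + t • A) q.1 q.2 := by
    intro p t
    rw [eval_aeval_polynomial]
    congr 2
    ext q
    simp only [Lq, L, Matrix.of_apply, Polynomial.eval_add, Polynomial.eval_C, Polynomial.eval_mul,
      Polynomial.eval_X, Matrix.add_apply, Matrix.smul_apply, smul_eq_mul]
    ring
  let u : W → Polynomial ℂ := fun w => ∑ a, ∑ b,
    Polynomial.C (ℓ (Pi.single a 1) * (w : Fin d → ℂ) b) * aeval Lq (P a b)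
  have hueval : ∀ (w : W) (t : ℂ), (u w).eval t = ℓ ((polyEval P (1 + t • A)).mulVec w) := by
    intro w t
    rw [hℓv]
    simp only [u, Polynomial.eval_finsetSum]
    refine Finset.sum_congr rfl fun a _ => Finset.sum_congr rfl fun b _ => ?_
    rw [Polynomial.eval_mul, Polynomial.eval_C, hLeval]
    rfl
  -- The derivative of `P(L)` is `P(L)` times the action of `L⁻¹ A`. Multiplying by `det L` replaces
  -- `L⁻¹` by the adjugate and keeps the coefficients polynomial.
  let c : Fin n × Fin n → Polynomial ℂ := fun k =>
    (L.adjugate * A.map Polynomial.C) k.1 k.2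
  have hc : ∀ q : Fin n × Fin n, ∑ k : Fin n × Fin n,
      c k * (if q.2 = k.2 then Lq (q.1, k.1) else 0) = L.det * Polynomial.C (A q.1 q.2) := by
    intro q
    have h1 : L * (L.adjugate * A.map Polynomial.C) = L.det • A.map Polynomial.C := by
      rw [← mul_assoc, Matrix.mul_adjugate, Matrix.smul_mul, one_mul]
    have h2 := congrFun (congrFun h1 q.1) q.2
    rw [Matrix.mul_apply, Matrix.smul_apply, Matrix.map_apply, smul_eq_mul] at h2
    rw [← h2, Fintype.sum_prod_type]
    refine Finset.sum_congr rfl fun k _ => ?_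
    simp [c, Lq, mul_comm]
  have hsys : ∀ a b, L.det * Polynomial.derivative (aeval Lq (P a b)) =
      ∑ k, c k * ∑ m, aeval Lq (P a m) * Polynomial.C (lie P k.1 k.2 m b) := by
    intro a b
    have h1 := derivation_aeval
      (Polynomial.derivative' : Derivation ℂ (Polynomial ℂ) (Polynomial ℂ)) Lq (P a b)
    rw [Polynomial.derivative'_apply] at h1
    have h2 : ∀ k : Fin n × Fin n, ∑ m, aeval Lq (P a m) * Polynomial.C (lie P k.1 k.2 m b) =
        ∑ q, aeval Lq (pderiv q (P a b)) * (if q.2 = k.2 then Lq (q.1, k.1) else 0) := by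
      intro k
      have h3 := congrArg (aeval Lq) ((vectorField_apply hP k.1 k.2 a b).symm.trans
        (vectorField_eq k.1 k.2 (P a b)))
      rw [map_sum, map_sum] at h3
      refine Eq.trans (Finset.sum_congr rfl fun m _ => ?_) (h3.trans
        (Finset.sum_congr rfl fun q _ => ?_))
      · rw [map_mul, aeval_C]; rfl
      · rw [map_mul]
        congr 1
        split_ifs <;> simp
    simp_rw [h2]
    rw [h1, Finset.mul_sum]
    simp_rw [Finset.mul_sum]
    rw [Finset.sum_comm]
    refine Finset.sum_congr rfl fun q _ => ?_
    have h4 : (Polynomial.derivative' : Derivation ℂ (Polynomial ℂ) (Polynomial ℂ)) (Lq q) =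
        Polynomial.C (A q.1 q.2) := by
      rw [Polynomial.derivative'_apply]
      simp [Lq, L]
    rw [h4, mul_left_comm, ← hc, Finset.mul_sum]
    exact Finset.sum_congr rfl fun k _ => by ring
  have hu0 := eq_zero_of_linear_system L.det (by
      rw [Polynomial.coeff_zero_eq_eval_zero]
      have : (Polynomial.evalRingHom (0 : ℂ)) L.det = 1 := by
        rw [RingHom.map_det]
        have : (Polynomial.evalRingHom (0 : ℂ)).mapMatrix L = 1 := by
          ext i j; simp [L]
        rw [this, Matrix.det_one]
      rw [Polynomial.coe_evalRingHom] at this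
      rw [this]; exact one_ne_zero) u c (fun k w => ⟨(lie P k.1 k.2).mulVec w, hW _ _ _ w.2⟩)
    (fun w => by
      rw [Polynomial.coeff_zero_eq_eval_zero, hueval, zero_smul, add_zero, hP.map_one,
        Matrix.one_mulVec]
      exact hℓ _ w.2)
    (fun w => by
      simp only [u, Polynomial.derivative_sum, Polynomial.derivative_C_mul]
      rw [Finset.mul_sum]
      simp_rw [Finset.mul_sum]
      rw [Finset.sum_comm (s := Finset.univ (α := Fin n × Fin n))]
      refine Finset.sum_congr rfl fun a _ => ?_
      have h1 : ∀ b, L.det * (Polynomial.C (ℓ (Pi.single a 1) * (w : Fin d → ℂ) b) *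
          Polynomial.derivative (aeval Lq (P a b))) = ∑ k : Fin n × Fin n, ∑ m,
          c k * (Polynomial.C (ℓ (Pi.single a 1) * (lie P k.1 k.2 m b * (w : Fin d → ℂ) b)) *
            aeval Lq (P a m)) := by
        intro b
        rw [mul_left_comm, hsys, Finset.mul_sum]
        refine Finset.sum_congr rfl fun k _ => ?_
        rw [Finset.mul_sum, Finset.mul_sum]
        refine Finset.sum_congr rfl fun m _ => ?_
        simp only [map_mul]
        ring
      simp_rw [h1]
      rw [Finset.sum_comm]
      refine Finset.sum_congr rfl fun k _ => ?_
      rw [Finset.sum_comm]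
      refine Finset.sum_congr rfl fun m _ => ?_
      simp only [Matrix.mulVec, dotProduct]
      rw [Finset.mul_sum, map_sum, Finset.sum_mul, Finset.mul_sum])
    ⟨w, hw⟩
  have := hueval ⟨w, hw⟩ 1
  rw [hu0] at this
  simpa [A] using this.symm

end UnitaryChar
-- Weights and the highest weight
namespace UnitaryChar

open MvPolynomial

section PartialSums

variable {n : ℕ}

/-- The sum of the first `k` entries. -/
def psum (k : ℕ) (μ : Fin n → ℕ) : ℕ := ∑ i : Fin n, if (i : ℕ) < k then μ i else 0

/-- The dominance order on vectors of natural numbers. -/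
def Dom (ν μ : Fin n → ℕ) : Prop := (∀ k, psum k ν ≤ psum k μ) ∧ psum n ν = psum n μ

/-- The sum of all partial sums. -/
def height (μ : Fin n → ℕ) : ℕ := ∑ k ∈ Finset.range (n + 1), psum k μ

theorem psum_shift {ν μ : Fin n →₀ ℕ} {i j : Fin n}
    (h : ν + Finsupp.single j 1 = μ + Finsupp.single i 1) (k : ℕ) :
    psum k ν + (if (j : ℕ) < k then 1 else 0) = psum k μ + (if (i : ℕ) < k then 1 else 0) := by
  have key : ∀ (ξ : Fin n →₀ ℕ) (a : Fin n), psum k ξ + (if (a : ℕ) < k then 1 else 0) =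
      psum k (ξ + Finsupp.single a 1 : Fin n →₀ ℕ) := by
    intro ξ a
    have h1 : (if (a : ℕ) < k then 1 else 0) =
        ∑ i : Fin n, if (i : ℕ) < k then Finsupp.single a 1 i else 0 := by
      rw [Finset.sum_eq_single a]
      · simp
      · intro b _ hb; simp [hb.symm]
      · simp
    rw [h1, psum, psum, ← Finset.sum_add_distrib]
    refine Finset.sum_congr rfl fun i _ => ?_
    split_ifs <;> simp
  rw [key, key, h]

/-- Moving one unit from slot `j` to the earlier slot `i` lowers no partial sum and increases the
sum of the entries before `j`. Hence raising operators raise the height, and a weight of maximal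
height is highest. -/
theorem height_lt_of_shift {ν μ : Fin n →₀ ℕ} {i j : Fin n} (hij : i < j)
    (h : ν + Finsupp.single j 1 = μ + Finsupp.single i 1) : height μ < height ν := by
  refine Finset.sum_lt_sum (fun k _ => ?_) ⟨j, by simp, ?_⟩
  · have := psum_shift h k
    have hij' : (i : ℕ) < j := hij
    split_ifs at this <;> omega
  · have := psum_shift h j
    have hij' : (i : ℕ) < j := hij
    simp only [lt_irrefl, if_false, hij', if_true] at this
    omega

theorem dom_of_shift {ν μ : Fin n →₀ ℕ} {i j : Fin n} (hij : j < i)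
    (h : ν + Finsupp.single j 1 = μ + Finsupp.single i 1) : Dom (n := n) ν μ := by
  have hij' : (j : ℕ) < i := hij
  constructor
  · intro k
    have := psum_shift h k
    split_ifs at this <;> omega
  · have := psum_shift h n
    simp only [Fin.is_lt, if_true] at this
    omega

theorem Dom.refl (μ : Fin n → ℕ) : Dom μ μ := ⟨fun _ => le_rfl, rfl⟩

theorem Dom.trans {ξ ν μ : Fin n → ℕ} (h₁ : Dom ξ ν) (h₂ : Dom ν μ) : Dom ξ μ :=
  ⟨fun k => (h₁.1 k).trans (h₂.1 k), h₁.2.trans h₂.2⟩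

end PartialSums

section

variable {n d : ℕ} (P : Matrix (Fin d) (Fin d) (MvPolynomial (Fin n × Fin n) ℂ))

/-- The restriction of a matrix coefficient to diagonal matrices. -/
noncomputable def torusPoly (a b : Fin d) : MvPolynomial (Fin n) ℂ :=
  bind₁ (fun q => if q.1 = q.2 then X q.1 else 0) (P a b)

theorem eval_torusPoly (x : Fin n → ℂ) (a b : Fin d) :
    (torusPoly P a b).eval x = polyEval P (Matrix.diagonal x) a b := by
  rw [torusPoly, ← MvPolynomial.coe_aeval_eq_eval, RingHom.coe_coe, aeval_bind₁, polyEval,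
    Matrix.map_apply, ← MvPolynomial.coe_aeval_eq_eval, RingHom.coe_coe]
  congr 2
  ext q
  rw [Matrix.diagonal_apply]
  split_ifs <;> simp

/-- The projection to the weight space of weight `μ`. -/
noncomputable def weightProj (μ : Fin n →₀ ℕ) : Matrix (Fin d) (Fin d) ℂ :=
  Matrix.of fun a b => coeff μ (torusPoly P a b)

/-- `v` is a vector of weight `μ`. -/
def IsWeightVec (μ : Fin n →₀ ℕ) (v : Fin d → ℂ) : Prop :=
  ∀ x : Fin n → ℂ, (polyEval P (Matrix.diagonal x)).mulVec v = (∏ i, x i ^ μ i) • v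

/-- The torus orbit of a vector, as a vector of polynomials. -/
noncomputable def torusVec (v : Fin d → ℂ) (a : Fin d) : MvPolynomial (Fin n) ℂ :=
  ∑ b, C (v b) * torusPoly P a b

theorem eval_torusVec (v : Fin d → ℂ) (a : Fin d) (x : Fin n → ℂ) :
    (torusVec P v a).eval x = (polyEval P (Matrix.diagonal x)).mulVec v a := by
  simp only [torusVec, map_sum, map_mul, eval_C, eval_torusPoly, Matrix.mulVec, dotProduct]
  exact Finset.sum_congr rfl fun b _ => mul_comm _ _

theorem coeff_torusVec (v : Fin d → ℂ) (a : Fin d) (μ : Fin n →₀ ℕ) :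
    coeff μ (torusVec P v a) = (weightProj P μ).mulVec v a := by
  simp only [torusVec, coeff_sum, coeff_C_mul, Matrix.mulVec, dotProduct, weightProj,
    Matrix.of_apply]
  exact Finset.sum_congr rfl fun b _ => mul_comm _ _

theorem eval_monomial_one (x : Fin n → ℂ) (μ : Fin n →₀ ℕ) (r : ℂ) :
    (monomial μ r).eval x = r * ∏ i, x i ^ μ i := by
  rw [eval_monomial, Finsupp.prod_fintype _ _ (by simp)]

theorem coeff_bind₁_scale (x : Fin n → ℂ) (p : MvPolynomial (Fin n) ℂ) (ν : Fin n →₀ ℕ) :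
    coeff ν (bind₁ (fun i => C (x i) * X i) p) = (∏ i, x i ^ ν i) * coeff ν p := by
  induction p using MvPolynomial.monomial_add_induction_on with
  | C a =>
    rw [bind₁_C_right]
    simp only [coeff_C]
    split_ifs with h
    · subst h; simp
    · simp
  | monomial_add μ r p _ _ ih =>
    rw [map_add, coeff_add, coeff_add, ih, mul_add]
    congr 1
    have : bind₁ (fun i => C (x i) * X i) (monomial μ r) = monomial μ (r * ∏ i, x i ^ μ i) := by
      refine MvPolynomial.funext fun y => ?_
      rw [eval_monomial_one, ← MvPolynomial.coe_aeval_eq_eval, RingHom.coe_coe, aeval_bind₁,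
        aeval_monomial, Finsupp.prod_fintype _ _ (by simp)]
      simp only [map_mul, aeval_C, aeval_X, Algebra.algebraMap_self, RingHom.id_apply, mul_pow,
        Finset.prod_mul_distrib]
      ring
    rw [this, coeff_monomial, coeff_monomial]
    split_ifs with h
    · subst h; ring
    · simp

variable {P}

theorem isWeightVec_weightProj (hP : IsPolyRep P) (μ : Fin n →₀ ℕ) (v : Fin d → ℂ) :
    IsWeightVec P μ ((weightProj P μ).mulVec v) := by
  intro x
  rw [Matrix.mulVec_mulVec, ← Matrix.smul_mulVec]
  congr 1
  ext a b
  have key : ∑ c, C (polyEval P (Matrix.diagonal x) a c) * torusPoly P c b =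
      bind₁ (fun i => C (x i) * X i) (torusPoly P a b) := by
    refine MvPolynomial.funext fun y => ?_
    have h := congrFun (congrFun (hP.map_mul (Matrix.diagonal x) (Matrix.diagonal y)) a) b
    rw [Matrix.diagonal_mul_diagonal, ← eval_torusPoly, Matrix.mul_apply] at h
    simp only [map_sum, map_mul, eval_C, eval_torusPoly]
    rw [← h, ← MvPolynomial.coe_aeval_eq_eval, RingHom.coe_coe, ← MvPolynomial.coe_aeval_eq_eval,
      RingHom.coe_coe, aeval_bind₁]
    congr 2
    ext i
    simp
  have h := congrArg (coeff μ) key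
  rw [coeff_bind₁_scale, coeff_sum] at h
  simp only [coeff_C_mul] at h
  rw [Matrix.mul_apply, Matrix.smul_apply, smul_eq_mul]
  exact h

theorem IsWeightVec.torusVec_eq {μ : Fin n →₀ ℕ} {v : Fin d → ℂ} (hv : IsWeightVec P μ v)
    (a : Fin d) : torusVec P v a = monomial μ (v a) := by
  refine MvPolynomial.funext fun x => ?_
  rw [eval_torusVec, hv, eval_monomial_one, Pi.smul_apply, smul_eq_mul, mul_comm]

theorem IsWeightVec.weightProj_mulVec {μ : Fin n →₀ ℕ} {v : Fin d → ℂ} (hv : IsWeightVec P μ v)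
    (ν : Fin n →₀ ℕ) : (weightProj P ν).mulVec v = if μ = ν then v else 0 := by
  ext a
  rw [← coeff_torusVec, hv.torusVec_eq, coeff_monomial]
  split_ifs <;> simp

/-- The weight components are the coefficients of the torus orbit of `v`, and this orbit takes the
value `v` at the identity. -/
theorem exists_weightProj_ne_zero (hP : IsPolyRep P) {v : Fin d → ℂ} (hv : v ≠ 0) :
    ∃ ν, (weightProj P ν).mulVec v ≠ 0 := by
  by_contra! hc
  apply hv
  ext a
  have h1 : torusVec P v a = 0 := by
    ext ν
    rw [coeff_torusVec, hc]; simp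
  have h2 := eval_torusVec P v a (fun _ => 1)
  rw [h1, Matrix.diagonal_one, hP.map_one, Matrix.one_mulVec, map_zero] at h2
  simpa using h2.symm

theorem weightProj_ne_zero_finite :
    {ν : Fin n →₀ ℕ | weightProj P ν ≠ 0}.Finite := by
  refine (Finset.univ.biUnion fun q : Fin d × Fin d =>
    (torusPoly P q.1 q.2).support).finite_toSet.subset fun ν hν => ?_
  by_contra hc
  apply hν
  ext a b
  simp only [Finset.coe_biUnion, Set.mem_iUnion, not_exists] at hc
  have := hc (a, b) (by simp)
  simpa [weightProj] using this

theorem IsWeightVec.lie_diag {μ : Fin n →₀ ℕ} {v : Fin d → ℂ} (hv : IsWeightVec P μ v)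
    (i : Fin n) : (lie P i i).mulVec v = (μ i : ℂ) • v := by
  ext a
  have hL : HasDerivAt (fun t : ℂ => (polyEval P (1 + t • Matrix.single i i (1 : ℂ))).mulVec v a)
      ((lie P i i).mulVec v a) 0 := by
    simp only [Matrix.mulVec, dotProduct]
    exact HasDerivAt.fun_sum fun c _ => (hasDerivAt_lie i i a c).mul_const _
  have heq : (fun t : ℂ => (polyEval P (1 + t • Matrix.single i i (1 : ℂ))).mulVec v a) =
      fun t : ℂ => (1 + t) ^ μ i * v a := by
    ext t
    have h1 : (1 + t • Matrix.single i i (1 : ℂ) : Matrix (Fin n) (Fin n) ℂ) =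
        Matrix.diagonal (fun k => if k = i then 1 + t else 1) := by
      ext a b
      rw [Matrix.add_apply, Matrix.smul_apply, Matrix.diagonal_apply, Matrix.one_apply,
        Matrix.single_apply]
      by_cases hab : a = b
      · subst hab
        by_cases ha : i = a
        · subst ha; simp
        · have ha' : ¬ a = i := fun h => ha h.symm
          simp [ha, ha']
      · have : ¬ (i = a ∧ i = b) := fun h => hab (h.1.symm.trans h.2)
        simp [hab, this]
    rw [h1, hv, Pi.smul_apply, smul_eq_mul, Finset.prod_eq_single i]
    · simp
    · intro b _ hb; simp [hb]
    · simp
  rw [heq] at hL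
  have hR : HasDerivAt (fun t : ℂ => (1 + t) ^ μ i * v a) ((μ i : ℂ) * v a) 0 := by
    have := (((hasDerivAt_id (0 : ℂ)).const_add 1).pow (μ i)).mul_const (v a)
    simpa using this
  exact hL.unique hR

/-- By `diagonal_mul_lie`, the torus orbit of the image times `X j` is a monomial. A nonzero weight
component identifies its exponent, and cancelling `X j` shows that the image is a weight vector
without any division by coordinates. -/
theorem IsWeightVec.lie_shift (hP : IsPolyRep P) {μ : Fin n →₀ ℕ} {v : Fin d → ℂ}
    (hv : IsWeightVec P μ v) (i j : Fin n) : (lie P i j).mulVec v = 0 ∨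
      ∃ ν, ν + Finsupp.single j 1 = μ + Finsupp.single i 1 ∧
        IsWeightVec P ν ((lie P i j).mulVec v) := by
  by_cases hw : (lie P i j).mulVec v = 0
  · exact Or.inl hw
  right
  set w := (lie P i j).mulVec v with hwdef
  have h1 : ∀ x : Fin n → ℂ, x j • (polyEval P (Matrix.diagonal x)).mulVec w =
      (x i * ∏ k, x k ^ μ k) • w := by
    intro x
    rw [hwdef, Matrix.mulVec_mulVec, ← Matrix.smul_mulVec, diagonal_mul_lie hP,
      Matrix.smul_mulVec, ← Matrix.mulVec_mulVec, hv, Matrix.mulVec_smul, smul_smul]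
  have h2 : ∀ a, X j * torusVec P w a = monomial (μ + Finsupp.single i 1) (w a) := by
    intro a
    refine MvPolynomial.funext fun x => ?_
    have := congrFun (h1 x) a
    rw [Pi.smul_apply, Pi.smul_apply, smul_eq_mul, smul_eq_mul] at this
    rw [map_mul, eval_X, eval_torusVec, this, ← mul_one (w a), ← monomial_mul, map_mul,
      eval_monomial_one, ← X, eval_X]
    ring
  obtain ⟨ν, hν⟩ := exists_weightProj_ne_zero hP hw
  have hνμ : ν + Finsupp.single j 1 = μ + Finsupp.single i 1 := by
    by_contra hne
    apply hν
    ext a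
    rw [← coeff_torusVec, ← coeff_X_mul ν j, add_comm, h2, coeff_monomial, if_neg (Ne.symm hne)]
    rfl
  refine ⟨ν, hνμ, fun x => ?_⟩
  ext a
  have h3 : torusVec P w a = monomial ν (w a) := by
    have h4 := h2 a
    rw [← hνμ, ← mul_one (w a), ← monomial_mul, mul_comm] at h4
    exact mul_right_cancel₀ (X_ne_zero j) h4
  rw [← eval_torusVec, h3, eval_monomial_one, Pi.smul_apply, smul_eq_mul, mul_comm]

/-- Schur's lemma for the Lie algebra action. -/
theorem eq_smul_one_of_commute (hP : IsPolyRep P) (M : Matrix (Fin d) (Fin d) ℂ)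
    (hM : ∀ i j, lie P i j * M = M * lie P i j) : ∃ c : ℂ, M = c • (1 : Matrix (Fin d) (Fin d) ℂ) := by
  have : Nonempty (Fin d) := ⟨⟨0, hP.nonempty⟩⟩
  obtain ⟨c, hc⟩ := Module.End.exists_eigenvalue (Matrix.toLin' M)
  obtain ⟨v, hv⟩ := hc.exists_hasEigenvector
  let W := Module.End.eigenspace (Matrix.toLin' M) c
  have hmem : ∀ w, w ∈ W ↔ M.mulVec w = c • w := fun w => by
    simp [W]
  have hst := mulVec_mem_of_lie hP W fun i j w hw => by
    rw [hmem] at hw ⊢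
    rw [Matrix.mulVec_mulVec, ← hM, ← Matrix.mulVec_mulVec, hw, Matrix.mulVec_smul]
  rcases hP.irreducible W (fun Z w hw => hst Z w hw) with h | h
  · exact absurd ((Submodule.mem_bot ℂ).mp (h ▸ hv.1 : v ∈ (⊥ : Submodule ℂ (Fin d → ℂ)))) hv.2
  · refine ⟨c, ?_⟩
    apply Matrix.toLin'.injective
    refine LinearMap.ext fun w => ?_
    have := (hmem w).mp (h ▸ Submodule.mem_top)
    simpa [Matrix.smul_mulVec] using this

/-- The vectors obtained from `v` by lowering operators. -/
inductive Lowered (P : Matrix (Fin d) (Fin d) (MvPolynomial (Fin n × Fin n) ℂ)) (v : Fin d → ℂ) :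
    (Fin d → ℂ) → Prop
  | base : Lowered P v v
  | step (i j : Fin n) (hij : j < i) (w : Fin d → ℂ) (hw : Lowered P v w) :
      Lowered P v ((lie P i j).mulVec w)

/-- The bracket relations move any operator past the lowering operators until it reaches `v`, where
it acts by zero, by a scalar or by lowering. So the span is stable under the Lie algebra, and
irreducibility makes it everything. -/
theorem span_lowered_eq_top (hP : IsPolyRep P) {μ : Fin n →₀ ℕ} {v : Fin d → ℂ} (hv0 : v ≠ 0)
    (hv : IsWeightVec P μ v) (hup : ∀ i j : Fin n, i < j → (lie P i j).mulVec v = 0) :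
    Submodule.span ℂ {w | Lowered P v w} = ⊤ := by
  set W := Submodule.span ℂ {w | Lowered P v w} with hW
  have hlow : ∀ i j : Fin n, j < i → ∀ w ∈ W, (lie P i j).mulVec w ∈ W := by
    intro i j hij w hw
    induction hw using Submodule.span_induction with
    | mem w hw => exact Submodule.subset_span (Lowered.step i j hij w hw)
    | zero => simp
    | add w₁ w₂ _ _ h₁ h₂ => rw [Matrix.mulVec_add]; exact add_mem h₁ h₂
    | smul c w _ h => rw [Matrix.mulVec_smul]; exact W.smul_mem c h
  have hbase : v ∈ W := Submodule.subset_span Lowered.base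
  have hgen : ∀ w, Lowered P v w → ∀ i j, (lie P i j).mulVec w ∈ W := by
    intro w hw
    induction hw with
    | base =>
      intro i j
      rcases lt_trichotomy i j with h | h | h
      · rw [hup i j h]; exact W.zero_mem
      · subst h
        rw [hv.lie_diag]; exact W.smul_mem _ hbase
      · exact hlow i j h v hbase
    | step k l hkl w hw ih =>
      intro i j
      have hb := congrArg (fun M => M.mulVec w) (lie_bracket hP i j k l)
      simp only [Matrix.sub_mulVec, ← Matrix.mulVec_mulVec] at hb
      rw [eq_add_of_sub_eq hb]
      refine add_mem (sub_mem ?_ ?_) (hlow k l hkl _ (ih i j))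
      · split_ifs
        · exact ih i l
        · simp
      · split_ifs
        · exact ih k j
        · simp
  have hst : ∀ i j, ∀ w ∈ W, (lie P i j).mulVec w ∈ W := by
    intro i j w hw
    induction hw using Submodule.span_induction with
    | mem w hw => exact hgen w hw i j
    | zero => simp
    | add w₁ w₂ _ _ h₁ h₂ => rw [Matrix.mulVec_add]; exact add_mem h₁ h₂
    | smul c w _ h => rw [Matrix.mulVec_smul]; exact W.smul_mem c h
  rcases hP.irreducible W (mulVec_mem_of_lie hP W hst) with h | h
  · exact absurd ((Submodule.mem_bot ℂ).mp (h ▸ hbase)) hv0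
  · exact h

theorem Lowered.weight (hP : IsPolyRep P) {μ : Fin n →₀ ℕ} {v : Fin d → ℂ}
    (hv : IsWeightVec P μ v) {w : Fin d → ℂ} (hw : Lowered P v w) :
    w = v ∨ w = 0 ∨ ∃ ν : Fin n →₀ ℕ, IsWeightVec P ν w ∧ Dom (n := n) ν μ ∧
      height ν < height μ := by
  induction hw with
  | base => exact Or.inl rfl
  | step i j hij w hw ih =>
    right
    rcases ih with rfl | rfl | ⟨ν, hν, hd, hh⟩
    · rcases hv.lie_shift hP i j with h | ⟨ξ, hξ, hw⟩
      · exact Or.inl h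
      · exact Or.inr ⟨ξ, hw, dom_of_shift hij hξ, height_lt_of_shift hij hξ.symm⟩
    · left; simp
    · rcases hν.lie_shift hP i j with h | ⟨ξ, hξ, hw⟩
      · exact Or.inl h
      · exact Or.inr ⟨ξ, hw, (dom_of_shift hij hξ).trans hd,
          (height_lt_of_shift hij hξ.symm).trans hh⟩

/-- The highest weight: it has multiplicity one and dominates all weights. -/
theorem exists_highest_weight (hP : IsPolyRep P) : ∃ μ : Fin n →₀ ℕ,
    (weightProj P μ).trace = 1 ∧ ∀ ν : Fin n →₀ ℕ, weightProj P ν ≠ 0 → Dom (n := n) ν μ := by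
  have hne : {ν : Fin n →₀ ℕ | weightProj P ν ≠ 0}.Nonempty := by
    have hv : (fun _ => 1 : Fin d → ℂ) ≠ 0 := fun h =>
      one_ne_zero (congrFun h ⟨0, hP.nonempty⟩)
    obtain ⟨ν, hν⟩ := exists_weightProj_ne_zero hP hv
    exact ⟨ν, fun h => hν (by rw [h]; simp)⟩
  -- Maximal height forces all raising operators to kill the vectors of weight `μ`; maximality for
  -- dominance is not needed at this point.
  obtain ⟨μ, hμ, hmax⟩ := Set.exists_max_image _ (fun ν : Fin n →₀ ℕ => height (n := n) ν)
    (weightProj_ne_zero_finite (P := P)) hne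
  obtain ⟨u, hu⟩ : ∃ u, (weightProj P μ).mulVec u ≠ 0 := by
    by_contra! hc
    apply hμ
    apply Matrix.toLin'.injective
    refine LinearMap.ext fun w => ?_
    simpa using hc w
  set v := (weightProj P μ).mulVec u with hvdef
  have hv : IsWeightVec P μ v := isWeightVec_weightProj hP μ u
  have hup : ∀ i j : Fin n, i < j → (lie P i j).mulVec v = 0 := by
    intro i j hij
    rcases hv.lie_shift hP i j with h | ⟨ξ, hξ, hw⟩
    · exact h
    · by_contra hne
      have h1 := hw.weightProj_mulVec ξ
      rw [if_pos rfl] at h1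
      have h2 : weightProj P ξ ≠ 0 := fun h => hne (by rw [← h1, h]; simp)
      exact absurd (hmax ξ h2) (not_le.mpr (height_lt_of_shift hij hξ))
  have htop := span_lowered_eq_top hP hu hv hup
  refine ⟨μ, ?_, ?_⟩
  -- Every lowered vector other than `v` is zero or has smaller height, hence another weight, so the
  -- projection sends everything to multiples of `v`. It fixes `v`, and a rank one operator fixing a
  -- nonzero vector of its image has trace one.
  · have hφ : ∀ w, ∃ c : ℂ, (weightProj P μ).mulVec w = c • v := by
      intro w
      have hw : w ∈ Submodule.span ℂ {w | Lowered P v w} := htop ▸ Submodule.mem_top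
      induction hw using Submodule.span_induction with
      | mem w hw =>
        rcases Lowered.weight hP hv hw with rfl | rfl | ⟨ν, hν, hd, hh⟩
        · exact ⟨1, by rw [hv.weightProj_mulVec, if_pos rfl, one_smul]⟩
        · exact ⟨0, by simp⟩
        · refine ⟨0, ?_⟩
          rw [hν.weightProj_mulVec, if_neg, zero_smul]
          rintro rfl
          exact lt_irrefl _ hh
      | zero => exact ⟨0, by simp⟩
      | add w₁ w₂ _ _ h₁ h₂ =>
        obtain ⟨c₁, h₁⟩ := h₁
        obtain ⟨c₂, h₂⟩ := h₂
        exact ⟨c₁ + c₂, by rw [Matrix.mulVec_add, h₁, h₂, add_smul]⟩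
      | smul c w _ h =>
        obtain ⟨c', h⟩ := h
        exact ⟨c * c', by rw [Matrix.mulVec_smul, h, smul_smul]⟩
    choose φ hφ using hφ
    have hcol : ∀ a b, weightProj P μ a b = φ (Pi.single b 1) * v a := by
      intro a b
      have := congrFun (hφ (Pi.single b 1)) a
      rw [Matrix.mulVec_single_one] at this
      simpa using this
    have hvv : (weightProj P μ).mulVec v = v := by rw [hv.weightProj_mulVec, if_pos rfl]
    obtain ⟨a, ha⟩ : ∃ a, v a ≠ 0 := by
      by_contra! hc
      exact hu (funext hc)
    have h1 := congrFun hvv a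
    simp only [Matrix.mulVec, dotProduct, hcol] at h1
    rw [Matrix.trace]
    simp only [Matrix.diag_apply, hcol]
    have h2 : (∑ b, φ (Pi.single b 1) * v b) * v a = v a := by
      rw [Finset.sum_mul]
      refine Eq.trans (Finset.sum_congr rfl fun b _ => ?_) h1
      ring
    exact mul_right_cancel₀ ha (by rw [h2, one_mul])
  · intro ν hν
    by_contra hd
    apply hν
    apply Matrix.toLin'.injective
    refine LinearMap.ext fun w => ?_
    rw [Matrix.toLin'_apply, map_zero, LinearMap.zero_apply]
    have hw : w ∈ Submodule.span ℂ {w | Lowered P v w} := htop ▸ Submodule.mem_top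
    induction hw using Submodule.span_induction with
    | mem w hw =>
      rcases Lowered.weight hP hv hw with rfl | rfl | ⟨ξ, hξ, hd', hh⟩
      · rw [hv.weightProj_mulVec, if_neg]
        rintro rfl
        exact hd (Dom.refl _)
      · simp
      · rw [hξ.weightProj_mulVec, if_neg]
        rintro rfl
        exact hd hd'
    | zero => simp
    | add w₁ w₂ _ _ h₁ h₂ => rw [Matrix.mulVec_add, h₁, h₂, add_zero]
    | smul c w _ h => rw [Matrix.mulVec_smul, h, smul_zero]

end

end UnitaryChar
-- Dominance order, alternants and the Vandermonde polynomial
namespace UnitaryChar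

open MvPolynomial

section Dominance

variable {n : ℕ}

theorem psum_add (k : ℕ) (μ ν : Fin n → ℕ) : psum k (μ + ν) = psum k μ + psum k ν := by
  rw [psum, psum, psum, ← Finset.sum_add_distrib]
  refine Finset.sum_congr rfl fun i _ => ?_
  split_ifs <;> simp

theorem eq_of_psum_eq {μ ν : Fin n → ℕ} (h : ∀ k, psum k μ = psum k ν) : μ = ν := by
  have key : ∀ (ξ : Fin n → ℕ) (i : Fin n), psum (i + 1) ξ = psum i ξ + ξ i := by
    intro ξ i
    have : ξ i = ∑ j : Fin n, if j = i then ξ j else 0 := by simp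
    rw [this, psum, psum, ← Finset.sum_add_distrib]
    refine Finset.sum_congr rfl fun j _ => ?_
    simp only [Fin.ext_iff]
    split_ifs <;> omega
  ext i
  have h1 := h (i + 1)
  rw [key, key, h i] at h1
  omega

/-- For antitone `m`, pairing with `m` is monotone for the dominance order. -/
theorem Dom.sum_mul_le {m y z : Fin n → ℕ} (hm : Antitone m) (h : Dom y z) :
    ∑ i, m i * y i ≤ ∑ i, m i * z i := by
  obtain ⟨M, hM⟩ : ∃ M, ∀ i, m i ≤ M := ⟨∑ i, m i, fun i =>
    Finset.single_le_sum (f := m) (fun _ _ => Nat.zero_le _) (Finset.mem_univ i)⟩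
  -- The sets where an antitone `m` exceeds a level are initial segments, so summing over levels
  -- writes the pairing with `m` as a sum of partial sums.
  have hlayer : ∀ k, ∃ t, ∀ i : Fin n, k < m i ↔ (i : ℕ) < t := by
    intro k
    have hex : ∃ t, ∀ i : Fin n, t ≤ (i : ℕ) → m i ≤ k :=
      ⟨n, fun i hi => absurd i.2 (not_lt.mpr hi)⟩
    classical
    refine ⟨Nat.find hex, fun i => ⟨fun hi => ?_, fun hi => ?_⟩⟩
    · by_contra hc
      exact absurd (Nat.find_spec hex i (not_lt.mp hc)) (not_le.mpr hi)
    · by_contra hc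
      exact Nat.find_min hex hi fun j hj => (hm (Fin.le_def.mpr hj)).trans (not_lt.mp hc)
  choose t ht using hlayer
  have hsum : ∀ w : Fin n → ℕ, ∑ i, m i * w i = ∑ k ∈ Finset.range M, psum (t k) w := by
    intro w
    simp only [psum]
    rw [Finset.sum_comm]
    refine Finset.sum_congr rfl fun i _ => ?_
    simp only [← ht]
    rw [← Finset.sum_filter, Finset.sum_const, smul_eq_mul]
    congr 1
    rw [show (Finset.range M).filter (fun k => k < m i) = Finset.range (m i) by
      ext k; have := hM i; simp; omega]
    simp
  rw [hsum, hsum]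
  exact Finset.sum_le_sum fun k _ => h.1 _

/-- With equal lengths, `|l - m|² = 2 (⟨m, m⟩ - ⟨m, l⟩)`, and dominance makes the right side at most
zero. -/
theorem Dom.eq_of_sum_sq {m l : Fin n → ℕ} (hm : Antitone m) (h : Dom m l)
    (hsq : ∑ i, m i ^ 2 = ∑ i, l i ^ 2) : m = l := by
  have h1 := h.sum_mul_le hm
  have h2 : ∑ i, ((l i : ℤ) - m i) ^ 2 ≤ 0 := by
    have : ∑ i, ((l i : ℤ) - m i) ^ 2 =
        ∑ i, (l i : ℤ) ^ 2 + ∑ i, (m i : ℤ) ^ 2 - 2 * ∑ i, (m i : ℤ) * l i := by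
      rw [Finset.mul_sum, ← Finset.sum_add_distrib, ← Finset.sum_sub_distrib]
      exact Finset.sum_congr rfl fun i _ => by ring
    rw [this]
    have h3 : ∑ i, (m i : ℤ) ^ 2 ≤ ∑ i, (m i : ℤ) * l i := by
      have : ∑ i, m i ^ 2 ≤ ∑ i, m i * l i := by simpa [sq] using h1
      exact_mod_cast this
    have h4 : ∑ i, (m i : ℤ) ^ 2 = ∑ i, (l i : ℤ) ^ 2 := by exact_mod_cast hsq
    linarith
  have h5 := (Finset.sum_eq_zero_iff_of_nonneg (fun i _ => sq_nonneg ((l i : ℤ) - m i))).mp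
    (le_antisymm h2 (Finset.sum_nonneg fun i _ => sq_nonneg _))
  ext i
  have := pow_eq_zero_iff (two_ne_zero) |>.mp (h5 i (Finset.mem_univ i))
  omega

/-- This is the rearrangement inequality against the indicator of the first `k` slots. -/
theorem dom_comp_perm {l : Fin n → ℕ} (hl : Antitone l) (σ : Equiv.Perm (Fin n)) :
    Dom (l ∘ σ) l := by
  constructor
  · intro k
    have hmono : Monovary (fun i : Fin n => if (i : ℕ) < k then 1 else 0) l := by
      intro i j hij
      have : j < i := by
        by_contra hc
        exact absurd (hl (not_lt.mp hc)) (not_le.mpr hij)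
      have h' : (j : ℕ) < i := this
      simp only
      split_ifs <;> omega
    have := hmono.sum_mul_comp_perm_le_sum_mul (σ := σ)
    simpa [psum] using this
  · simp only [psum, Fin.is_lt, if_true]
    exact Equiv.sum_comp σ l

end Dominance

section Alternant

variable {n : ℕ}

/-- The alternating sum of the monomials in the orbit of `l`. -/
noncomputable def alternant (l : Fin n →₀ ℕ) : MvPolynomial (Fin n) ℂ :=
  ∑ σ : Equiv.Perm (Fin n), monomial (l.mapDomain σ) ((Equiv.Perm.sign σ : ℤ) : ℂ)

theorem mapDomain_perm_apply (l : Fin n →₀ ℕ) (σ : Equiv.Perm (Fin n)) (i : Fin n) :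
    l.mapDomain σ (σ i) = l i := Finsupp.mapDomain_apply σ.injective _ _

theorem coe_mapDomain_perm (l : Fin n →₀ ℕ) (σ : Equiv.Perm (Fin n)) :
    (l.mapDomain σ : Fin n → ℕ) = l ∘ (σ⁻¹ : Equiv.Perm (Fin n)) := by
  ext i
  simp

theorem eval_alternant (l : Fin n →₀ ℕ) (x : Fin n → ℂ) :
    (alternant l).eval x = (Matrix.of fun i j => x i ^ l j).det := by
  rw [alternant, map_sum, Matrix.det_apply']
  refine Finset.sum_congr rfl fun σ _ => ?_
  rw [eval_monomial_one, ← Equiv.prod_comp σ]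
  simp only [mapDomain_perm_apply, Matrix.of_apply]

/-- The exponent vector `(n - 1, …, 1, 0)`. -/
noncomputable def rhoVec (n : ℕ) : Fin n →₀ ℕ := Finsupp.equivFunOnFinite.symm fun i => (i.rev : ℕ)

theorem rhoVec_strictAnti : StrictAnti (rhoVec n) := by
  intro i j hij
  have : (i : ℕ) < j := hij
  simp [rhoVec, Fin.rev]
  omega

/-- The Vandermonde polynomial. -/
noncomputable def vdm (n : ℕ) : MvPolynomial (Fin n) ℂ := alternant (rhoVec n)

theorem eval_vdm (x : Fin n → ℂ) :
    (vdm n).eval x = ∏ i, ∏ j ∈ Finset.Ioi i, (x i - x j) := by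
  have h := Matrix.det_projVandermonde (fun _ => 1) x
  rw [vdm, eval_alternant]
  simp only [one_mul] at h
  rw [← h]
  congr 1
  ext i j
  simp [Matrix.projVandermonde_apply, rhoVec]

theorem vdm_eq_prod : vdm n = ∏ i, ∏ j ∈ Finset.Ioi i, (X i - X j) := by
  refine MvPolynomial.funext fun x => ?_
  rw [eval_vdm]
  simp [map_prod]

theorem mapDomain_perm_injective {l : Fin n →₀ ℕ} (hl : Function.Injective l)
    {σ τ : Equiv.Perm (Fin n)} (h : l.mapDomain σ = l.mapDomain τ) : σ = τ := by
  have h1 : (l.mapDomain σ : Fin n → ℕ) = l.mapDomain τ := by rw [h]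
  rw [coe_mapDomain_perm, coe_mapDomain_perm] at h1
  have : σ⁻¹ = τ⁻¹ := Equiv.ext fun i => hl (congrFun h1 i)
  exact inv_injective this

theorem coeff_alternant_mapDomain {l : Fin n →₀ ℕ} (hl : Function.Injective l)
    (σ : Equiv.Perm (Fin n)) :
    coeff (l.mapDomain σ) (alternant l) = ((Equiv.Perm.sign σ : ℤ) : ℂ) := by
  rw [alternant, coeff_sum, Finset.sum_eq_single σ]
  · simp
  · intro τ _ hτ
    rw [coeff_monomial, if_neg fun h => hτ (mapDomain_perm_injective hl h)]
  · simp

theorem exists_of_coeff_alternant_ne_zero {l m : Fin n →₀ ℕ} (h : coeff m (alternant l) ≠ 0) :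
    ∃ σ : Equiv.Perm (Fin n), m = l.mapDomain σ := by
  by_contra! hc
  apply h
  rw [alternant, coeff_sum]
  refine Finset.sum_eq_zero fun σ _ => ?_
  rw [coeff_monomial, if_neg (Ne.symm (hc σ))]

theorem rename_alternant (l : Fin n →₀ ℕ) (τ : Equiv.Perm (Fin n)) :
    rename τ (alternant l) = C ((Equiv.Perm.sign τ : ℤ) : ℂ) * alternant l := by
  have hs : ((Equiv.Perm.sign τ : ℤ) : ℂ) * ((Equiv.Perm.sign τ : ℤ) : ℂ) = 1 := by
    rw [← Int.cast_mul, ← Units.val_mul, Int.units_mul_self]; simp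
  rw [alternant, map_sum, Finset.mul_sum, ← Equiv.sum_comp (Equiv.mulLeft τ)
    (fun σ => C ((Equiv.Perm.sign τ : ℤ) : ℂ) *
      monomial (l.mapDomain σ) ((Equiv.Perm.sign σ : ℤ) : ℂ))]
  refine Finset.sum_congr rfl fun σ _ => ?_
  rw [rename_monomial, C_mul_monomial, ← Finsupp.mapDomain_comp]
  simp only [Equiv.coe_mulLeft, Equiv.Perm.sign_mul, Units.val_mul, Int.cast_mul]
  rw [← mul_assoc, hs, one_mul]
  rfl

theorem vdm_ne_zero : vdm n ≠ 0 := by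
  intro h
  have := coeff_alternant_mapDomain (rhoVec_strictAnti (n := n)).injective 1
  rw [← vdm, h] at this
  simp at this

/-- The Euler operator `xᵢ ∂ᵢ`. -/
noncomputable def euler (i : Fin n) : Derivation ℂ (MvPolynomial (Fin n) ℂ) (MvPolynomial (Fin n) ℂ) :=
  (X i : MvPolynomial (Fin n) ℂ) • pderiv i

theorem coeff_euler (i : Fin n) (p : MvPolynomial (Fin n) ℂ) (m : Fin n →₀ ℕ) :
    coeff m (euler i p) = (m i : ℂ) * coeff m p := by
  induction p using MvPolynomial.monomial_add_induction_on with
  | C a =>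
    rw [euler, Derivation.smul_apply, pderiv_C, smul_zero, coeff_zero, coeff_C]
    split_ifs with h
    · subst h; simp
    · simp
  | monomial_add μ r p _ _ ih =>
    rw [map_add, coeff_add, coeff_add, ih, mul_add]
    congr 1
    rw [euler, Derivation.smul_apply, smul_eq_mul, X_mul_pderiv_monomial, coeff_smul,
      coeff_monomial]
    split_ifs with h
    · subst h; simp
    · simp

theorem eval_euler_prod {ι : Type*} (k : Fin n) (x : Fin n → ℂ) (s : Finset ι)
    (f : ι → MvPolynomial (Fin n) ℂ) (hf : ∀ i ∈ s, (f i).eval x ≠ 0) :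
    (euler k (∏ i ∈ s, f i)).eval x =
      (∏ i ∈ s, f i).eval x * ∑ i ∈ s, (euler k (f i)).eval x / (f i).eval x := by
  classical
  induction s using Finset.induction_on with
  | empty => simp
  | insert a s ha ih =>
    rw [Finset.prod_insert ha, Finset.sum_insert ha, Derivation.leibniz, map_add, smul_eq_mul,
      smul_eq_mul, map_mul, map_mul, ih fun i hi => hf i (Finset.mem_insert_of_mem hi), map_mul]
    have := hf a (Finset.mem_insert_self a s)
    field_simp
    ring

/-- The logarithmic derivative of the product of the differences; distinct coordinates are needed
for the division. -/
theorem eval_euler_vdm (k : Fin n) (x : Fin n → ℂ) (hx : Function.Injective x) :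
    (euler k (vdm n)).eval x = (vdm n).eval x * ∑ i, ∑ j ∈ Finset.Ioi i,
      ((if i = k then x i else 0) - (if j = k then x j else 0)) / (x i - x j) := by
  have hne : ∀ i, ∀ j ∈ Finset.Ioi i, x i - x j ≠ 0 := fun i j hj =>
    sub_ne_zero.mpr fun h => (Finset.mem_Ioi.mp hj).ne (hx h)
  have hX : ∀ i, (euler k (X i)).eval x = if i = k then x i else 0 := by
    intro i
    rw [euler, Derivation.smul_apply, pderiv_X, smul_eq_mul, map_mul, eval_X]
    by_cases h : i = k
    · subst h; simp
    · simp [h]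
  have hpe : ∀ i, (∏ j ∈ Finset.Ioi i, (X i - X j : MvPolynomial (Fin n) ℂ)).eval x ≠ 0 := by
    intro i
    rw [map_prod]
    refine Finset.prod_ne_zero_iff.mpr fun j hj => ?_
    simpa using hne i j hj
  rw [vdm_eq_prod, eval_euler_prod k x _ _ fun i _ => hpe i]
  congr 1
  refine Finset.sum_congr rfl fun i _ => ?_
  rw [eval_euler_prod k x _ _ fun j hj => by simpa using hne i j hj, mul_div_assoc,
    mul_div_cancel₀ _ (hpe i)]
  refine Finset.sum_congr rfl fun j _ => ?_
  rw [map_sub, map_sub, hX, hX, map_sub, eval_X, eval_X]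

/-- Every exponent of the Vandermonde polynomial is a rearrangement of `rhoVec n`, and the operator
multiplies a monomial by the sum of the squares of its exponents. -/
theorem sum_euler_euler_vdm : ∑ k, euler k (euler k (vdm n)) =
    C ((∑ i, (rhoVec n i : ℂ) ^ 2)) * vdm n := by
  ext m
  rw [coeff_sum, coeff_C_mul]
  simp only [coeff_euler]
  by_cases h : coeff m (vdm n) = 0
  · simp [h]
  · obtain ⟨σ, rfl⟩ := exists_of_coeff_alternant_ne_zero h
    rw [← Equiv.sum_comp σ]
    simp only [mapDomain_perm_apply]
    rw [Finset.sum_mul]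
    exact Finset.sum_congr rfl fun i _ => by ring

end Alternant

end UnitaryChar
-- The Casimir element and the Weyl character formula
namespace UnitaryChar

open MvPolynomial

section

variable {n d : ℕ} {P : Matrix (Fin d) (Fin d) (MvPolynomial (Fin n × Fin n) ℂ)}

variable (P) in
/-- The trace of `M` times the torus element, as a polynomial. -/
noncomputable def traceTorus (M : Matrix (Fin d) (Fin d) ℂ) : MvPolynomial (Fin n) ℂ :=
  ∑ a, ∑ b, C (M a b) * torusPoly P b a

theorem eval_traceTorus (M : Matrix (Fin d) (Fin d) ℂ) (x : Fin n → ℂ) :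
    (traceTorus P M).eval x = (M * polyEval P (Matrix.diagonal x)).trace := by
  simp only [traceTorus, map_sum, map_mul, eval_C, eval_torusPoly, Matrix.trace, Matrix.diag_apply,
    Matrix.mul_apply]

theorem coeff_traceTorus (M : Matrix (Fin d) (Fin d) ℂ) (μ : Fin n →₀ ℕ) :
    coeff μ (traceTorus P M) = (M * weightProj P μ).trace := by
  simp only [traceTorus, coeff_sum, coeff_C_mul, Matrix.trace, Matrix.diag_apply,
    Matrix.mul_apply, weightProj, Matrix.of_apply]

theorem lie_mul_weightProj (hP : IsPolyRep P) (i : Fin n) (μ : Fin n →₀ ℕ) :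
    lie P i i * weightProj P μ = (μ i : ℂ) • weightProj P μ := by
  apply Matrix.toLin'.injective
  refine LinearMap.ext fun w => ?_
  rw [Matrix.toLin'_apply, Matrix.toLin'_apply, ← Matrix.mulVec_mulVec,
    (isWeightVec_weightProj hP μ w).lie_diag, Matrix.smul_mulVec]

theorem euler_traceTorus (hP : IsPolyRep P) (i : Fin n) (M : Matrix (Fin d) (Fin d) ℂ) :
    euler i (traceTorus P M) = traceTorus P (M * lie P i i) := by
  ext μ
  rw [coeff_euler, coeff_traceTorus, coeff_traceTorus, mul_assoc, lie_mul_weightProj hP,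
    Matrix.mul_smul, Matrix.trace_smul, smul_eq_mul]

/-- The Casimir element acts by a scalar. -/
theorem exists_casimir (hP : IsPolyRep P) :
    ∃ c : ℂ, ∑ i, ∑ j, lie P i j * lie P j i = c • (1 : Matrix (Fin d) (Fin d) ℂ) := by
  apply eq_smul_one_of_commute hP
  intro k l
  rw [← sub_eq_zero, Finset.mul_sum, Finset.sum_mul, ← Finset.sum_sub_distrib]
  have h1 : ∀ i, lie P k l * ∑ j, lie P i j * lie P j i - (∑ j, lie P i j * lie P j i) * lie P k l =
      ∑ j, (((if i = l then lie P k j else 0) - (if k = j then lie P i l else 0)) * lie P j i +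
        lie P i j * ((if j = l then lie P k i else 0) - (if k = i then lie P j l else 0))) := by
    intro i
    rw [Finset.mul_sum, Finset.sum_mul, ← Finset.sum_sub_distrib]
    refine Finset.sum_congr rfl fun j _ => ?_
    rw [← lie_bracket hP, ← lie_bracket hP]
    noncomm_ring
  simp_rw [h1, sub_mul, mul_sub, Finset.sum_add_distrib, Finset.sum_sub_distrib, ite_mul, mul_ite,
    zero_mul, mul_zero]
  rw [Finset.sum_comm (f := fun i j => if i = l then lie P k j * lie P j i else 0)]
  simp only [Finset.sum_ite_eq, Finset.sum_ite_eq', Finset.mem_univ, if_true]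
  rw [Finset.sum_comm (f := fun i j => if k = i then lie P i j * lie P j l else 0)]
  simp

/-- The identity matrix acts by a scalar. -/
theorem exists_central (hP : IsPolyRep P) :
    ∃ c : ℂ, ∑ i, lie P i i = c • (1 : Matrix (Fin d) (Fin d) ℂ) := by
  apply eq_smul_one_of_commute hP
  intro k l
  rw [← sub_eq_zero, Finset.mul_sum, Finset.sum_mul, ← Finset.sum_sub_distrib]
  simp_rw [lie_bracket hP]
  rw [Finset.sum_sub_distrib]
  simp

theorem traceTorus_sum {ι : Type*} (s : Finset ι) (M : ι → Matrix (Fin d) (Fin d) ℂ) :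
    traceTorus P (∑ i ∈ s, M i) = ∑ i ∈ s, traceTorus P (M i) := by
  ext μ
  rw [coeff_traceTorus, coeff_sum, Finset.sum_mul, Matrix.trace_sum]
  simp only [coeff_traceTorus]

/-- Moving the torus element past `lie P j i` and using cyclicity of the trace reverses the product
up to scalars; the bracket then restores the order. Thus the off-diagonal Casimir terms become
first-order derivatives of the character. -/
theorem eval_traceTorus_lie_mul_lie (hP : IsPolyRep P) (i j : Fin n) (x : Fin n → ℂ) :
    (x i - x j) * (traceTorus P (lie P i j * lie P j i)).eval x =
      x i * ((traceTorus P (lie P i i)).eval x - (traceTorus P (lie P j j)).eval x) := by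
  simp only [eval_traceTorus]
  set T := polyEval P (Matrix.diagonal x) with hT
  have h1 := congrArg (fun M => (lie P i j * M).trace) (diagonal_mul_lie hP x j i)
  simp only [Matrix.mul_smul, Matrix.trace_smul, smul_eq_mul, ← hT] at h1
  have h2 : (lie P i j * (T * lie P j i)).trace = (lie P j i * lie P i j * T).trace := by
    rw [← mul_assoc, Matrix.trace_mul_comm, mul_assoc]
  have h3 := lie_bracket hP i j j i
  rw [if_pos rfl, if_pos rfl] at h3
  have h4 : lie P j i * lie P i j = lie P i j * lie P j i - (lie P i i - lie P j j) := by
    rw [← h3]; abel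
  rw [h2, h4, sub_mul, sub_mul, Matrix.trace_sub, Matrix.trace_sub] at h1
  rw [← mul_assoc] at h1
  linear_combination h1

/-- Multiplied by the Vandermonde polynomial, the character is an eigenfunction of the torus
Laplacian. -/
theorem exists_laplacian_eigenvalue (hP : IsPolyRep P) : ∃ c : ℂ,
    ∑ k, euler k (euler k (traceTorus P 1 * vdm n)) = C c * (traceTorus P 1 * vdm n) := by
  obtain ⟨c, hc⟩ := exists_casimir hP
  obtain ⟨N, hN⟩ := exists_central hP
  have hsmul : ∀ z : ℂ, traceTorus P (z • (1 : Matrix (Fin d) (Fin d) ℂ)) = C z * traceTorus P 1 := by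
    intro z
    ext μ
    rw [coeff_C_mul, coeff_traceTorus, coeff_traceTorus, Matrix.smul_mul, Matrix.trace_smul,
      smul_eq_mul]
  -- The three contributions are the Casimir scalar, the central scalar counted `n - 1` times
  -- through the pairs `e i + e j`, and the eigenvalue of the Vandermonde polynomial.
  refine ⟨c + ((n : ℂ) - 1) * N + ∑ i, (rhoVec n i : ℂ) ^ 2, ?_⟩
  -- An extra Vandermonde factor makes the identity trivial at points with repeated coordinates, so
  -- divisions by `x i - x j` are legitimate in what remains.
  apply mul_right_cancel₀ (vdm_ne_zero (n := n))
  refine MvPolynomial.funext fun x => ?_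
  rw [map_mul, map_mul]
  by_cases hx : Function.Injective x
  swap
  · have : (vdm n).eval x = 0 := by
      rw [eval_vdm]
      simp only [Function.Injective, not_forall] at hx
      obtain ⟨a, b, hab, hne⟩ := hx
      rcases lt_or_gt_of_ne hne with h | h
      · exact Finset.prod_eq_zero (Finset.mem_univ a)
          (Finset.prod_eq_zero (Finset.mem_Ioi.mpr h) (sub_eq_zero.mpr hab))
      · exact Finset.prod_eq_zero (Finset.mem_univ b)
          (Finset.prod_eq_zero (Finset.mem_Ioi.mpr h) (sub_eq_zero.mpr hab.symm))
    rw [this, mul_zero, mul_zero]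
  congr 1
  set p := traceTorus P 1 with hp
  have hne : ∀ i, ∀ j ∈ Finset.Ioi i, x i - x j ≠ 0 := fun i j hj =>
    sub_ne_zero.mpr fun h => (Finset.mem_Ioi.mp hj).ne (hx h)
  let e : Fin n → ℂ := fun i => (euler i p).eval x
  have he : ∀ i, e i = (traceTorus P (lie P i i)).eval x := fun i => by
    simp only [e, hp]; rw [euler_traceTorus hP, one_mul]
  let V := (vdm n).eval x
  -- the central character
  have hcent : ∑ i, e i = N * p.eval x := by
    simp only [he]
    rw [← map_sum, ← traceTorus_sum, hN, hsmul, map_mul, eval_C]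
  -- the Casimir identity
  have hcas : ∑ i, (euler i (euler i p)).eval x + ∑ i, ∑ j ∈ Finset.Ioi i,
      (x i + x j) * (e i - e j) / (x i - x j) = c * p.eval x := by
    have h1 : ∑ i, ∑ j, (traceTorus P (lie P i j * lie P j i)).eval x = c * p.eval x := by
      have := congrArg (fun M => (traceTorus P M).eval x) hc
      simp only [hsmul, map_mul, eval_C, traceTorus_sum, map_sum] at this
      exact this
    rw [← h1]
    have h2 : ∀ i, ∑ j, (traceTorus P (lie P i j * lie P j i)).eval x =
        (euler i (euler i p)).eval x +
          ∑ j ∈ {i}ᶜ, (traceTorus P (lie P i j * lie P j i)).eval x := by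
      intro i
      rw [← Finset.sum_add_sum_compl {i}, Finset.sum_singleton]
      congr 1
      rw [hp, euler_traceTorus hP, euler_traceTorus hP, one_mul]
    simp_rw [h2]
    rw [Finset.sum_add_distrib]
    congr 1
    rw [← Finset.sum_sum_Ioi_add_eq_sum_sum_off_diag
      (fun j i => (traceTorus P (lie P i j * lie P j i)).eval x)]
    refine Finset.sum_congr rfl fun i _ => Finset.sum_congr rfl fun j hj => ?_
    have hij := hne i j hj
    have h3 := eval_traceTorus_lie_mul_lie hP i j x
    have h4 := eval_traceTorus_lie_mul_lie hP j i x
    rw [← he, ← he] at h3 h4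
    rw [div_eq_iff hij]
    linear_combination h4 - h3
  -- the cross term
  have hcross : ∑ k, e k * (euler k (vdm n)).eval x = V * ∑ i, ∑ j ∈ Finset.Ioi i,
      (x i * e i - x j * e j) / (x i - x j) := by
    simp_rw [eval_euler_vdm _ x hx]
    rw [Finset.mul_sum]
    simp_rw [Finset.mul_sum]
    rw [Finset.sum_comm]
    refine Finset.sum_congr rfl fun i _ => ?_
    rw [Finset.sum_comm]
    refine Finset.sum_congr rfl fun j _ => ?_
    have : ∀ k, e k * (V * (((if i = k then x i else 0) - (if j = k then x j else 0)) /
        (x i - x j))) = V / (x i - x j) * ((if i = k then x i * e k else 0) -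
          (if j = k then x j * e k else 0)) := by
      intro k
      split_ifs <;> ring
    simp only [V] at this ⊢
    simp_rw [this]
    rw [← Finset.mul_sum, Finset.sum_sub_distrib]
    simp only [Finset.sum_ite_eq, Finset.mem_univ, if_true]
    ring
  have hpair : ∑ i, ∑ j ∈ Finset.Ioi i, (e i + e j) = ((n : ℂ) - 1) * ∑ i, e i := by
    have h1 := Finset.sum_sum_Ioi_add_eq_sum_sum_off_diag (fun j _ : Fin n => e j)
    have h2 : ∀ i, ∑ j ∈ ({i}ᶜ : Finset (Fin n)), e j = ∑ j, e j - e i := by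
      intro i
      rw [← Finset.sum_add_sum_compl {i} e, Finset.sum_singleton]; ring
    simp_rw [h2] at h1
    rw [Finset.sum_sub_distrib, Finset.sum_const, Finset.card_univ, Fintype.card_fin,
      nsmul_eq_mul] at h1
    rw [show ∑ i, ∑ j ∈ Finset.Ioi i, (e i + e j) = ∑ i, ∑ j ∈ Finset.Ioi i, (e j + e i) from
      Finset.sum_congr rfl fun i _ => Finset.sum_congr rfl fun j _ => add_comm _ _, h1]
    ring
  -- Termwise, `2 (x i e i - x j e j) = (x i + x j)(e i - e j) + (x i - x j)(e i + e j)`. This lets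
  -- the cross term of the product rule absorb the first-order part of the Casimir.
  have hrel : ∑ i, ∑ j ∈ Finset.Ioi i, (x i + x j) * (e i - e j) / (x i - x j) +
      ∑ i, ∑ j ∈ Finset.Ioi i, (e i + e j) = 2 * ∑ i, ∑ j ∈ Finset.Ioi i,
      (x i * e i - x j * e j) / (x i - x j) := by
    rw [← Finset.sum_add_distrib, Finset.mul_sum]
    refine Finset.sum_congr rfl fun i _ => ?_
    rw [← Finset.sum_add_distrib, Finset.mul_sum]
    refine Finset.sum_congr rfl fun j hj => ?_
    have hij := hne i j hj
    field_simp
    ring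
  have hvv : ∑ k, (euler k (euler k (vdm n))).eval x = (∑ i, (rhoVec n i : ℂ) ^ 2) * V := by
    rw [← map_sum, sum_euler_euler_vdm, map_mul, eval_C]
  have hexp : (∑ k, euler k (euler k (p * vdm n))).eval x =
      V * ∑ i, (euler i (euler i p)).eval x + 2 * ∑ k, e k * (euler k (vdm n)).eval x +
        p.eval x * ∑ k, (euler k (euler k (vdm n))).eval x := by
    rw [map_sum, Finset.mul_sum, Finset.mul_sum, Finset.mul_sum, ← Finset.sum_add_distrib,
      ← Finset.sum_add_distrib]
    refine Finset.sum_congr rfl fun k _ => ?_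
    simp only [Derivation.leibniz, smul_eq_mul, map_add, map_mul, V, e]
    ring
  rw [hexp, hcross, hvv, map_mul, map_mul, eval_C]
  have hVx : (vdm n).eval x = V := rfl
  rw [hVx]
  linear_combination V * hcas + (-V) * hrel + V * hpair + (((n : ℂ) - 1) * V) * hcent

/-- Permuting the coordinates is conjugation by a permutation matrix, on which the representation is
also defined. -/
theorem rename_traceTorus_one (hP : IsPolyRep P) (σ : Equiv.Perm (Fin n)) :
    rename σ (traceTorus P 1) = traceTorus P 1 := by
  refine MvPolynomial.funext fun x => ?_
  rw [eval_rename, eval_traceTorus, eval_traceTorus, one_mul, one_mul]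
  let A : Matrix (Fin n) (Fin n) ℂ := (1 : Matrix (Fin n) (Fin n) ℂ).submatrix σ (Equiv.refl _)
  let B : Matrix (Fin n) (Fin n) ℂ := (1 : Matrix (Fin n) (Fin n) ℂ).submatrix (Equiv.refl _) σ
  have h1 : Matrix.diagonal (x ∘ σ) = A * (Matrix.diagonal x * B) := by
    have : Matrix.diagonal x = (Matrix.diagonal x).submatrix (Equiv.refl _) (Equiv.refl _) := rfl
    simp only [A, B]
    rw [this, Matrix.submatrix_mul_equiv, Matrix.submatrix_mul_equiv, mul_one, one_mul,
      Matrix.submatrix_diagonal _ _ σ.injective]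
  have h2 : B * A = 1 := by
    simp only [A, B]
    rw [Matrix.submatrix_mul_equiv, mul_one]
    rfl
  rw [h1, hP.map_mul, hP.map_mul, ← mul_assoc, Matrix.trace_mul_comm, ← mul_assoc, ← hP.map_mul,
    h2, hP.map_one, one_mul]

/-- The Weyl character formula. -/
theorem weyl_character (hP : IsPolyRep P) : ∃ l : Fin n → ℕ, Function.Injective l ∧
    ∀ x : Fin n → ℂ, (polyEval P (Matrix.diagonal x)).trace *
      ∏ i, ∏ j ∈ Finset.Ioi i, (x i - x j) = (Matrix.of fun i j => x i ^ l j).det := by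
  obtain ⟨c, hc⟩ := exists_laplacian_eigenvalue hP
  obtain ⟨μ, hμ1, hμ⟩ := exists_highest_weight hP
  set p := traceTorus P 1 with hp
  set q := p * vdm n with hq
  set l := μ + rhoVec n with hl
  have hcoeffp : ∀ ν, coeff ν p = (weightProj P ν).trace := fun ν => by
    rw [hp, coeff_traceTorus, one_mul]
  have hpdom : ∀ ν, coeff ν p ≠ 0 → Dom (n := n) ν μ := fun ν hν => hμ ν fun h => hν (by
    rw [hcoeffp, h, Matrix.trace_zero])
  have hvdom : ∀ ξ, coeff ξ (vdm n) ≠ 0 → Dom (n := n) ξ (rhoVec n) := by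
    intro ξ hξ
    obtain ⟨σ, rfl⟩ := exists_of_coeff_alternant_ne_zero hξ
    rw [coe_mapDomain_perm]
    exact dom_comp_perm rhoVec_strictAnti.antitone _
  have hqdom : ∀ m, coeff m q ≠ 0 → Dom (n := n) m l := by
    intro m hm
    rw [hq, coeff_mul] at hm
    obtain ⟨⟨ν, ξ⟩, hνξ, hne⟩ := Finset.exists_ne_zero_of_sum_ne_zero hm
    rw [Finset.HasAntidiagonal.mem_antidiagonal] at hνξ
    have h1 := hpdom ν (left_ne_zero_of_mul hne)
    have h2 := hvdom ξ (right_ne_zero_of_mul hne)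
    simp only at hνξ
    rw [← hνξ, hl, Finsupp.coe_add, Finsupp.coe_add]
    refine ⟨fun k => ?_, ?_⟩
    · rw [psum_add, psum_add]; exact add_le_add (h1.1 k) (h2.1 k)
    · rw [psum_add, psum_add, h1.2, h2.2]
  -- Both factors have dominant top exponents `μ` and `rhoVec n`, so these are the only pair with
  -- sum `l`, and both coefficients there are one.
  have hql : coeff l q = 1 := by
    rw [hq, coeff_mul, Finset.sum_eq_single (μ, rhoVec n)]
    · have := coeff_alternant_mapDomain (rhoVec_strictAnti (n := n)).injective 1
      simp only [Equiv.Perm.coe_one, Finsupp.mapDomain_id, Equiv.Perm.sign_one] at this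
      rw [hcoeffp, hμ1, vdm, this]
      simp
    · rintro ⟨ν, ξ⟩ hνξ hne
      rw [Finset.HasAntidiagonal.mem_antidiagonal] at hνξ
      by_contra hc
      have h1 := hpdom ν (left_ne_zero_of_mul hc)
      have h2 := hvdom ξ (right_ne_zero_of_mul hc)
      simp only at hνξ
      have h3 : ∀ k, psum (n := n) k ν + psum (n := n) k ξ =
          psum (n := n) k μ + psum (n := n) k (rhoVec n) := by
        intro k
        rw [← psum_add, ← psum_add, ← Finsupp.coe_add, ← Finsupp.coe_add, hνξ]
      apply hne
      have h4 : ν = μ := DFunLike.coe_injective (eq_of_psum_eq fun k => by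
        have := h3 k; have := h1.1 k; have := h2.1 k; omega)
      have h5 : ξ = rhoVec n := DFunLike.coe_injective (eq_of_psum_eq fun k => by
        have := h3 k; have := h1.1 k; have := h2.1 k; omega)
      rw [h4, h5]
    · intro h
      rw [Finset.HasAntidiagonal.mem_antidiagonal] at h
      exact absurd hl.symm h
  -- The Laplacian is diagonal on monomials, so all exponents of an eigenfunction have the same
  -- Euclidean length.
  have hqsq : ∀ m, coeff m q ≠ 0 → (∑ i, m i ^ 2) = ∑ i, l i ^ 2 := by
    have h1 : ∀ m, coeff m q ≠ 0 → (∑ i, (m i : ℂ) ^ 2) = c := by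
      intro m hm
      have := congrArg (coeff m) hc
      rw [coeff_sum, coeff_C_mul] at this
      simp only [coeff_euler] at this
      apply mul_right_cancel₀ hm
      rw [← this, Finset.sum_mul]
      exact Finset.sum_congr rfl fun i _ => by ring
    intro m hm
    have := (h1 m hm).trans (h1 l (by rw [hql]; exact one_ne_zero)).symm
    exact_mod_cast this
  have hanti : ∀ (σ : Equiv.Perm (Fin n)) m, coeff (m.mapDomain σ) q =
      ((Equiv.Perm.sign σ : ℤ) : ℂ) * coeff m q := by
    intro σ m
    have h1 : rename σ q = C ((Equiv.Perm.sign σ : ℤ) : ℂ) * q := by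
      rw [hq, map_mul, hp, rename_traceTorus_one hP, vdm, rename_alternant]; ring
    have hs : ((Equiv.Perm.sign σ : ℤ) : ℂ) * ((Equiv.Perm.sign σ : ℤ) : ℂ) = 1 := by
      rw [← Int.cast_mul, ← Units.val_mul, Int.units_mul_self]; simp
    have h2 := coeff_rename_mapDomain σ σ.injective q m
    rw [h1, coeff_C_mul] at h2
    rw [← h2, ← mul_assoc, hs, one_mul]
  -- A repeated entry would make `l` fixed by a transposition, and antisymmetry would force its
  -- coefficient to vanish.
  have hinj : Function.Injective l := by
    intro i j hij
    by_contra hne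
    have h1 := hanti (Equiv.swap i j) l
    have h2 : l.mapDomain (Equiv.swap i j) = l := by
      apply DFunLike.coe_injective
      rw [coe_mapDomain_perm]
      ext k
      simp only [Equiv.swap_inv, Function.comp]
      rcases eq_or_ne k i with rfl | hki
      · rw [Equiv.swap_apply_left, hij]
      · rcases eq_or_ne k j with rfl | hkj
        · rw [Equiv.swap_apply_right, hij]
        · rw [Equiv.swap_apply_of_ne_of_ne hki hkj]
    rw [h2, hql, Equiv.Perm.sign_swap hne] at h1
    norm_num at h1
  have hmain : q = alternant l := by
    -- Sort `m` in decreasing order: the sorted exponent still occurs in `q`, is dominated by `l`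
    -- and has the same length, so it equals `l`.
    have horb : ∀ m, coeff m q ≠ 0 → ∃ σ : Equiv.Perm (Fin n), m = l.mapDomain σ := by
      intro m hm
      let τ : Equiv.Perm (Fin n) := Tuple.sort fun i => -(m i : ℤ)
      have hτ : Antitone (m ∘ τ) := by
        intro i j hij
        have := Tuple.monotone_sort (fun i => -(m i : ℤ)) hij
        simp only [Function.comp] at this ⊢
        have h : (m (τ j) : ℤ) ≤ m (τ i) := by simpa using this
        exact_mod_cast h
      have h1 : coeff (m.mapDomain (τ⁻¹ : Equiv.Perm (Fin n))) q ≠ 0 := by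
        rw [hanti]
        refine mul_ne_zero ?_ hm
        rcases Int.units_eq_one_or (Equiv.Perm.sign τ⁻¹) with h | h <;> rw [h] <;> simp
      have h2 : m.mapDomain (τ⁻¹ : Equiv.Perm (Fin n)) = l := by
        apply DFunLike.coe_injective
        refine Dom.eq_of_sum_sq ?_ (hqdom _ h1) (hqsq _ h1)
        rw [coe_mapDomain_perm, inv_inv]
        exact hτ
      refine ⟨τ, ?_⟩
      rw [← h2, ← Finsupp.mapDomain_comp]
      have : (τ : Fin n → Fin n) ∘ (τ⁻¹ : Equiv.Perm (Fin n)) = id := by ext i; simp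
      rw [this, Finsupp.mapDomain_id]
    ext m
    by_cases hm : ∃ σ : Equiv.Perm (Fin n), m = l.mapDomain σ
    · obtain ⟨σ, rfl⟩ := hm
      rw [hanti, hql, mul_one, coeff_alternant_mapDomain hinj]
    · have h1 : coeff m q = 0 := by
        by_contra h; exact hm (horb m h)
      have h2 : coeff m (alternant l) = 0 := by
        by_contra h; exact hm (exists_of_coeff_alternant_ne_zero h)
      rw [h1, h2]
  refine ⟨l, hinj, fun x => ?_⟩
  rw [← eval_alternant, ← hmain, hq, map_mul, eval_vdm, hp, eval_traceTorus, one_mul]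

end

end UnitaryChar
-- Schur polynomials on the unit torus via branching
namespace UnitaryChar

section Branching

/-- Branching: if the first row is constantly one, a determinant in `l` is a sum over the
interlacing vectors of determinants of discrete derivatives. -/
theorem det_branching {R : Type*} [CommRing R] {a : ℕ} (F : Fin (a + 1) → ℕ → R)
    (G : Fin a → ℕ → R) (c : Fin a → R) (h0 : ∀ m, F 0 m = 1)
    (hF : ∀ i m, F i.succ (m + 1) - F i.succ m = c i * G i m) (l : Fin (a + 1) → ℕ)
    (hl : Monotone l) :
    (Matrix.of fun i j => F i (l j)).det = (∏ i, c i) *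
      ∑ m ∈ Fintype.piFinset fun j : Fin a => Finset.Ico (l j.castSucc) (l j.succ),
        (Matrix.of fun i j => G i (m j)).det := by
  -- Subtracting from each column its predecessor turns the first row into `(1, 0, …, 0)`. The
  -- remaining entries telescope into sums over intervals, and multilinearity in the columns pulls
  -- these sums out.
  let B : Matrix (Fin (a + 1)) (Fin (a + 1)) R :=
    Matrix.of fun i j => Fin.cases (F i (l 0)) (fun j => F i (l j.succ) - F i (l j.castSucc)) j
  have h1 : (Matrix.of fun i j => F i (l j)).det = B.det := by
    refine Matrix.det_eq_of_forall_col_eq_smul_add_pred (fun _ => 1) (fun i => ?_) fun i j => ?_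
    · simp [B]
    · simp [B]
  have h2 : B.det = (B.submatrix Fin.succ Fin.succ).det := by
    rw [Matrix.det_succ_row_zero, Fin.sum_univ_succ]
    simp [B, h0]
  have htel : ∀ (i : Fin a) (u k : ℕ), F i.succ (u + k) - F i.succ u =
      c i * ∑ m ∈ Finset.Ico u (u + k), G i m := by
    intro i u k
    induction k with
    | zero => simp
    | succ k ih =>
      rw [← add_assoc, Finset.sum_Ico_succ_top (by omega), mul_add, ← ih, ← hF]
      ring
  have h3 : B.submatrix Fin.succ Fin.succ = Matrix.of fun i j => c i *
      (Matrix.of fun i j => ∑ m ∈ Finset.Ico (l (Fin.castSucc j)) (l j.succ), G i m) i j := by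
    ext i j
    have hle : l j.castSucc ≤ l j.succ := hl (Fin.castSucc_le_succ j)
    obtain ⟨k, hk⟩ := Nat.exists_eq_add_of_le hle
    simp only [B, Matrix.submatrix_apply, Matrix.of_apply, Fin.cases_succ]
    rw [hk, htel]
  rw [h1, h2, h3, Matrix.det_mul_column]
  congr 1
  rw [← Matrix.det_transpose]
  have h4 := (Matrix.detRowAlternating (n := Fin a) (R := R)).toMultilinearMap.map_sum_finset
    (fun (j : Fin a) (m : ℕ) (i : Fin a) => G i m)
    (fun j : Fin a => Finset.Ico (l j.castSucc) (l j.succ))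
  have h5 : (Matrix.of fun i j => ∑ m ∈ Finset.Ico (l (Fin.castSucc j)) (l j.succ), G i m).transpose
      = fun j => ∑ m ∈ Finset.Ico (l j.castSucc) (l j.succ), fun i => G i m := by
    ext j i
    simp [Matrix.transpose_apply, Finset.sum_apply]
  rw [h5]
  refine Eq.trans h4 (Finset.sum_congr rfl fun m _ => ?_)
  rw [← Matrix.det_transpose]
  rfl

theorem strictMono_of_interlacing {a : ℕ} {l : Fin (a + 1) → ℕ} {m : Fin a → ℕ}
    (hm : m ∈ Fintype.piFinset fun j : Fin a => Finset.Ico (l j.castSucc) (l j.succ))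
    (hl : StrictMono l) : StrictMono m := by
  rw [Fintype.mem_piFinset] at hm
  intro i j hij
  have h1 := Finset.mem_Ico.mp (hm i)
  have h2 := Finset.mem_Ico.mp (hm j)
  have : l i.succ ≤ l j.castSucc := hl.monotone (by
    rw [Fin.le_def]; simpa using hij)
  omega

/-- The value of a Schur polynomial on the unit torus is bounded by its value at one. -/
theorem norm_det_pow_le_det_choose {a : ℕ} (x : Fin a → ℂ) (hx : ∀ i, ‖x i‖ = 1) (l : Fin a → ℕ)
    (hl : StrictMono l) : ‖(Matrix.of fun i j => x i ^ l j).det‖ ≤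
      ‖(Matrix.vandermonde x).det‖ * (Matrix.of fun i j : Fin a => ((l j).choose i : ℝ)).det := by
  induction a with
  | zero => simp
  | succ a ih =>
    -- Rotating by a unit scalar changes neither absolute value and makes the first coordinate one,
    -- as branching requires.
    let y : Fin (a + 1) → ℂ := fun i => x i / x 0
    have hx0 : x 0 ≠ 0 := fun h => by have := hx 0; rw [h] at this; simp at this
    have hy : ∀ i, ‖y i‖ = 1 := fun i => by simp [y, hx]
    have hy0 : y 0 = 1 := div_self hx0
    have hxy : ∀ i, x i = x 0 * y i := fun i => by simp only [y]; field_simp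
    have h1 : ‖(Matrix.of fun i j => x i ^ l j).det‖ = ‖(Matrix.of fun i j => y i ^ l j).det‖ := by
      have : (Matrix.of fun i j => x i ^ l j) =
          Matrix.of fun i j => x 0 ^ l j * (Matrix.of fun i j => y i ^ l j) i j := by
        ext i j
        simp only [Matrix.of_apply]
        rw [hxy i, mul_pow]
      rw [this, Matrix.det_mul_row, norm_mul, norm_prod]
      simp [hx]
    have h2 : ‖(Matrix.vandermonde x).det‖ = ‖(Matrix.vandermonde y).det‖ := by
      rw [Matrix.det_vandermonde, Matrix.det_vandermonde, norm_prod, norm_prod]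
      refine Finset.prod_congr rfl fun i _ => ?_
      rw [norm_prod, norm_prod]
      refine Finset.prod_congr rfl fun j _ => ?_
      rw [hxy j, hxy i, ← mul_sub, norm_mul, hx, one_mul]
    have h3 : ‖(Matrix.vandermonde y).det‖ = (∏ i : Fin a, ‖y i.succ - 1‖) *
        ‖(Matrix.vandermonde fun i : Fin a => y i.succ).det‖ := by
      rw [Matrix.det_vandermonde, Matrix.det_vandermonde, Fin.prod_univ_succ, norm_mul, norm_prod]
      congr 1
      · rw [Fin.prod_Ioi_zero]
        simp [hy0]
      · congr 1
        refine Finset.prod_congr rfl fun i _ => ?_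
        rw [Fin.prod_Ioi_succ]
    rw [h1, h2, h3, det_branching (fun i m => y i ^ m) (fun i m => y i.succ ^ m)
      (fun i => y i.succ - 1) (fun m => by simp [hy0]) (fun i m => by ring) l hl.monotone,
      norm_mul, norm_prod, mul_assoc]
    refine mul_le_mul_of_nonneg_left ?_ (Finset.prod_nonneg fun i _ => norm_nonneg _)
    -- By Pascal's rule the binomial determinant branches over the same interlacing vectors with all
    -- factors one, so the two sides can be compared term by term.
    have h4 := det_branching (fun (i : Fin (a + 1)) m => (m.choose i : ℝ))
      (fun (i : Fin a) m => (m.choose i : ℝ)) (fun _ => 1) (fun m => by simp) (fun i m => by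
        rw [Fin.val_succ, Nat.choose_succ_succ]; push_cast; ring) l hl.monotone
    rw [h4, Finset.prod_const_one, one_mul, Finset.mul_sum]
    refine (norm_sum_le _ _).trans (Finset.sum_le_sum fun m hm => ?_)
    exact ih _ (fun i => hy i.succ) m (strictMono_of_interlacing hm hl)

/-- Multiplied by `i!`, the binomial becomes a falling factorial, a monic polynomial of degree `i`;
such rows give the Vandermonde determinant. -/
theorem det_choose_mul_prod_factorial {a : ℕ} (l : Fin a → ℕ) :
    (Matrix.of fun i j : Fin a => ((l j).choose i : ℝ)).det * ∏ i : Fin a, ((i : ℕ).factorial : ℝ) =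
      (Matrix.vandermonde fun i => (l i : ℝ)).det := by
  rw [Matrix.det_eval_matrixOfPolynomials_eq_det_vandermonde (fun i => (l i : ℝ))
    (fun i => descPochhammer ℝ i) (fun i => descPochhammer_natDegree _ _)
    (fun i => monic_descPochhammer _ _), ← Matrix.det_transpose, mul_comm, ← Matrix.det_mul_row]
  congr 1
  ext i j
  simp only [Matrix.of_apply, Matrix.transpose_apply]
  rw [descPochhammer_eval_eq_descFactorial, Nat.descFactorial_eq_factorial_mul_choose]
  push_cast
  ring

theorem norm_det_pow_le {a : ℕ} (x : Fin a → ℂ) (hx : ∀ i, ‖x i‖ = 1) (l : Fin a → ℕ) :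
    ‖(Matrix.of fun i j => x i ^ l j).det‖ * ∏ i : Fin a, ((i : ℕ).factorial : ℝ) ≤
      ‖(Matrix.vandermonde x).det‖ * ‖(Matrix.vandermonde fun i => (l i : ℝ)).det‖ := by
  by_cases hl : Function.Injective l
  swap
  · simp only [Function.Injective, not_forall] at hl
    obtain ⟨i, j, hij, hne⟩ := hl
    rw [Matrix.det_zero_of_column_eq hne fun k => by simp [hij]]
    simp only [norm_zero, zero_mul]
    positivity
  let σ := Tuple.sort l
  have hmono : StrictMono (l ∘ σ) :=
    (Tuple.monotone_sort l).strictMono_of_injective (hl.comp σ.injective)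
  have h1 : ‖(Matrix.of fun i j => x i ^ l j).det‖ =
      ‖(Matrix.of fun i j => x i ^ (l ∘ σ) j).det‖ := by
    have : (Matrix.of fun i j => x i ^ (l ∘ σ) j) =
        (Matrix.of fun i j => x i ^ l j).submatrix id σ := rfl
    rw [this, Matrix.det_permute', norm_mul]
    rcases Int.units_eq_one_or (Equiv.Perm.sign σ) with h | h <;> rw [h] <;> simp
  have h2 : ‖(Matrix.vandermonde fun i => (l i : ℝ)).det‖ =
      ‖(Matrix.vandermonde fun i => ((l ∘ σ) i : ℝ)).det‖ := by
    have : (Matrix.vandermonde fun i => ((l ∘ σ) i : ℝ)) =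
        (Matrix.vandermonde fun i => (l i : ℝ)).submatrix σ id := rfl
    rw [this, Matrix.det_permute, norm_mul]
    rcases Int.units_eq_one_or (Equiv.Perm.sign σ) with h | h <;> rw [h] <;> simp
  rw [h1, h2, ← det_choose_mul_prod_factorial]
  refine (mul_le_mul_of_nonneg_right (norm_det_pow_le_det_choose x hx _ hmono)
    (by positivity)).trans ?_
  rw [mul_assoc]
  exact mul_le_mul_of_nonneg_left (le_abs_self _) (norm_nonneg _)

end Branching

/-! ### Laplace expansion along two blocks of rows -/

section Laplace

open Equiv in
/-- Laplace expansion along a block of rows, averaged over all permutations of the columns. -/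
theorem factorial_mul_det {ι κ R : Type*} [Fintype ι] [Fintype κ] [DecidableEq ι] [DecidableEq κ]
    [CommRing R] (M : Matrix (ι ⊕ κ) (ι ⊕ κ) R) :
    ((Fintype.card ι).factorial * (Fintype.card κ).factorial : R) * M.det =
      ∑ σ : Perm (ι ⊕ κ), ((Perm.sign σ : ℤ) : R) *
        ((M.submatrix Sum.inl (σ ∘ Sum.inl)).det * (M.submatrix Sum.inr (σ ∘ Sum.inr)).det) := by
  have h1 : ∀ σ : Perm (ι ⊕ κ), ((Perm.sign σ : ℤ) : R) *
      ((M.submatrix Sum.inl (σ ∘ Sum.inl)).det * (M.submatrix Sum.inr (σ ∘ Sum.inr)).det) =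
      ∑ τ : Perm ι × Perm κ, ((Perm.sign σ : ℤ) : R) * ((Perm.sign (Perm.sumCongr τ.1 τ.2) : ℤ) : R) *
        ∏ s, M (Perm.sumCongr τ.1 τ.2 s) (σ s) := by
    intro σ
    rw [Matrix.det_apply', Matrix.det_apply', Finset.sum_mul_sum, ← Finset.sum_product',
      Finset.univ_product_univ, Finset.mul_sum]
    refine Finset.sum_congr rfl fun τ _ => ?_
    rw [Perm.sign_sumCongr, Fintype.prod_sum_type]
    simp only [Matrix.submatrix_apply, Function.comp, Perm.sumCongr_apply, Sum.map_inl, Sum.map_inr,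
      Units.val_mul, Int.cast_mul]
    ring
  simp_rw [h1]
  rw [Finset.sum_comm]
  -- Replacing `σ` by `σ * τ` shows that each block permutation `τ` contributes the full
  -- determinant; counting these permutations gives the two factorials.
  have h2 : ∀ τ : Perm (ι ⊕ κ), ∑ σ : Perm (ι ⊕ κ), ((Perm.sign σ : ℤ) : R) *
      ((Perm.sign τ : ℤ) : R) * ∏ s, M (τ s) (σ s) = M.det := by
    intro τ
    rw [← Matrix.det_transpose, Matrix.det_apply', ← Equiv.sum_comp (Equiv.mulRight τ)]
    refine Finset.sum_congr rfl fun σ _ => ?_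
    have hs : ((Perm.sign τ : ℤ) : R) * ((Perm.sign τ : ℤ) : R) = 1 := by
      rw [← Int.cast_mul, ← Units.val_mul, Int.units_mul_self]; simp
    simp only [Equiv.coe_mulRight, Perm.sign_mul, Units.val_mul, Int.cast_mul, Perm.mul_apply]
    rw [mul_assoc (((Perm.sign σ : ℤ) : R)), hs, mul_one,
      Equiv.prod_comp τ (fun s => M s (σ s))]
    rfl
  rw [Finset.sum_congr rfl fun τ _ => h2 _]
  simp [Fintype.card_perm, Finset.card_univ]

end Laplace

/-! ### Vandermonde products split into internal and cross parts -/

section VandermondeNorm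

/-- The absolute value of the Vandermonde determinant of a finite family. -/
noncomputable def vnorm {ι E : Type*} [Fintype ι] [DecidableEq ι] [NormedAddCommGroup E] (f : ι → E) :
    ℝ := Real.sqrt (∏ s, ∏ t, if s = t then 1 else ‖f s - f t‖)

variable {ι κ E : Type*} [Fintype ι] [DecidableEq ι] [Fintype κ] [DecidableEq κ]
  [NormedAddCommGroup E]

theorem vnorm_nonneg (f : ι → E) : 0 ≤ vnorm f := Real.sqrt_nonneg _

theorem vnorm_sq (f : ι → E) : vnorm f ^ 2 = ∏ s, ∏ t, if s = t then 1 else ‖f s - f t‖ := by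
  rw [vnorm, Real.sq_sqrt]
  refine Finset.prod_nonneg fun s _ => Finset.prod_nonneg fun t _ => ?_
  split_ifs <;> positivity

theorem vnorm_comp_equiv (f : ι → E) (e : κ ≃ ι) : vnorm (f ∘ e) = vnorm f := by
  rw [vnorm, vnorm]
  congr 1
  rw [← e.prod_comp]
  refine Finset.prod_congr rfl fun s _ => ?_
  rw [← e.prod_comp]
  simp

theorem vnorm_sumElim (u : ι → E) (v : κ → E) :
    vnorm (Sum.elim u v) = vnorm u * vnorm v * ∏ i, ∏ k, ‖u i - v k‖ := by
  rw [← sq_eq_sq₀ (vnorm_nonneg _) (by have := vnorm_nonneg u; have := vnorm_nonneg v; positivity),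
    mul_pow, mul_pow, vnorm_sq, vnorm_sq, vnorm_sq]
  simp only [Fintype.prod_sum_type, Sum.elim_inl, Sum.elim_inr, Sum.inl.injEq, Sum.inr.injEq,
    reduceCtorEq, if_false, Finset.prod_mul_distrib]
  have : ∏ k, ∏ i, ‖v k - u i‖ = ∏ i, ∏ k, ‖u i - v k‖ := by
    rw [Finset.prod_comm]
    simp_rw [norm_sub_rev]
  rw [this]
  ring

theorem vnorm_eq_norm_det {𝕜 : Type*} [NormedField 𝕜] {a : ℕ} (f : Fin a → 𝕜) :
    vnorm f = ‖(Matrix.vandermonde f).det‖ := by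
  rw [← sq_eq_sq₀ (vnorm_nonneg _) (norm_nonneg _), vnorm_sq, Matrix.det_vandermonde, norm_prod, sq,
    ← Finset.prod_mul_distrib]
  simp_rw [norm_prod, ← Finset.prod_mul_distrib]
  have h1 := Finset.prod_prod_Ioi_mul_eq_prod_prod_off_diag (fun j i : Fin a => ‖f j - f i‖)
  have h2 : ∀ i, ∏ j ∈ Finset.Ioi i, ‖f j - f i‖ * ‖f j - f i‖ =
      ∏ j ∈ Finset.Ioi i, ‖f j - f i‖ * ‖f i - f j‖ := fun i =>
    Finset.prod_congr rfl fun j _ => by rw [norm_sub_rev (f i)]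
  simp_rw [h2, h1]
  refine Finset.prod_congr rfl fun s _ => ?_
  rw [← Finset.prod_mul_prod_compl {s}, Finset.prod_singleton, if_pos rfl, one_mul]
  refine Finset.prod_congr rfl fun t ht => ?_
  rw [if_neg (by simpa [eq_comm] using ht), norm_sub_rev]

theorem vnorm_pos {f : ι → E} (hf : Function.Injective f) : 0 < vnorm f := by
  refine Real.sqrt_pos.mpr (Finset.prod_pos fun s _ => Finset.prod_pos fun t _ => ?_)
  split_ifs with h
  · exact one_pos
  · exact norm_pos_iff.mpr (sub_ne_zero.mpr fun h' => h (hf h'))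

theorem one_le_norm_natCast_sub {p q : ℕ} (h : p ≠ q) : 1 ≤ ‖(p : ℝ) - q‖ := by
  have h1 : (1 : ℤ) ≤ |(p : ℤ) - q| := Int.one_le_abs (sub_ne_zero.mpr (by exact_mod_cast h))
  rw [Real.norm_eq_abs]
  exact_mod_cast h1

/-- The part of a Vandermonde determinant internal to one block is controlled by the cross part. -/
theorem vnorm_pow_le_cross {ι κ : Type*} [Fintype ι] [DecidableEq ι] [Fintype κ]
    (u : ι → ℕ) (v : κ → ℕ) (huv : ∀ i k, u i ≠ v k) :
    (vnorm fun i => (u i : ℝ)) ^ (2 * Fintype.card κ) ≤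
      2 ^ (Fintype.card ι ^ 2 * Fintype.card κ) *
        (∏ i, ∏ k, ‖(u i : ℝ) - v k‖) ^ (2 * Fintype.card ι) := by
  have h1 : ∀ i k, 1 ≤ ‖(u i : ℝ) - v k‖ := fun i k => one_le_norm_natCast_sub (huv i k)
  -- By the triangle inequality through `v k`: a sum of two numbers that are at least one is at most
  -- twice their product. Integrality of the exponents enters here.
  have h2 : ∀ s t k, (if s = t then 1 else ‖(u s : ℝ) - u t‖) ≤
      2 * (‖(u s : ℝ) - v k‖ * ‖(u t : ℝ) - v k‖) := by
    intro s t k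
    have hs := h1 s k
    have ht := h1 t k
    split_ifs
    · nlinarith
    · have : ‖(u s : ℝ) - u t‖ ≤ ‖(u s : ℝ) - v k‖ + ‖(u t : ℝ) - v k‖ := by
        have := norm_sub_le_norm_sub_add_norm_sub (u s : ℝ) (v k) (u t)
        rwa [norm_sub_rev (v k : ℝ)] at this
      nlinarith
  have hnn : ∀ s t, (0 : ℝ) ≤ if s = t then 1 else ‖(u s : ℝ) - u t‖ := by
    intro s t; split_ifs <;> positivity
  calc (vnorm fun i => (u i : ℝ)) ^ (2 * Fintype.card κ)
      = ∏ s, ∏ t, ∏ _k : κ, (if s = t then 1 else ‖(u s : ℝ) - u t‖) := by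
        rw [pow_mul, vnorm_sq, ← Finset.prod_pow]
        refine Finset.prod_congr rfl fun s _ => ?_
        rw [← Finset.prod_pow]
        refine Finset.prod_congr rfl fun t _ => ?_
        rw [Finset.prod_const, Finset.card_univ]
    _ ≤ ∏ s, ∏ t, ∏ k, (2 * (‖(u s : ℝ) - v k‖ * ‖(u t : ℝ) - v k‖)) :=
        Finset.prod_le_prod (fun s _ => Finset.prod_nonneg fun t _ => Finset.prod_nonneg
          fun k _ => hnn s t) fun s _ => Finset.prod_le_prod (fun t _ => Finset.prod_nonneg
          fun k _ => hnn s t) fun t _ => Finset.prod_le_prod (fun k _ => hnn s t)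
          fun k _ => h2 s t k
    _ = _ := by
        simp only [Finset.prod_mul_distrib, Finset.prod_const, Finset.card_univ,
          Finset.prod_pow]
        rw [mul_comm 2 (Fintype.card ι), pow_mul _ (Fintype.card ι) 2, sq (_ ^ Fintype.card ι)]
        congr 1
        rw [← pow_mul, ← pow_mul]
        congr 1
        ring

/-- Combine the internal estimates for both blocks with the cross part, and weaken the exponents to
multiples of `(a + b) ^ 2`, which is allowed because the cross part is at least one. Taking roots
bounds the cross part below by a power of the whole product. -/
theorem vnorm_sumElim_pow_le (u : ι → ℕ) (v : κ → ℕ) (huv : ∀ i k, u i ≠ v k) :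
    (vnorm (Sum.elim (fun i => (u i : ℝ)) fun k => (v k : ℝ))) ^
        (2 * (Fintype.card ι * Fintype.card κ)) ≤
      2 ^ (Fintype.card ι * Fintype.card κ * (Fintype.card ι + Fintype.card κ) ^ 2) *
        (∏ i, ∏ k, ‖(u i : ℝ) - v k‖) ^ (2 * (Fintype.card ι + Fintype.card κ) ^ 2) := by
  set a := Fintype.card ι
  set b := Fintype.card κ
  set K := ∏ i, ∏ k, ‖(u i : ℝ) - v k‖ with hK
  have hK1 : 1 ≤ K := by
    refine Finset.one_le_prod fun i _ => Finset.one_le_prod fun k _ => one_le_norm_natCast_sub (huv i k)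
  have h1 := vnorm_pow_le_cross u v huv
  have h2 := vnorm_pow_le_cross v u fun k i => (huv i k).symm
  have hK' : ∏ k, ∏ i, ‖(v k : ℝ) - u i‖ = K := by
    rw [hK, Finset.prod_comm]
    simp_rw [norm_sub_rev]
  rw [hK'] at h2
  have h1' := pow_le_pow_left₀ (by have := vnorm_nonneg fun i => (u i : ℝ); positivity) h1 a
  have h2' := pow_le_pow_left₀ (by have := vnorm_nonneg fun i => (v i : ℝ); positivity) h2 b
  rw [vnorm_sumElim]
  have hu := vnorm_nonneg fun i => (u i : ℝ)
  have hv := vnorm_nonneg fun i => (v i : ℝ)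
  calc ((vnorm fun i => (u i : ℝ)) * (vnorm fun i => (v i : ℝ)) * K) ^ (2 * (a * b))
      = ((vnorm fun i => (u i : ℝ)) ^ (2 * b)) ^ a * ((vnorm fun i => (v i : ℝ)) ^ (2 * a)) ^ b *
        K ^ (2 * (a * b)) := by
          rw [mul_pow, mul_pow, ← pow_mul, ← pow_mul]
          congr 3 <;> ring
    _ ≤ (2 ^ (a ^ 2 * b) * K ^ (2 * a)) ^ a * (2 ^ (b ^ 2 * a) * K ^ (2 * b)) ^ b *
        K ^ (2 * (a * b)) := by gcongr
    _ = 2 ^ (a ^ 2 * b * a + b ^ 2 * a * b) * K ^ (2 * a * a + 2 * b * b + 2 * (a * b)) := by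
          rw [mul_pow, mul_pow, ← pow_mul, ← pow_mul, ← pow_mul, ← pow_mul, pow_add, pow_add,
            pow_add]
          ring
    _ ≤ 2 ^ (a * b * (a + b) ^ 2) * K ^ (2 * (a + b) ^ 2) := by
          gcongr
          · norm_num
          · nlinarith [Nat.zero_le (a * b * (a * b))]
          · nlinarith [Nat.zero_le (a * b)]

theorem vnorm_fin_eq (a : ℕ) : (vnorm fun i : Fin a => (i : ℝ)) =
    ∏ i : Fin a, ((i : ℕ).factorial : ℝ) := by
  rw [vnorm_eq_norm_det]
  rcases a with _ | a
  · simp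
  · rw [Matrix.det_vandermonde_id_eq_superFactorial, ← Nat.prod_range_succ_factorial,
      ← Fin.prod_univ_eq_prod_range (fun i => i.factorial)]
    simp

/-- The product of factorials is the Vandermonde product of `0, …, a + b - 1`; split off the first
`a` numbers and bound each cross difference by `a + b - 1`. -/
theorem prod_factorial_le (a b : ℕ) : ∏ i : Fin (a + b), ((i : ℕ).factorial : ℝ) ≤
    (∏ i : Fin a, ((i : ℕ).factorial : ℝ)) * (∏ i : Fin b, ((i : ℕ).factorial : ℝ)) *
      ((a + b : ℝ) - 1) ^ (a * b) := by
  rw [← vnorm_fin_eq, ← vnorm_fin_eq, ← vnorm_fin_eq, ← vnorm_comp_equiv _ finSumFinEquiv]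
  have h1 : ((fun i : Fin (a + b) => (i : ℝ)) ∘ finSumFinEquiv) =
      Sum.elim (fun i : Fin a => (i : ℝ)) (fun k : Fin b => (a : ℝ) + k) := by
    ext s
    rcases s with s | s <;> simp
  have h2 : (vnorm fun k : Fin b => (a : ℝ) + k) = vnorm fun k : Fin b => (k : ℝ) := by
    simp [vnorm]
  rw [h1, vnorm_sumElim, h2]
  refine mul_le_mul_of_nonneg_left ?_ (mul_nonneg (vnorm_nonneg _) (vnorm_nonneg _))
  calc ∏ i : Fin a, ∏ k : Fin b, ‖(i : ℝ) - (a + k)‖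
      ≤ ∏ i : Fin a, ∏ k : Fin b, ((a + b : ℝ) - 1) := by
        refine Finset.prod_le_prod (fun i _ => by positivity) fun i _ =>
          Finset.prod_le_prod (fun k _ => by positivity) fun k _ => ?_
        have h3 : ((i : ℕ) : ℝ) + 1 ≤ a := by exact_mod_cast i.2
        have h4 : ((k : ℕ) : ℝ) + 1 ≤ b := by exact_mod_cast k.2
        have h5 : (0 : ℝ) ≤ (i : ℕ) := by positivity
        have h6 : (0 : ℝ) ≤ (k : ℕ) := by positivity
        rw [Real.norm_eq_abs, abs_le]
        constructor <;> linarith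
    _ = _ := by simp [← pow_mul, mul_comm]

end VandermondeNorm

end UnitaryChar
-- The Weyl dimension formula and the character bound on the torus
namespace UnitaryChar

open Filter Topology

theorem tendsto_pow_sub_pow_div (a b : ℕ) :
    Tendsto (fun q : ℂ => (q ^ a - q ^ b) / (q - 1)) (𝓝[≠] 1) (𝓝 ((a : ℂ) - b)) := by
  have h : HasDerivAt (fun q : ℂ => q ^ a - q ^ b) ((a : ℂ) - b) 1 := by
    have := (hasDerivAt_pow a (1 : ℂ)).fun_sub (hasDerivAt_pow b (1 : ℂ))
    simp only [one_pow, mul_one] at this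
    exact this
  refine (hasDerivAt_iff_tendsto_slope.mp h).congr fun q => ?_
  simp [slope_def_field]

/-- The Weyl dimension formula. -/
theorem weyl_dimension {n d : ℕ} {P : Matrix (Fin d) (Fin d) (MvPolynomial (Fin n × Fin n) ℂ)}
    (hP : IsPolyRep P) {l : Fin n → ℕ}
    (hl : ∀ x : Fin n → ℂ, (polyEval P (Matrix.diagonal x)).trace *
      ∏ i, ∏ j ∈ Finset.Ioi i, (x i - x j) = (Matrix.of fun i j => x i ^ l j).det) :
    (d : ℝ) * ∏ i : Fin n, ((i : ℕ).factorial : ℝ) = vnorm fun i => (l i : ℝ) := by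
  -- At `x i = q ^ i` the numerator is itself a Vandermonde determinant, in the `q ^ l j`. Dividing
  -- each factor on both sides by `q - 1` and letting `q` tend to one gives the degree.
  let f : ℂ → ℂ := fun q => (polyEval P (Matrix.diagonal fun i : Fin n => q ^ (i : ℕ))).trace
  have hf : Continuous f := by
    have : f = fun q => (traceTorus P 1).eval fun i : Fin n => q ^ (i : ℕ) := by
      ext q; rw [eval_traceTorus, one_mul]
    rw [this]
    exact (MvPolynomial.continuous_eval _).comp (by fun_prop)
  have hf1 : f 1 = d := by
    simp only [f, one_pow, Matrix.diagonal_one, hP.map_one, Matrix.trace_one, Fintype.card_fin]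
  have hfq : ∀ q, f q * ∏ i : Fin n, ∏ j ∈ Finset.Ioi i, (q ^ (i : ℕ) - q ^ (j : ℕ)) =
      ∏ i : Fin n, ∏ j ∈ Finset.Ioi i, (q ^ l j - q ^ l i) := by
    intro q
    rw [hl, ← Matrix.det_vandermonde fun j => q ^ l j, ← Matrix.det_transpose]
    congr 1
    ext i j
    simp [Matrix.vandermonde_apply, ← pow_mul, mul_comm]
  have hfq' : ∀ᶠ q in 𝓝[≠] (1 : ℂ), f q * ∏ i : Fin n, ∏ j ∈ Finset.Ioi i,
      ((q ^ (i : ℕ) - q ^ (j : ℕ)) / (q - 1)) =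
      ∏ i : Fin n, ∏ j ∈ Finset.Ioi i, ((q ^ l j - q ^ l i) / (q - 1)) := by
    filter_upwards [self_mem_nhdsWithin] with q hq
    simp only [Finset.prod_div_distrib]
    rw [← mul_div_assoc, hfq]
  have hlimL : Tendsto (fun q => f q * ∏ i : Fin n, ∏ j ∈ Finset.Ioi i,
      ((q ^ (i : ℕ) - q ^ (j : ℕ)) / (q - 1))) (𝓝[≠] 1)
      (𝓝 ((d : ℂ) * ∏ i : Fin n, ∏ j ∈ Finset.Ioi i, (((i : ℕ) : ℂ) - ((j : ℕ) : ℂ)))) := by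
    refine Tendsto.mul ?_ (tendsto_finsetProd _ fun i _ => tendsto_finsetProd _ fun j _ =>
      tendsto_pow_sub_pow_div _ _)
    rw [← hf1]
    exact hf.continuousAt.tendsto.mono_left nhdsWithin_le_nhds
  have hlimR : Tendsto (fun q : ℂ => ∏ i : Fin n, ∏ j ∈ Finset.Ioi i,
      ((q ^ l j - q ^ l i) / (q - 1))) (𝓝[≠] 1)
      (𝓝 (∏ i : Fin n, ∏ j ∈ Finset.Ioi i, ((l j : ℂ) - l i))) :=
    tendsto_finsetProd _ fun i _ => tendsto_finsetProd _ fun j _ => tendsto_pow_sub_pow_div _ _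
  have heq := tendsto_nhds_unique (hlimL.congr' hfq') hlimR
  have hcast : ∀ p q : ℕ, ‖(p : ℂ) - q‖ = ‖(p : ℝ) - q‖ := fun p q => by
    rw [← Complex.ofReal_natCast, ← Complex.ofReal_natCast, ← Complex.ofReal_sub, Complex.norm_real]
  have hn := congrArg norm heq
  rw [norm_mul, norm_prod, norm_prod, Complex.norm_natCast] at hn
  simp only [norm_prod, hcast] at hn
  rw [← vnorm_fin_eq, vnorm_eq_norm_det, vnorm_eq_norm_det, Matrix.det_vandermonde,
    Matrix.det_vandermonde, norm_prod, norm_prod]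
  simp only [norm_prod]
  rw [← hn]
  congr 1
  exact Finset.prod_congr rfl fun i _ => Finset.prod_congr rfl fun j _ => norm_sub_rev _ _

/-- Points of the unit torus with distinct coordinates are dense. -/
theorem le_of_forall_injective {n : ℕ} {f : (Fin n → ℂ) → ℝ} (hf : Continuous f) {K : ℝ}
    (h : ∀ x : Fin n → ℂ, (∀ i, ‖x i‖ = 1) → Function.Injective x → f x ≤ K)
    (x : Fin n → ℂ) (hx : ∀ i, ‖x i‖ = 1) : f x ≤ K := by
  -- Coordinates rotate at distinct speeds, so those that coincide at `t = 0` separate to first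
  -- order, while distinct ones stay distinct for small `t`.
  let y : ℝ → Fin n → ℂ := fun t j => x j * Complex.exp (t * (j : ℕ) * Complex.I)
  have hy : Continuous y := by fun_prop
  have hy0 : y 0 = x := by ext j; simp [y]
  have hyn : ∀ t j, ‖y t j‖ = 1 := by
    intro t j
    simp only [y, norm_mul, hx, one_mul]
    rw [show (t : ℂ) * ((j : ℕ) : ℂ) * Complex.I = ((t * (j : ℕ) : ℝ) : ℂ) * Complex.I by
      push_cast; ring, Complex.norm_exp_ofReal_mul_I]
  have hinj : ∀ᶠ t in 𝓝[≠] (0 : ℝ), Function.Injective (y t) := by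
    have hpair : ∀ i j : Fin n, i ≠ j → ∀ᶠ t in 𝓝[≠] (0 : ℝ), y t i - y t j ≠ 0 := by
      intro i j hij
      by_cases hxij : x i = x j
      · have hd : ∀ k : Fin n, HasDerivAt (fun t : ℝ => y t k) (x k * ((k : ℕ) * Complex.I)) 0 := by
          intro k
          have h1 : HasDerivAt (fun t : ℝ => (t : ℂ) * (k : ℕ) * Complex.I)
              ((k : ℕ) * Complex.I) 0 := by
            have := ((Complex.ofRealCLM.hasDerivAt (x := (0 : ℝ))).mul_const ((k : ℕ) : ℂ)).mul_const
              Complex.I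
            simpa using this
          have h2 := (h1.cexp).const_mul (x k)
          simpa using h2
        have hd2 := (hd i).sub (hd j)
        refine hd2.eventually_ne ?_
        rw [hxij, ← mul_sub, ← sub_mul]
        have hxj : x j ≠ 0 := fun h0 => by have := hx j; rw [h0] at this; simp at this
        refine mul_ne_zero hxj (mul_ne_zero (sub_ne_zero.mpr ?_) Complex.I_ne_zero)
        exact_mod_cast fun h0 => hij (Fin.ext h0)
      · have : Tendsto (fun t => y t i - y t j) (𝓝[≠] 0) (𝓝 (x i - x j)) := by
          have hc : Continuous fun t => y t i - y t j := by fun_prop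
          have := hc.tendsto 0
          rw [hy0] at this
          exact this.mono_left nhdsWithin_le_nhds
        exact this.eventually_ne (sub_ne_zero.mpr hxij)
    have hall : ∀ᶠ t in 𝓝[≠] (0 : ℝ), ∀ i j : Fin n, i ≠ j → y t i - y t j ≠ 0 := by
      rw [eventually_all]; intro i
      rw [eventually_all]; intro j
      by_cases hij : i = j
      · simp [hij]
      · filter_upwards [hpair i j hij] with t ht _ using ht
    filter_upwards [hall] with t ht i j hij
    by_contra hne
    exact ht i j hne (sub_eq_zero.mpr hij)
  have hlim : Tendsto (fun t => f (y t)) (𝓝[≠] (0 : ℝ)) (𝓝 (f x)) := by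
    have := (hf.comp hy).tendsto 0
    simp only [Function.comp, hy0] at this
    exact this.mono_left nhdsWithin_le_nhds
  refine le_of_tendsto hlim ?_
  filter_upwards [hinj] with t ht using h _ (hyn t) ht

theorem sum_elim_comp {ι κ α : Type*} (f : ι ⊕ κ → α) :
    Sum.elim (f ∘ Sum.inl) (f ∘ Sum.inr) = f := Sum.elim_comp_inl_inr f

/-- The character bound at a point of the torus in terms of the cross products of the exponents. -/
theorem norm_trace_mul_cross_le {a b d : ℕ}
    {P : Matrix (Fin d) (Fin d) (MvPolynomial (Fin (a + b) × Fin (a + b)) ℂ)}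
    {l : Fin (a + b) → ℕ}
    (hl : ∀ x : Fin (a + b) → ℂ, (polyEval P (Matrix.diagonal x)).trace *
      ∏ i, ∏ j ∈ Finset.Ioi i, (x i - x j) = (Matrix.of fun i j => x i ^ l j).det)
    {C₀ : ℝ} (hC₀ : 0 < C₀) (hC : ∀ σ : Equiv.Perm (Fin a ⊕ Fin b), C₀ ≤ ∏ i, ∏ k,
      ‖(l (finSumFinEquiv (σ (Sum.inl i))) : ℝ) - l (finSumFinEquiv (σ (Sum.inr k)))‖)
    (x : Fin (a + b) → ℂ) (hx : ∀ i, ‖x i‖ = 1) :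
    ‖(polyEval P (Matrix.diagonal x)).trace‖ *
      (∏ i, ∏ k, ‖x (finSumFinEquiv (Sum.inl i)) - x (finSumFinEquiv (Sum.inr k))‖) *
      (a.factorial * b.factorial * ((∏ i : Fin a, ((i : ℕ).factorial : ℝ)) *
        ∏ i : Fin b, ((i : ℕ).factorial : ℝ))) ≤
      (a + b).factorial * ((vnorm fun i => (l i : ℝ)) / C₀) := by
  revert x
  -- Distinct coordinates make the Vandermonde products of the two blocks nonzero, so they can be
  -- cancelled at the end; continuity recovers repeated eigenvalues.
  refine fun x hx => le_of_forall_injective (f := fun x =>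
    ‖(polyEval P (Matrix.diagonal x)).trace‖ *
      (∏ i, ∏ k, ‖x (finSumFinEquiv (Sum.inl i)) - x (finSumFinEquiv (Sum.inr k))‖) *
      (a.factorial * b.factorial * ((∏ i : Fin a, ((i : ℕ).factorial : ℝ)) *
        ∏ i : Fin b, ((i : ℕ).factorial : ℝ)))) ?_ ?_ x hx
  · have h1 : Continuous fun x : Fin (a + b) → ℂ => (polyEval P (Matrix.diagonal x)).trace := by
      have : (fun x : Fin (a + b) → ℂ => (polyEval P (Matrix.diagonal x)).trace) =
          fun x => (traceTorus P 1).eval x := by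
        ext x; rw [eval_traceTorus, one_mul]
      rw [this]
      exact MvPolynomial.continuous_eval _
    fun_prop
  intro x hx hinj
  set e : Fin a ⊕ Fin b ≃ Fin (a + b) := finSumFinEquiv with he
  set xQ : Fin a → ℂ := fun i => x (e (Sum.inl i)) with hxQ
  set xR : Fin b → ℂ := fun k => x (e (Sum.inr k)) with hxR
  set SA := ∏ i : Fin a, ((i : ℕ).factorial : ℝ) with hSA
  set SB := ∏ i : Fin b, ((i : ℕ).factorial : ℝ) with hSB
  set V := vnorm fun i => (l i : ℝ) with hV
  set cx := ∏ i, ∏ k, ‖xQ i - xR k‖ with hcx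
  let M : Matrix (Fin a ⊕ Fin b) (Fin a ⊕ Fin b) ℂ := Matrix.of fun s t => x (e s) ^ l (e t)
  have hMdet : M.det = (Matrix.of fun i j => x i ^ l j).det := by
    rw [← Matrix.det_submatrix_equiv_self e (Matrix.of fun i j => x i ^ l j)]
    rfl
  have hvx : vnorm x = vnorm xQ * vnorm xR * cx := by
    rw [← vnorm_comp_equiv x e, ← sum_elim_comp (x ∘ e), vnorm_sumElim]
    rfl
  have hvprod : ‖∏ i, ∏ j ∈ Finset.Ioi i, (x i - x j)‖ = vnorm x := by
    rw [vnorm_eq_norm_det, Matrix.det_vandermonde]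
    simp only [norm_prod]
    exact Finset.prod_congr rfl fun i _ => Finset.prod_congr rfl fun j _ => norm_sub_rev _ _
  have hposQ : 0 < vnorm xQ := vnorm_pos (hinj.comp (e.injective.comp Sum.inl_injective))
  have hposR : 0 < vnorm xR := vnorm_pos (hinj.comp (e.injective.comp Sum.inr_injective))
  -- Each block determinant is bounded by its Vandermonde products. The exponent products of the two
  -- blocks multiply to `V` divided by their cross part, hence to at most `V / C₀`.
  have hterm : ∀ σ : Equiv.Perm (Fin a ⊕ Fin b),
      (‖(M.submatrix Sum.inl (σ ∘ Sum.inl)).det‖ * SA) *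
        (‖(M.submatrix Sum.inr (σ ∘ Sum.inr)).det‖ * SB) ≤ vnorm xQ * vnorm xR * (V / C₀) := by
    intro σ
    have h1 := norm_det_pow_le xQ (fun i => hx _) (fun j => l (e (σ (Sum.inl j))))
    have h2 := norm_det_pow_le xR (fun i => hx _) (fun j => l (e (σ (Sum.inr j))))
    rw [← vnorm_eq_norm_det, ← vnorm_eq_norm_det] at h1 h2
    set vQ := vnorm fun i : Fin a => (l (e (σ (Sum.inl i))) : ℝ) with hvQ
    set vR := vnorm fun i : Fin b => (l (e (σ (Sum.inr i))) : ℝ) with hvR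
    have h3 : vQ * vR ≤ V / C₀ := by
      have h4 : V = vQ * vR * ∏ i, ∏ k,
          ‖(l (e (σ (Sum.inl i))) : ℝ) - l (e (σ (Sum.inr k)))‖ := by
        rw [hV, ← vnorm_comp_equiv (fun i => (l i : ℝ)) (σ.trans e),
          ← sum_elim_comp ((fun i => (l i : ℝ)) ∘ (σ.trans e)), vnorm_sumElim]
        rfl
      rw [le_div_iff₀ hC₀, h4]
      exact mul_le_mul_of_nonneg_left (hC σ) (mul_nonneg (vnorm_nonneg _) (vnorm_nonneg _))
    calc _ ≤ (vnorm xQ * vQ) * (vnorm xR * vR) :=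
          mul_le_mul h1 h2 (mul_nonneg (norm_nonneg _) (by positivity))
            (mul_nonneg hposQ.le (vnorm_nonneg _))
      _ = vnorm xQ * vnorm xR * (vQ * vR) := by ring
      _ ≤ _ := mul_le_mul_of_nonneg_left h3 (mul_nonneg hposQ.le hposR.le)
  have hsum := congrArg norm (factorial_mul_det M)
  rw [norm_mul, norm_mul, hMdet, ← hl x, norm_mul, hvprod, Complex.norm_natCast,
    Complex.norm_natCast, Fintype.card_fin, Fintype.card_fin] at hsum
  have hle : (a.factorial * b.factorial : ℝ) *
      (‖(polyEval P (Matrix.diagonal x)).trace‖ * vnorm x) * (SA * SB) ≤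
      (a + b).factorial * (vnorm xQ * vnorm xR * (V / C₀)) := by
    rw [hsum]
    calc _ ≤ (∑ σ : Equiv.Perm (Fin a ⊕ Fin b), ‖((Equiv.Perm.sign σ : ℤ) : ℂ) *
          ((M.submatrix Sum.inl (σ ∘ Sum.inl)).det *
            (M.submatrix Sum.inr (σ ∘ Sum.inr)).det)‖) * (SA * SB) :=
          mul_le_mul_of_nonneg_right (norm_sum_le _ _) (by positivity)
      _ ≤ ∑ _σ : Equiv.Perm (Fin a ⊕ Fin b), vnorm xQ * vnorm xR * (V / C₀) := by
          rw [Finset.sum_mul]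
          refine Finset.sum_le_sum fun σ _ => ?_
          have hs : ‖((Equiv.Perm.sign σ : ℤ) : ℂ)‖ = 1 := by
            rcases Int.units_eq_one_or (Equiv.Perm.sign σ) with h | h <;> rw [h] <;> simp
          rw [norm_mul, hs, one_mul, norm_mul]
          refine le_trans (le_of_eq ?_) (hterm σ)
          ring
      _ = _ := by simp [Finset.card_univ, Fintype.card_perm]
  rw [hvx] at hle
  have hQR := mul_pos hposQ hposR
  refine le_of_mul_le_mul_left ?_ hQR
  calc _ = _ := by ring
    _ ≤ _ := hle
    _ = _ := by ring

/-- The binomial is a sum of two entries of row `a + b - 1`, so it is at most `2 ^ (a + b - 1)`; and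
`(a - 1)(b - 1) ≥ 0`. -/
theorem choose_le_two_pow {a b : ℕ} (ha : 1 ≤ a) (hb : 1 ≤ b) :
    (a + b).choose a ≤ 2 ^ (a * b) := by
  have h1 : (a + b).choose a ≤ 2 ^ (a + b - 1) := by
    obtain ⟨a, rfl⟩ := Nat.exists_eq_add_of_le' ha
    obtain ⟨b, rfl⟩ := Nat.exists_eq_add_of_le' hb
    rw [show a + 1 + (b + 1) = (a + b + 1) + 1 by ring, Nat.choose_succ_succ, Nat.add_sub_cancel,
      ← Nat.sum_range_choose]
    have : ({a, a + 1} : Finset ℕ) ⊆ Finset.range (a + b + 1 + 1) := by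
      intro k hk
      simp only [Finset.mem_insert, Finset.mem_singleton] at hk
      rw [Finset.mem_range]
      omega
    refine le_trans (le_of_eq ?_) (Finset.sum_le_sum_of_subset this)
    rw [Finset.sum_pair (by omega)]
  refine h1.trans (Nat.pow_le_pow_right (by norm_num) ?_)
  obtain ⟨a, rfl⟩ := Nat.exists_eq_add_of_le' ha
  obtain ⟨b, rfl⟩ := Nat.exists_eq_add_of_le' hb
  have : a + 1 + (b + 1) - 1 = a + b + 1 := by omega
  rw [this]
  nlinarith [Nat.zero_le (a * b)]

/-- The character bound on the torus in terms of the degree. -/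
theorem norm_trace_mul_cross_le_degree {a b d : ℕ} (ha : 1 ≤ a) (hb : 1 ≤ b)
    {P : Matrix (Fin d) (Fin d) (MvPolynomial (Fin (a + b) × Fin (a + b)) ℂ)} (hP : IsPolyRep P)
    (x : Fin (a + b) → ℂ) (hx : ∀ i, ‖x i‖ = 1) :
    ‖(polyEval P (Matrix.diagonal x)).trace‖ *
      (∏ i, ∏ k, ‖x (finSumFinEquiv (Sum.inl i)) - x (finSumFinEquiv (Sum.inr k))‖) ≤
      ((a + b : ℕ) : ℝ) ^ (2 * (a * b)) *
        (d : ℝ) ^ (1 - ((a * b : ℕ) : ℝ) / ((a + b : ℕ) : ℝ) ^ 2) := by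
  obtain ⟨l, hlinj, hl⟩ := weyl_character hP
  have hdim := weyl_dimension hP hl
  set V := vnorm fun i => (l i : ℝ) with hV
  set t : ℝ := ((a * b : ℕ) : ℝ) / ((a + b : ℕ) : ℝ) ^ 2 with ht
  have hd : (0 : ℝ) < d := by exact_mod_cast hP.nonempty
  have hn0 : (0 : ℝ) < ((a + b : ℕ) : ℝ) := by exact_mod_cast (by omega : 0 < a + b)
  set SA := ∏ i : Fin a, ((i : ℕ).factorial : ℝ) with hSA
  set SB := ∏ i : Fin b, ((i : ℕ).factorial : ℝ) with hSB
  set SN := ∏ i : Fin (a + b), ((i : ℕ).factorial : ℝ) with hSN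
  have hSApos : 0 < SA := Finset.prod_pos fun i _ => by positivity
  have hSBpos : 0 < SB := Finset.prod_pos fun i _ => by positivity
  have hSN1 : 1 ≤ SN := Finset.one_le_prod fun i _ => by
    exact_mod_cast Nat.succ_le_of_lt (Nat.factorial_pos i)
  have hdV : (d : ℝ) ≤ V := by rw [← hdim]; nlinarith
  -- This is the `2 (a + b) ^ 2`-th root of the bound of `vnorm_sumElim_pow_le`, after replacing `V`
  -- by the smaller `d`.
  set C₀ : ℝ := (d : ℝ) ^ t * (2 : ℝ) ^ (-((a * b : ℕ) : ℝ) / 2) with hC₀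
  have hC₀pos : 0 < C₀ := by positivity
  have hC : ∀ σ : Equiv.Perm (Fin a ⊕ Fin b), C₀ ≤ ∏ i, ∏ k,
      ‖(l (finSumFinEquiv (σ (Sum.inl i))) : ℝ) - l (finSumFinEquiv (σ (Sum.inr k)))‖ := by
    intro σ
    have h1 := vnorm_sumElim_pow_le (fun i : Fin a => l (finSumFinEquiv (σ (Sum.inl i))))
      (fun k : Fin b => l (finSumFinEquiv (σ (Sum.inr k)))) (fun i k h => by
        have := σ.injective (finSumFinEquiv.injective (hlinj h))
        simp at this)
    have h2 : vnorm (Sum.elim (fun i : Fin a => (l (finSumFinEquiv (σ (Sum.inl i))) : ℝ))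
        fun k : Fin b => (l (finSumFinEquiv (σ (Sum.inr k))) : ℝ)) = V := by
      rw [hV, ← vnorm_comp_equiv (fun i => (l i : ℝ)) (σ.trans finSumFinEquiv),
        ← sum_elim_comp ((fun i => (l i : ℝ)) ∘ (σ.trans finSumFinEquiv))]
      rfl
    rw [h2, Fintype.card_fin, Fintype.card_fin] at h1
    set K := ∏ i, ∏ k, ‖(l (finSumFinEquiv (σ (Sum.inl i))) : ℝ) -
      l (finSumFinEquiv (σ (Sum.inr k)))‖ with hK
    have hKnn : 0 ≤ K := Finset.prod_nonneg fun i _ => Finset.prod_nonneg fun k _ => norm_nonneg _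
    have h3 : (d : ℝ) ^ (2 * (a * b)) ≤ 2 ^ (a * b * (a + b) ^ 2) * K ^ (2 * (a + b) ^ 2) :=
      (pow_le_pow_left₀ hd.le hdV _).trans h1
    have h4 : C₀ ^ (2 * (a + b) ^ 2) ≤ K ^ (2 * (a + b) ^ 2) := by
      have e1 : ((d : ℝ) ^ t) ^ (2 * (a + b) ^ 2) = (d : ℝ) ^ (2 * (a * b)) := by
        rw [← Real.rpow_natCast, ← Real.rpow_mul hd.le, ← Real.rpow_natCast]
        congr 1
        rw [ht]
        push_cast at hn0 ⊢
        field_simp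
      have e2 : ((2 : ℝ) ^ (-((a * b : ℕ) : ℝ) / 2)) ^ (2 * (a + b) ^ 2) =
          (2 ^ (a * b * (a + b) ^ 2))⁻¹ := by
        rw [← Real.rpow_natCast, ← Real.rpow_mul (by norm_num), ← Real.rpow_natCast,
          ← Real.rpow_neg (by norm_num)]
        congr 1
        push_cast
        ring
      rw [hC₀, mul_pow, e1, e2, ← div_eq_mul_inv, div_le_iff₀ (by positivity), mul_comm (K ^ _)]
      exact h3
    exact le_of_pow_le_pow_left₀ (by positivity) hKnn h4
  have hmain := norm_trace_mul_cross_le hl hC₀pos hC x hx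
  rw [← hV, ← hdim] at hmain
  set Y := ‖(polyEval P (Matrix.diagonal x)).trace‖ *
      (∏ i, ∏ k, ‖x (finSumFinEquiv (Sum.inl i)) - x (finSumFinEquiv (Sum.inr k))‖) with hY
  have hchoose : ((a + b).factorial : ℝ) = (a + b).choose a * (a.factorial * b.factorial) := by
    have := Nat.add_choose_mul_factorial_mul_factorial a b
    rw [← this, Nat.choose_symm_add]; push_cast; ring
  have hab : (0 : ℝ) < a.factorial * b.factorial * (SA * SB) := by positivity
  have hSle := prod_factorial_le a b
  refine le_of_mul_le_mul_right (hmain.trans ?_) hab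
  have hCinv : ((d : ℝ) * SN) / C₀ = SN * ((d : ℝ) ^ (1 - t) * (2 : ℝ) ^ (((a * b : ℕ) : ℝ) / 2)) := by
    rw [hC₀, Real.rpow_sub hd, Real.rpow_one, neg_div, Real.rpow_neg (by norm_num)]
    field_simp
  rw [hCinv, hchoose]
  have hch : (((a + b).choose a : ℕ) : ℝ) ≤ 2 ^ (a * b) := by
    exact_mod_cast choose_le_two_pow ha hb
  -- The binomial, the factorials and the constant in `C₀` together cost `(2 √2 (n - 1)) ^ (ab)`
  -- with `n = a + b`, and `3 (n - 1) ≤ n²`.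
  have hnum : (2 : ℝ) ^ (a * b) * ((((a : ℝ) + b) - 1) ^ (a * b) * (2 : ℝ) ^ (((a * b : ℕ) : ℝ) / 2)) ≤
      ((a + b : ℕ) : ℝ) ^ (2 * (a * b)) := by
    have e1 : (2 : ℝ) ^ (((a * b : ℕ) : ℝ) / 2) = (Real.sqrt 2) ^ (a * b) := by
      rw [Real.sqrt_eq_rpow, ← Real.rpow_natCast, ← Real.rpow_mul (by norm_num)]
      congr 1; ring
    rw [e1, ← mul_pow, ← mul_pow, pow_mul (((a + b : ℕ) : ℝ)) 2 (a * b)]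
    have hsq : Real.sqrt 2 ≤ 3 / 2 := by
      rw [Real.sqrt_le_left (by norm_num)]; norm_num
    have hs0 := Real.sqrt_nonneg 2
    have ha' : (1 : ℝ) ≤ a := by exact_mod_cast ha
    have hb' : (1 : ℝ) ≤ b := by exact_mod_cast hb
    have hnn : 0 ≤ 2 * (((a : ℝ) + b - 1) * Real.sqrt 2) :=
      mul_nonneg (by norm_num) (mul_nonneg (by linarith) hs0)
    refine pow_le_pow_left₀ hnn ?_ _
    push_cast
    have h5 : ((a : ℝ) + b - 1) * Real.sqrt 2 ≤ ((a : ℝ) + b - 1) * (3 / 2) :=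
      mul_le_mul_of_nonneg_left hsq (by linarith)
    nlinarith [sq_nonneg ((a : ℝ) + b - 3 / 2)]
  have hDpos : 0 < (d : ℝ) ^ (1 - t) := by positivity
  have h2pos : 0 < (2 : ℝ) ^ (((a * b : ℕ) : ℝ) / 2) := by positivity
  calc ((a + b).choose a : ℝ) * (a.factorial * b.factorial) *
        (SN * ((d : ℝ) ^ (1 - t) * (2 : ℝ) ^ (((a * b : ℕ) : ℝ) / 2)))
      ≤ 2 ^ (a * b) * (a.factorial * b.factorial) *
        ((SA * SB * ((a + b : ℝ) - 1) ^ (a * b)) *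
          ((d : ℝ) ^ (1 - t) * (2 : ℝ) ^ (((a * b : ℕ) : ℝ) / 2))) := by
        refine mul_le_mul (mul_le_mul_of_nonneg_right hch (by positivity))
          (mul_le_mul_of_nonneg_right hSle (by positivity)) (by positivity) (by positivity)
    _ = (2 ^ (a * b) * (((a + b : ℝ) - 1) ^ (a * b) * (2 : ℝ) ^ (((a * b : ℕ) : ℝ) / 2))) *
        (d : ℝ) ^ (1 - t) * (a.factorial * b.factorial * (SA * SB)) := by ring
    _ ≤ _ := by
        refine mul_le_mul_of_nonneg_right (mul_le_mul_of_nonneg_right hnum hDpos.le) hab.le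

end UnitaryChar

/-! ### Diagonalization of unitary matrices -/

namespace UnitaryChar

open Matrix

/-- The circle is infinite and the spectrum finite, so some rotation moves all eigenvalues away from
one, where the Cayley transform is undefined. -/
theorem exists_norm_eq_one_isUnit_one_sub_smul {n : ℕ} (A : Matrix (Fin n) (Fin n) ℂ) :
    ∃ z : ℂ, ‖z‖ = 1 ∧ IsUnit (1 - z • A) := by
  have hinf : (Metric.sphere (0 : ℂ) 1).Infinite := by
    refine (isPreconnected_sphere (by simp [Complex.rank_real_complex]) (0 : ℂ) 1).infinite_of_nontrivial
      ⟨1, by simp, -1, by simp, ?_⟩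
    intro h
    have := congrArg Complex.re h
    norm_num at this
  have hfin : (((A.charpoly.roots.toFinset : Finset ℂ) : Set ℂ)).Finite := Finset.finite_toSet _
  obtain ⟨w, hw, hw'⟩ := hinf.exists_notMem_finite hfin
  have hw1 : ‖w‖ = 1 := by simpa using hw
  have hw0 : w ≠ 0 := by
    rintro rfl
    simp at hw1
  refine ⟨w⁻¹, by simp [hw1], ?_⟩
  have hdet : (Matrix.scalar (Fin n) w - A).det ≠ 0 := by
    rw [← Matrix.eval_charpoly]
    intro h
    apply hw'
    simp only [Finset.mem_coe, Multiset.mem_toFinset]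
    rw [Polynomial.mem_roots A.charpoly_monic.ne_zero]
    exact h
  have hs : (1 - w⁻¹ • A) = w⁻¹ • (Matrix.scalar (Fin n) w - A) := by
    rw [smul_sub]
    congr 1
    ext i j
    by_cases hij : i = j
    · subst hij
      simp [hw0]
    · simp [hij]
  rw [hs, Matrix.isUnit_iff_isUnit_det, Matrix.det_smul]
  exact (IsUnit.mk0 _ (mul_ne_zero (pow_ne_zero _ (inv_ne_zero hw0)) hdet))

/-- The Cayley transform `H = i (1 + A)(1 - A)⁻¹` is Hermitian, so the spectral theorem applies to
it. Inverting the transform on its real eigenvalues `e` yields the unit numbers `(e - i)/(e + i)`.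
-/
theorem exists_unitary_conj_diagonal_of_isUnit {n : ℕ} {A : Matrix (Fin n) (Fin n) ℂ}
    (hA : A ∈ unitaryGroup (Fin n) ℂ) (h : IsUnit (1 - A)) :
    ∃ (V : unitaryGroup (Fin n) ℂ) (x : Fin n → ℂ), (∀ i, ‖x i‖ = 1) ∧
      A = V * diagonal x * star (V : Matrix (Fin n) (Fin n) ℂ) := by
  have h1 : Aᴴ * A = 1 := mem_unitaryGroup_iff'.1 hA
  have hdet : IsUnit (1 - A).det := (isUnit_iff_isUnit_det _).1 h
  set B := (1 - A)⁻¹ with hB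
  have hB1 : B * (1 - A) = 1 := nonsing_inv_mul _ hdet
  have hB2 : (1 - A) * B = 1 := mul_nonsing_inv _ hdet
  have hB3 : Bᴴ * (1 - Aᴴ) = 1 := by
    have := congrArg conjTranspose hB2
    simpa using this
  set H : Matrix (Fin n) (Fin n) ℂ := Complex.I • ((1 + A) * B) with hH
  have hkey : -((1 + Aᴴ) * (1 - A)) = (1 - Aᴴ) * (1 + A) := by
    simp only [add_mul, mul_sub, sub_mul, mul_add, one_mul, mul_one, h1]
    abel
  have hherm : H.IsHermitian := by
    have e : -(Bᴴ * (1 + Aᴴ)) = (1 + A) * B := by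
      calc -(Bᴴ * (1 + Aᴴ)) = -(Bᴴ * (1 + Aᴴ)) * ((1 - A) * B) := by rw [hB2, mul_one]
        _ = Bᴴ * (-((1 + Aᴴ) * (1 - A))) * B := by noncomm_ring
        _ = (Bᴴ * (1 - Aᴴ)) * (1 + A) * B := by rw [hkey]; noncomm_ring
        _ = (1 + A) * B := by rw [hB3, one_mul]
    rw [Matrix.IsHermitian, hH, conjTranspose_smul, conjTranspose_mul, ← e]
    simp
  clear_value H
  have hHA : H - Complex.I • 1 = (H + Complex.I • 1) * A := by
    have e : H * (1 - A) = Complex.I • (1 + A) := by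
      rw [hH, smul_mul_assoc, mul_assoc, hB1, mul_one]
    rw [mul_sub, mul_one, smul_add] at e
    rw [add_mul, smul_mul_assoc, one_mul]
    rw [sub_eq_iff_eq_add] at e ⊢
    refine e.trans ?_
    abel
  set V := hherm.eigenvectorUnitary
  set e := hherm.eigenvalues with he
  have hspec : H = V * diagonal (fun i => (e i : ℂ)) * star (V : Matrix (Fin n) (Fin n) ℂ) := by
    have := hherm.spectral_theorem
    rw [Unitary.conjStarAlgAut_apply] at this
    exact this
  have hVV : star (V : Matrix (Fin n) (Fin n) ℂ) * V = 1 := Unitary.coe_star_mul_self V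
  have hVV' : (V : Matrix (Fin n) (Fin n) ℂ) * star (V : Matrix (Fin n) (Fin n) ℂ) = 1 :=
    Unitary.coe_mul_star_self V
  have hne : ∀ i, (e i : ℂ) + Complex.I ≠ 0 := by
    intro i h
    have := congrArg Complex.im h
    simp at this
  refine ⟨V, fun i => ((e i : ℂ) - Complex.I) / ((e i : ℂ) + Complex.I), ?_, ?_⟩
  · intro i
    have : ‖(e i : ℂ) - Complex.I‖ = ‖(e i : ℂ) + Complex.I‖ := by
      rw [← Complex.norm_conj]
      simp
    rw [norm_div, this, div_self]
    simpa using hne i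
  · have hminus : diagonal (fun i => (e i : ℂ) - Complex.I) =
        diagonal (fun i => (e i : ℂ) + Complex.I) *
          (star (V : Matrix (Fin n) (Fin n) ℂ) * A * V) := by
      have hc : ∀ c : ℂ, diagonal (fun i => (e i : ℂ) + c) =
          star (V : Matrix (Fin n) (Fin n) ℂ) * (H + c • 1) * V := by
        intro c
        have h2 : diagonal (fun i => (e i : ℂ) + c) = diagonal (fun i => (e i : ℂ)) + c • 1 := by
          rw [← diagonal_one, ← diagonal_smul, diagonal_add]
          simp
        rw [h2, mul_add, add_mul, mul_smul_comm, smul_mul_assoc, mul_one, hVV]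
        congr 1
        rw [hspec]
        calc diagonal (fun i => (e i : ℂ)) = (star (V : Matrix (Fin n) (Fin n) ℂ) * V) *
              diagonal (fun i => (e i : ℂ)) * (star (V : Matrix (Fin n) (Fin n) ℂ) * V) := by
              rw [hVV, one_mul, mul_one]
          _ = _ := by noncomm_ring
      have h3 := hc (-Complex.I)
      rw [neg_smul, ← sub_eq_add_neg, hHA] at h3
      simp only [← sub_eq_add_neg] at h3
      rw [h3, hc Complex.I]
      calc _ = star (V : Matrix (Fin n) (Fin n) ℂ) * (H + Complex.I • 1) * (1 * A) * V := by
            rw [one_mul, mul_assoc (star _) (H + _) A]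
        _ = _ := by rw [← hVV']; noncomm_ring
    have hdiag : star (V : Matrix (Fin n) (Fin n) ℂ) * A * V =
        diagonal fun i => ((e i : ℂ) - Complex.I) / ((e i : ℂ) + Complex.I) := by
      have h4 := congrArg (fun M => diagonal (fun i => ((e i : ℂ) + Complex.I)⁻¹) * M) hminus
      simp only [← mul_assoc, diagonal_mul_diagonal] at h4
      simp only [inv_mul_cancel₀ (hne _), diagonal_one, one_mul] at h4
      rw [← h4]
      congr 1
      funext i
      rw [div_eq_inv_mul]
    rw [← hdiag]
    calc A = ((V : Matrix (Fin n) (Fin n) ℂ) * star (V : Matrix (Fin n) (Fin n) ℂ)) * A *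
          ((V : Matrix (Fin n) (Fin n) ℂ) * star (V : Matrix (Fin n) (Fin n) ℂ)) := by
          rw [hVV', one_mul, mul_one]
      _ = _ := by noncomm_ring

/-- Unitary matrices are unitarily diagonalizable. -/
theorem exists_unitary_conj_diagonal {n : ℕ} (g : U n) :
    ∃ (V : U n) (x : Fin n → ℂ), (∀ i, ‖x i‖ = 1) ∧
      (g : Matrix (Fin n) (Fin n) ℂ) = V * diagonal x * star (V : Matrix (Fin n) (Fin n) ℂ) := by
  obtain ⟨z, hz, hu⟩ := exists_norm_eq_one_isUnit_one_sub_smul (g : Matrix (Fin n) (Fin n) ℂ)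
  have hz0 : z ≠ 0 := by
    rintro rfl
    simp at hz
  have hmem : z • (g : Matrix (Fin n) (Fin n) ℂ) ∈ unitaryGroup (Fin n) ℂ := by
    rw [mem_unitaryGroup_iff, star_smul, smul_mul_smul_comm, mem_unitaryGroup_iff.1 g.2]
    have : z * star z = 1 := by
      rw [Complex.star_def, Complex.mul_conj, Complex.normSq_eq_norm_sq, hz]
      simp
    rw [this, one_smul]
  obtain ⟨V, x, hx, h⟩ := exists_unitary_conj_diagonal_of_isUnit hmem hu
  refine ⟨V, fun i => z⁻¹ * x i, fun i => by simp [hz, hx], ?_⟩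
  have hd : diagonal (fun i => z⁻¹ * x i) = z⁻¹ • diagonal x := by
    rw [← diagonal_smul]
    rfl
  rw [hd, mul_smul_comm, smul_mul_assoc, ← h, smul_smul, inv_mul_cancel₀ hz0, one_smul]

theorem eigenvalues_of_eq_conj {n : ℕ} {g V : U n} {x : Fin n → ℂ}
    (h : (g : Matrix (Fin n) (Fin n) ℂ) = V * diagonal x * star (V : Matrix (Fin n) (Fin n) ℂ)) :
    eigenvalues g = Finset.univ.val.map x := by
  have hVV : star (V : Matrix (Fin n) (Fin n) ℂ) * V = 1 := Unitary.coe_star_mul_self V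
  rw [eigenvalues, h, mul_assoc, charpoly_mul_comm, mul_assoc, hVV, mul_one, charpoly_diagonal,
    Polynomial.roots_prod _ _ (Finset.prod_ne_zero_iff.2 fun i _ => Polynomial.X_sub_C_ne_zero _)]
  simp [Multiset.bind_singleton]

/-- Two families with the same multiset of values differ by a permutation. -/
theorem exists_perm_of_map_univ_eq {ι α : Type*} [Fintype ι] {x y : ι → α}
    (h : (Finset.univ.val.map x : Multiset α) = Finset.univ.val.map y) :
    ∃ σ : Equiv.Perm ι, x = y ∘ σ := by
  classical
  have hc : ∀ c, Nonempty ({i // x i = c} ≃ {i // y i = c}) := by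
    intro c
    refine ⟨Fintype.equivOfCardEq ?_⟩
    have := congrArg (Multiset.count c) h
    rw [Multiset.count_map, Multiset.count_map] at this
    rw [Fintype.card_subtype, Fintype.card_subtype, Finset.card_def, Finset.card_def,
      Finset.filter_val, Finset.filter_val]
    simpa only [eq_comm] using this
  let e := fun c => Classical.choice (hc c)
  exact ⟨Equiv.ofFiberEquiv e, funext fun i => (Equiv.ofFiberEquiv_map e i).symm⟩

end UnitaryChar

/-! ### From the torus bound to separated elements -/

namespace UnitaryChar

open Matrix

theorem exists_map_univ_eq {α : Type*} (Q : Multiset α) :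
    ∃ x : Fin (Multiset.card Q) → α, Q = Finset.univ.val.map x := by
  induction Q using Quot.inductionOn with
  | h l =>
    refine ⟨fun i => l.get i, ?_⟩
    rw [Fin.univ_val_map]
    exact congrArg _ (List.ofFn_get l).symm

theorem trace_polyEval_diagonal_comp {n d : ℕ}
    {P : Matrix (Fin d) (Fin d) (MvPolynomial (Fin n × Fin n) ℂ)} (hP : IsPolyRep P)
    (x : Fin n → ℂ) (σ : Equiv.Perm (Fin n)) :
    (polyEval P (diagonal (x ∘ σ))).trace = (polyEval P (diagonal x)).trace := by
  have h := congrArg (MvPolynomial.eval x) (rename_traceTorus_one hP σ)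
  rwa [MvPolynomial.eval_rename, eval_traceTorus, eval_traceTorus, one_mul, one_mul] at h

theorem trace_polyEval_conj {n d : ℕ}
    {P : Matrix (Fin d) (Fin d) (MvPolynomial (Fin n × Fin n) ℂ)} (hP : IsPolyRep P)
    {S S' : Matrix (Fin n) (Fin n) ℂ} (h : S' * S = 1) (X : Matrix (Fin n) (Fin n) ℂ) :
    (polyEval P (S * X * S')).trace = (polyEval P X).trace := by
  rw [hP.map_mul, trace_mul_comm, ← hP.map_mul, ← mul_assoc, h, one_mul]

theorem norm_det_eq_one {n : ℕ} (g : U n) : ‖(g : Matrix (Fin n) (Fin n) ℂ).det‖ = 1 := by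
  have h := (Matrix.det_of_mem_unitary g.2)
  exact CStarRing.norm_of_mem_unitary h

theorem norm_character_eq {n m : ℕ} {π : Representation ℂ (U n) (Fin m → ℂ)} {d N : ℕ}
    {P : Matrix (Fin d) (Fin d) (MvPolynomial (Fin n × Fin n) ℂ)}
    (h : ∀ g : U n, (g : Matrix (Fin n) (Fin n) ℂ).det ^ N * π.character g =
      (polyEval P (g : Matrix (Fin n) (Fin n) ℂ)).trace) (g : U n) :
    ‖π.character g‖ = ‖(polyEval P (g : Matrix (Fin n) (Fin n) ℂ)).trace‖ := by
  rw [← h g, norm_mul, norm_pow, norm_det_eq_one, one_pow, one_mul]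

/-- The character bound for an element whose eigenvalues split into two parts at distance `ε`. -/
theorem norm_mul_pow_card_le {n : ℕ} {ρ : U n → ℂ} (hρ : ρ ∈ Irr (U n)) (g : U n)
    {Q R : Multiset ℂ} (hQR : Q + R = eigenvalues g) (hQ : 1 ≤ Multiset.card Q)
    (hR : 1 ≤ Multiset.card R) {ε : ℝ} (hε : 0 ≤ ε) (hsep : ∀ a ∈ Q, ∀ b ∈ R, ε ≤ ‖a - b‖) :
    n = Multiset.card Q + Multiset.card R ∧ 1 ≤ degree ρ ∧
    ‖ρ g‖ * ε ^ (Multiset.card Q * Multiset.card R) ≤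
      (n : ℝ) ^ (2 * (Multiset.card Q * Multiset.card R)) *
        degree ρ ^ (1 - ((Multiset.card Q * Multiset.card R : ℕ) : ℝ) / (n : ℝ) ^ 2) := by
  obtain ⟨m, π, hirr, hcont, rfl⟩ := hρ
  obtain ⟨V, x, hx, hg⟩ := exists_unitary_conj_diagonal g
  have heig := eigenvalues_of_eq_conj hg
  rw [heig] at hQR
  obtain ⟨xQ, hxQ⟩ := exists_map_univ_eq Q
  obtain ⟨xR, hxR⟩ := exists_map_univ_eq R
  generalize Multiset.card Q = a at *
  generalize Multiset.card R = b at *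
  have hn : n = a + b := by
    have := congrArg Multiset.card hQR
    rw [hxQ, hxR] at this
    simpa using this.symm
  subst hn
  obtain ⟨N, P, hP, htr⟩ := exists_isPolyRep π hirr hcont
  have hdeg : degree π.character = (m : ℝ) := by simp [degree]
  rw [hdeg]
  refine ⟨rfl, by exact_mod_cast hP.nonempty, ?_⟩
  have hperm : (Finset.univ.val.map (Fin.append xQ xR) : Multiset ℂ) = Finset.univ.val.map x := by
    rw [← hQR, hxQ, hxR, Fin.univ_val_map, Fin.univ_val_map, Fin.univ_val_map,
      List.ofFn_fin_append, Multiset.coe_add]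
  obtain ⟨σ, hσ⟩ := exists_perm_of_map_univ_eq hperm
  have hVV : star (V : Matrix (Fin (a + b)) (Fin (a + b)) ℂ) * V = 1 := Unitary.coe_star_mul_self V
  have hnorm : ‖π.character g‖ = ‖(polyEval P (diagonal (Fin.append xQ xR))).trace‖ := by
    rw [norm_character_eq htr, hg, trace_polyEval_conj hP hVV, hσ, trace_polyEval_diagonal_comp hP]
  have hmain := norm_trace_mul_cross_le_degree hQ hR hP (Fin.append xQ xR)
    (fun i => by rw [hσ]; exact hx _)
  rw [hnorm]
  refine le_trans (mul_le_mul_of_nonneg_left ?_ (norm_nonneg _)) hmain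
  have : ε ^ (a * b) = ∏ _i : Fin a, ∏ _k : Fin b, ε := by
    simp [← pow_mul, mul_comm]
  rw [this]
  refine Finset.prod_le_prod (fun _ _ => Finset.prod_nonneg fun _ _ => hε) fun i _ =>
    Finset.prod_le_prod (fun _ _ => hε) fun k _ => ?_
  rw [finSumFinEquiv_apply_left, finSumFinEquiv_apply_right, Fin.append_left, Fin.append_right]
  exact hsep _ (by rw [hxQ]; simp) _ (by rw [hxR]; simp)

/-- With `t = ab/n²` and `c = γ(1-γ) ≤ t`, the loss from `ε` is `D ^ (c t)` and the loss from `n ^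
(2ab)` is at most `D ^ (γ t / 2)`, against the gain `D ^ (-t)`. The constant `4/γ` in the threshold
is what this balance requires. -/
theorem norm_le_of_isSeparated {n : ℕ} (hn : 2 ≤ n) {ρ : U n → ℂ} (hρ : ρ ∈ Irr (U n)) {g : U n}
    {γ : ℝ} (hγ : 0 < γ) (hγ' : γ < 1 / 2)
    (hD : (2 : ℝ) ^ (4 / γ * (n : ℝ) ^ 2 * Real.logb 2 n) < degree ρ)
    (hsep : IsSeparated γ (degree ρ ^ (-(γ * (1 - γ)) / (n : ℝ) ^ 2)) g) :
    ‖ρ g‖ ≤ degree ρ ^ (1 - γ * (1 - γ) / 2) := by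
  obtain ⟨Q, R, hQR, hQ, hR, hdist⟩ := hsep
  have hn0 : (0 : ℝ) < n := by positivity
  have hQ1 : 1 ≤ Multiset.card Q := by
    have : (0 : ℝ) < Multiset.card Q := lt_of_lt_of_le (by positivity) hQ
    exact_mod_cast this
  have hR1 : 1 ≤ Multiset.card R := by
    have : (0 : ℝ) < Multiset.card R := lt_of_lt_of_le (by positivity) hR
    exact_mod_cast this
  have hD0 : 0 < degree ρ := lt_trans (by positivity) hD
  obtain ⟨hab, hD1, hmain⟩ := norm_mul_pow_card_le hρ g hQR hQ1 hR1 (by positivity) hdist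
  set D := degree ρ with hDdef
  set a := Multiset.card Q
  set b := Multiset.card R
  set c := γ * (1 - γ) with hc
  have hab' : (n : ℝ) = a + b := by exact_mod_cast hab
  have hlog : (n : ℝ) ^ (4 / γ * (n : ℝ) ^ 2) ≤ D := by
    have e : (2 : ℝ) ^ (4 / γ * (n : ℝ) ^ 2 * Real.logb 2 n) = (n : ℝ) ^ (4 / γ * (n : ℝ) ^ 2) := by
      rw [mul_comm, Real.rpow_mul (by norm_num), Real.rpow_logb (by norm_num) (by norm_num) hn0]
    rw [← e]
    exact hD.le
  set t : ℝ := ((a * b : ℕ) : ℝ) / (n : ℝ) ^ 2 with ht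
  have ht0 : 0 ≤ t := by positivity
  have htn : t * (n : ℝ) ^ 2 = ((a * b : ℕ) : ℝ) := by
    rw [ht]; field_simp
  have htc : c ≤ t := by
    rw [ht, le_div_iff₀ (by positivity)]
    push_cast
    rw [hab'] at hQ hR ⊢
    rw [hc]
    nlinarith [mul_nonneg (sub_nonneg.2 hQ) (sub_nonneg.2 hR)]
  have hpow : (n : ℝ) ^ (2 * (a * b)) ≤ D ^ (γ * t / 2) := by
    calc (n : ℝ) ^ (2 * (a * b)) = ((n : ℝ) ^ (4 / γ * (n : ℝ) ^ 2)) ^ (γ * t / 2) := by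
          rw [← Real.rpow_mul hn0.le, ← Real.rpow_natCast]
          congr 1
          rw [Nat.cast_mul, ← htn]
          push_cast
          field_simp
          ring
      _ ≤ _ := Real.rpow_le_rpow (by positivity) hlog (by positivity)
  have heps : (D ^ (-c / (n : ℝ) ^ 2)) ^ (a * b) = D ^ (-(c * t)) := by
    rw [← Real.rpow_natCast, ← Real.rpow_mul hD0.le]
    congr 1
    rw [← htn]
    field_simp
  rw [heps] at hmain
  have h1 : ‖ρ g‖ ≤ D ^ (γ * t / 2 + (1 - t) + c * t) := by
    rw [Real.rpow_add hD0, Real.rpow_add hD0]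
    calc ‖ρ g‖ = ‖ρ g‖ * D ^ (-(c * t)) * D ^ (c * t) := by
          rw [mul_assoc, ← Real.rpow_add hD0]; simp
      _ ≤ _ := by
          refine mul_le_mul_of_nonneg_right (hmain.trans ?_) (by positivity)
          exact mul_le_mul_of_nonneg_right hpow (by positivity)
  refine h1.trans (Real.rpow_le_rpow_of_exponent_le hD1 ?_)
  -- Equivalent to `(1 - γ)(1/2 - γ) ≥ 0`; both losses together use at most half of the gain.
  have h2 : c + γ / 2 ≤ 1 / 2 := by
    rw [hc]
    nlinarith
  nlinarith

end UnitaryChar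

/-! ### Spread elements are separated -/

namespace UnitaryChar

/-- Among `n + 1` consecutive intervals, one contains none of `n` given points. -/
theorem exists_forall_notMem_Ioc {n : ℕ} (f : Fin n → ℝ) (s : ℝ) {δ : ℝ} (hδ : 0 < δ) :
    ∃ j : ℕ, j ≤ n ∧ ∀ i, f i ∉ Set.Ioc (s + j * δ) (s + (j + 1) * δ) := by
  by_contra! hcon
  choose i hi using fun j : Fin (n + 1) => hcon j (Nat.lt_succ_iff.1 j.2)
  have hinj : Function.Injective i := by
    have key : ∀ j k : Fin (n + 1), i j = i k → j ≤ k := by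
      intro j k hjk
      have h1 := (hi j).1
      have h2 := (hi k).2
      rw [← hjk] at h2
      have h3 : ((j : ℕ) : ℝ) < (k : ℕ) + 1 := by
        have : ((j : ℕ) : ℝ) * δ < ((k : ℕ) + 1) * δ := by linarith
        exact lt_of_mul_lt_mul_right this hδ.le
      have : (j : ℕ) < k + 1 := by exact_mod_cast h3
      exact Fin.le_def.2 (by omega)
    exact fun j k hjk => le_antisymm (key j k hjk) (key k j hjk.symm)
  have := Fintype.card_le_of_injective i hinj
  simp at this

/-- Take the least sample value whose lower count reaches `c`; if the strict count also reached `c`,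
the largest smaller value would already do. -/
theorem exists_quantile {n : ℕ} (f : Fin n → ℝ) {c : ℝ} (hc : 0 < c) (hcn : c ≤ n) :
    ∃ s : ℝ, c ≤ (Finset.univ.filter fun i => f i ≤ s).card ∧
      ((Finset.univ.filter fun i => f i < s).card : ℝ) < c := by
  have hn : 0 < n := by
    have : (0 : ℝ) < n := hc.trans_le hcn
    exact_mod_cast this
  have : Nonempty (Fin n) := ⟨⟨0, hn⟩⟩
  set S := Finset.univ.filter fun i => c ≤ ((Finset.univ.filter fun k => f k ≤ f i).card : ℝ) with hS
  have hSne : S.Nonempty := by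
    obtain ⟨i, hi⟩ := Finite.exists_max f
    refine ⟨i, ?_⟩
    rw [hS, Finset.mem_filter, Finset.filter_true_of_mem fun k _ => hi k]
    simpa using hcn
  obtain ⟨i, hiS, hi⟩ := Finset.exists_min_image S f hSne
  refine ⟨f i, (Finset.mem_filter.1 hiS).2, ?_⟩
  by_contra! hcon
  have hne : (Finset.univ.filter fun k => f k < f i).Nonempty := by
    rw [← Finset.card_pos]
    exact_mod_cast hc.trans_le hcon
  obtain ⟨k, hk, hkmax⟩ := Finset.exists_max_image _ f hne
  have hk' : f k < f i := by simpa using hk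
  have hkS : k ∈ S := by
    rw [hS, Finset.mem_filter]
    refine ⟨Finset.mem_univ _, hcon.trans ?_⟩
    exact_mod_cast Finset.card_le_card fun l hl => by
      simpa using hkmax l hl
  exact absurd (hi k hkS) (not_le.2 hk')

theorem norm_exp_sub_exp (a b : ℝ) :
    ‖Complex.exp (a * Complex.I) - Complex.exp (b * Complex.I)‖ = 2 * |Real.sin ((b - a) / 2)| := by
  have h : Complex.exp (a * Complex.I) - Complex.exp (b * Complex.I) =
      -(Complex.exp (a * Complex.I) * (Complex.exp (Complex.I * ((b - a : ℝ) : ℂ)) - 1)) := by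
    rw [mul_sub, ← Complex.exp_add]
    push_cast
    ring_nf
  rw [h, norm_neg, norm_mul, Complex.norm_exp_ofReal_mul_I, one_mul,
    Complex.norm_exp_I_mul_ofReal_sub_one]
  simp

/-- Arguments of finitely many points of the circle can be chosen in an interval that is shorter
than a full turn by a definite amount. -/
theorem exists_angles {n : ℕ} (x : Fin n → ℂ) (hx : ∀ i, ‖x i‖ = 1) :
    ∃ φ : Fin n → ℝ, (∀ i, Complex.exp (φ i * Complex.I) = x i) ∧
      ∀ i k, φ i - φ k ≤ 2 * Real.pi - 2 * Real.pi / (n + 1) := by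
  have hn1 : (0 : ℝ) < n + 1 := by positivity
  set δ := 2 * Real.pi / (n + 1) with hδ
  have hδ0 : 0 < δ := by positivity
  have hδn : (n + 1) * δ = 2 * Real.pi := by
    rw [hδ]; field_simp
  -- One of `n + 1` equal arcs of the circle contains no point. Cutting the circle there, by adding
  -- a full turn to the arguments before the cut, leaves an angular range shorter than a turn by
  -- that arc.
  obtain ⟨j, hj, hgap⟩ := exists_forall_notMem_Ioc (fun i => (x i).arg) (-Real.pi) hδ0
  have hexp : ∀ i, Complex.exp ((x i).arg * Complex.I) = x i := by
    intro i
    have := Complex.norm_mul_exp_arg_mul_I (x i)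
    rwa [hx, Complex.ofReal_one, one_mul] at this
  set t := -Real.pi + (j + 1) * δ with ht
  have hrange : ∀ i, (t < (x i).arg ∧ (x i).arg ≤ Real.pi) ∨
      (-Real.pi < (x i).arg ∧ (x i).arg ≤ t - δ) := by
    intro i
    rcases lt_or_ge t (x i).arg with h | h
    · exact Or.inl ⟨h, Complex.arg_le_pi _⟩
    · refine Or.inr ⟨Complex.neg_pi_lt_arg _, ?_⟩
      by_contra! h2
      refine hgap i ⟨?_, h⟩
      rw [ht] at h2
      linarith
  have htpi : t ≤ Real.pi := by
    have : ((j : ℝ) + 1) * δ ≤ (n + 1) * δ := by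
      have : (j : ℝ) ≤ n := by exact_mod_cast hj
      gcongr
    linarith
  have htpi' : -Real.pi ≤ t - δ := by
    have : 0 ≤ (j : ℝ) * δ := by positivity
    rw [ht]; linarith
  classical
  refine ⟨fun i => if t < (x i).arg then (x i).arg else (x i).arg + 2 * Real.pi, ?_, ?_⟩
  · intro i
    dsimp only
    split_ifs
    · exact hexp i
    · push_cast
      rw [add_mul, Complex.exp_add, hexp, Complex.exp_two_pi_mul_I, mul_one]
  · have hb : ∀ i, t ≤ (if t < (x i).arg then (x i).arg else (x i).arg + 2 * Real.pi) ∧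
        (if t < (x i).arg then (x i).arg else (x i).arg + 2 * Real.pi) ≤ t - δ + 2 * Real.pi := by
      intro i
      rcases hrange i with h | h
      · rw [if_pos h.1]
        exact ⟨h.1.le, by linarith⟩
      · rw [if_neg (by linarith)]
        exact ⟨by linarith, by linarith⟩
    intro i k
    have h1 := hb i
    have h2 := hb k
    dsimp only
    linarith

/-- Half the angle lies in `[y, π - y]` for `y = ε/(n+1)`, so the chord is at least `2 sin y`. This
exceeds `3y/2`, while `ε² = y ε (n+1) ≤ 3y/2`. -/
theorem sq_le_norm_exp_sub_exp {n : ℕ} (hn : 2 ≤ n) {ε : ℝ} (hε : 0 < ε) (hεn : ε * n ≤ 1)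
    {a b : ℝ} (h1 : 2 * ε / (n + 1) ≤ b - a) (h2 : b - a ≤ 2 * Real.pi - 2 * Real.pi / (n + 1)) :
    ε ^ 2 ≤ ‖Complex.exp (a * Complex.I) - Complex.exp (b * Complex.I)‖ := by
  have hn' : (2 : ℝ) ≤ n := by exact_mod_cast hn
  set y := ε / ((n : ℝ) + 1) with hy
  have hy0 : 0 < y := by positivity
  have hyn : y * (n + 1) = ε := by
    rw [hy]; field_simp
  have hε2 : ε ≤ 1 / 2 := by nlinarith
  have hy1 : y ≤ 1 / 6 := by nlinarith
  have hpi := Real.pi_gt_three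
  have h1' : y ≤ (b - a) / 2 := by
    have : 2 * ε / ((n : ℝ) + 1) = 2 * y := by rw [hy]; ring
    linarith
  have h2' : (b - a) / 2 ≤ Real.pi - y := by
    have : y ≤ Real.pi / (n + 1) := by
      rw [hy]; gcongr; linarith
    have e : 2 * Real.pi / ((n : ℝ) + 1) = 2 * (Real.pi / (n + 1)) := by ring
    linarith
  have hsin : Real.sin y ≤ Real.sin ((b - a) / 2) := by
    rcases le_total ((b - a) / 2) (Real.pi / 2) with h | h
    · exact Real.sin_le_sin_of_le_of_le_pi_div_two (by linarith) h h1'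
    · rw [← Real.sin_pi_sub ((b - a) / 2)]
      exact Real.sin_le_sin_of_le_of_le_pi_div_two (by linarith) (by linarith) (by linarith)
  have hs := Real.sin_gt_sub_cube hy0
  rw [norm_exp_sub_exp]
  have h3 : ε ^ 2 ≤ 2 * (y - y ^ 3 / 6) := by
    have e1 : ε ^ 2 = y * (ε * (n + 1)) := by rw [← hyn]; ring
    have e2 : ε * (n + 1) ≤ 3 / 2 := by linarith
    have e3 : ε ^ 2 ≤ y * (3 / 2) := by
      rw [e1]; exact mul_le_mul_of_nonneg_left e2 hy0.le
    have e4 : y ^ 3 ≤ y := by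
      have : y ^ 3 ≤ y ^ 1 := pow_le_pow_of_le_one hy0.le (by linarith) (by norm_num)
      simpa using this
    linarith
  have := le_abs_self (Real.sin ((b - a) / 2))
  linarith

theorem IsSpread.isSeparated {n : ℕ} (hn : 2 ≤ n) {g : U n} {γ ε : ℝ} (hγ : 0 < γ)
    (hγ' : γ < 1 / 2) (hε : 0 < ε) (hεn : ε * n ≤ 1) (h : IsSpread (2 * γ) ε g) :
    IsSeparated γ (ε ^ 2) g := by
  obtain ⟨V, x, hx, hg⟩ := exists_unitary_conj_diagonal g
  have heig := eigenvalues_of_eq_conj hg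
  obtain ⟨φ, hφ, hrange⟩ := exists_angles x hx
  have hn0 : (0 : ℝ) < n := by positivity
  have hc0 : 0 < γ * n := by positivity
  have hcn : γ * n ≤ n := by nlinarith
  obtain ⟨s, hs, hs'⟩ := exists_quantile φ hc0 hcn
  obtain ⟨s₁, hs₁, hs₁'⟩ := exists_quantile (fun i => -φ i) hc0 hcn
  -- Fewer than `γ n` angles lie below `s`, and fewer than `γ n` above `-s₁`. If these quantiles
  -- were within `2ε`, a single arc would contain more than `(1 - 2γ) n` eigenvalues.
  have hwide : s + 2 * ε < -s₁ := by
    by_contra! hcon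
    have hsp := h s
    rw [heig, Multiset.countP_map] at hsp
    classical
    have hsp' : ((Finset.univ.filter fun i => x i ∈ arc s (2 * ε)).card : ℝ) ≤
        (1 - 2 * γ) * n := hsp
    have hsub : (Finset.univ : Finset (Fin n)) ⊆
        Finset.univ.filter (fun i => x i ∈ arc s (2 * ε)) ∪
        ((Finset.univ.filter fun i => φ i < s) ∪ (Finset.univ.filter fun i => -φ i < s₁)) := by
      intro i _
      simp only [Finset.mem_union, Finset.mem_filter, Finset.mem_univ, true_and]
      by_contra! hi
      exact hi.1 ⟨φ i, ⟨hi.2.1, by linarith [hi.2.2]⟩, hφ i⟩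
    have h2 := (Finset.card_le_card hsub).trans ((Finset.card_union_le _ _).trans
      (Nat.add_le_add_left (Finset.card_union_le _ _) _))
    rw [Finset.card_univ, Fintype.card_fin] at h2
    have hcard : (n : ℝ) ≤ ((Finset.univ.filter fun i => x i ∈ arc s (2 * ε)).card : ℝ) +
        (((Finset.univ.filter fun i => φ i < s).card : ℝ) +
          ((Finset.univ.filter fun i => -φ i < s₁).card : ℝ)) := by
      exact_mod_cast h2
    linarith
  have hn1 : (0 : ℝ) < n + 1 := by positivity
  set δ := 2 * ε / (n + 1) with hδ
  have hδ0 : 0 < δ := by positivity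
  have hδn : (n + 1) * δ = 2 * ε := by
    rw [hδ]; field_simp
  -- Pigeonhole finds an empty window of width `2ε/(n+1)` between the quantiles; the split is made
  -- at its left end, so both parts keep at least `γ n` eigenvalues.
  obtain ⟨j, hj, hgap⟩ := exists_forall_notMem_Ioc φ s hδ0
  have hj1 : ((j : ℝ) + 1) * δ ≤ 2 * ε := by
    rw [← hδn]
    have : (j : ℝ) ≤ n := by exact_mod_cast hj
    gcongr
  have hj0 : 0 ≤ (j : ℝ) * δ := by positivity
  refine ⟨(Finset.univ.val.filter fun i => φ i ≤ s + j * δ).map x,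
    (Finset.univ.val.filter fun i => ¬ φ i ≤ s + j * δ).map x, ?_, ?_, ?_, ?_⟩
  · rw [← Multiset.map_add, Multiset.filter_add_not, heig]
  · rw [Multiset.card_map]
    refine hs.trans ?_
    have : (Finset.univ.filter fun i => φ i ≤ s).card ≤
        (Finset.univ.filter fun i => φ i ≤ s + j * δ).card :=
      Finset.card_le_card fun i hi => by
        simp only [Finset.mem_filter, Finset.mem_univ, true_and] at hi ⊢
        linarith
    exact_mod_cast this
  · rw [Multiset.card_map]
    refine hs₁.trans ?_
    have : (Finset.univ.filter fun i => -φ i ≤ s₁).card ≤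
        (Finset.univ.filter fun i => ¬ φ i ≤ s + j * δ).card :=
      Finset.card_le_card fun i hi => by
        simp only [Finset.mem_filter, Finset.mem_univ, true_and] at hi ⊢
        linarith
    exact_mod_cast this
  · intro a ha b hb
    simp only [Multiset.mem_map, Multiset.mem_filter, Finset.mem_val, Finset.mem_univ,
      true_and] at ha hb
    obtain ⟨i, hi, rfl⟩ := ha
    obtain ⟨k, hk, rfl⟩ := hb
    rw [← hφ i, ← hφ k]
    refine sq_le_norm_exp_sub_exp hn hε hεn ?_ (hrange k i)
    have : s + ((j : ℝ) + 1) * δ < φ k := by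
      by_contra! hcon
      exact hgap k ⟨not_le.1 hk, hcon⟩
    linarith

/-- The spread radius is the square root of the separation distance, matching the loss from `ε` to
`ε²`; the threshold on the degree also guarantees `ε n ≤ 1`. -/
theorem norm_le_of_isSpread {n : ℕ} (hn : 2 ≤ n) {ρ : U n → ℂ} (hρ : ρ ∈ Irr (U n)) {g : U n}
    {γ : ℝ} (hγ : 0 < γ) (hγ' : γ < 1 / 2)
    (hD : (2 : ℝ) ^ (4 / γ * (n : ℝ) ^ 2 * Real.logb 2 n) < degree ρ)
    (h : IsSpread (2 * γ) (degree ρ ^ (-(γ * (1 - γ) / 2) / (n : ℝ) ^ 2)) g) :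
    ‖ρ g‖ ≤ degree ρ ^ (1 - γ * (1 - γ) / 2) := by
  have hD0 : 0 < degree ρ := lt_trans (by positivity) hD
  have hn0 : (0 : ℝ) < n := by positivity
  have hn1 : (1 : ℝ) ≤ n := by exact_mod_cast (by omega : 1 ≤ n)
  refine norm_le_of_isSeparated hn hρ hγ hγ' hD ?_
  have hsq : (degree ρ ^ (-(γ * (1 - γ) / 2) / (n : ℝ) ^ 2)) ^ 2 =
      degree ρ ^ (-(γ * (1 - γ)) / (n : ℝ) ^ 2) := by
    rw [← Real.rpow_natCast, ← Real.rpow_mul hD0.le]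
    congr 1
    push_cast
    ring
  rw [← hsq]
  refine h.isSeparated hn hγ hγ' (by positivity) ?_
  have e : (2 : ℝ) ^ (4 / γ * (n : ℝ) ^ 2 * Real.logb 2 n) = (n : ℝ) ^ (4 / γ * (n : ℝ) ^ 2) := by
    rw [mul_comm, Real.rpow_mul (by norm_num), Real.rpow_logb (by norm_num) (by norm_num) hn0]
  rw [e] at hD
  have h1 : (n : ℝ) ≤ degree ρ ^ (γ * (1 - γ) / 2 / (n : ℝ) ^ 2) := by
    calc (n : ℝ) = (n : ℝ) ^ (1 : ℝ) := (Real.rpow_one _).symm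
      -- The exponent `2 (1 - γ)` is the product of `4n²/γ` and `γ(1-γ)/(2n²)`, and exceeds one
      -- because `γ < 1/2`.
      _ ≤ (n : ℝ) ^ (2 * (1 - γ)) := Real.rpow_le_rpow_of_exponent_le hn1 (by linarith)
      _ = ((n : ℝ) ^ (4 / γ * (n : ℝ) ^ 2)) ^ (γ * (1 - γ) / 2 / (n : ℝ) ^ 2) := by
          rw [← Real.rpow_mul hn0.le]
          congr 1
          field_simp
          ring
      _ ≤ _ := by
          refine Real.rpow_le_rpow (by positivity) hD.le ?_
          have : 0 < 1 - γ := by linarith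
          positivity
  rw [neg_div, Real.rpow_neg hD0.le, inv_mul_le_one₀ (by positivity)]
  exact h1

end UnitaryChar

/-! ### Assembly of the two bounds -/

theorem mainTheorem4 (n : ℕ) (hn : 2 ≤ n)
    (ρ : UnitaryChar.U n → ℂ) (hρ : ρ ∈ UnitaryChar.Irr (UnitaryChar.U n))
    (g : UnitaryChar.U n) :
    (∀ γ : ℝ, 0 < γ → γ < 1 / 2 →
      UnitaryChar.degree ρ > (2 : ℝ) ^ (16 / γ * (n : ℝ) ^ 2 * Real.logb 2 n) →
      UnitaryChar.IsSeparated γ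
        (UnitaryChar.degree ρ ^ (-(γ * (1 - γ)) / (n : ℝ) ^ 2)) g →
      ‖ρ g‖ ≤ UnitaryChar.degree ρ ^ (1 - γ * (1 - γ) / 2)) ∧
    (∀ β : ℝ, 0 < β → β < 1 →
      UnitaryChar.degree ρ > (2 : ℝ) ^ (8 / β * (n : ℝ) ^ 2 * Real.logb 2 n) →
      UnitaryChar.IsSpread β
        (UnitaryChar.degree ρ ^ (-(1 / 8 * (β * (2 - β))) / (n : ℝ) ^ 2)) g →
      ‖ρ g‖ ≤ UnitaryChar.degree ρ ^ (1 - β * (2 - β) / 8)) := by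
  refine ⟨fun γ hγ hγ' hD hsep => ?_, fun β hβ hβ' hD hspread => ?_⟩
  -- The constant `16/γ` is weakened to `4/γ`. In the spread case `γ = β/2` gives `4/γ = 8/β` with
  -- no slack.
  · refine UnitaryChar.norm_le_of_isSeparated hn hρ hγ hγ' (lt_of_le_of_lt ?_ hD) hsep
    have hlog : 0 ≤ Real.logb 2 n :=
      Real.logb_nonneg (by norm_num) (by exact_mod_cast (by omega : 1 ≤ n))
    refine Real.rpow_le_rpow_of_exponent_le (by norm_num) ?_
    gcongr
    norm_num
  · have h := UnitaryChar.norm_le_of_isSpread hn hρ (g := g) (γ := β / 2) (by linarith)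
      (by linarith)
    have e1 : 4 / (β / 2) = 8 / β := by field_simp; norm_num
    have e2 : 2 * (β / 2) = β := by ring
    have e3 : β / 2 * (1 - β / 2) / 2 = 1 / 8 * (β * (2 - β)) := by ring
    have e4 : 1 / 8 * (β * (2 - β)) = β * (2 - β) / 8 := by ring
    rw [e1, e2, e3] at h
    rw [← e4]
    exact h hD hspread
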